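/- Let $m\in\mathbb C$ with $\operatorname{Re} m>-1$. On the Hilbert space $L^2[0,\infty[$ consider: - the self-adjoint generator of dilations $A=\frac1{2\mathrm i}(x\partial_x+\partial_x x)$ (on its maximal domain, derivatives in the sense of distributions on $]0,\infty[$); functions of $A$ are understood in the sense of the Borel functional calculus; - the inversion $(\mathcal I f)(x)=x^{-1}f(x^{-1})$, and the operator $X^{-2}$ of multiplication by $x^{-2}$ with its maximal domain; - the Hankel transformation $(\mathcal F_m f)(k)=\int_0^\infty J_m(kx)\sqrt{kx}\,f(x)\,\mathrm dx$, where $J_m$ is the Bessel function and the integral is the $L^2$-limit of $\int_0^R$ as $R\to\infty$ (its domain being the set of $f\in L^2[0,\infty[$ for which $\int_0^R J_m(kx)\sqrt{kx}\,f(x)\,\mathrm dx$ converges absolutely for all $R,k>0$, is square integrable in $k$ for every $R$, and converges in $L^2$ as $R\to\infty$); - the homogeneous Schrödinger operator $H_m$: let $L_{\alpha}=-\partial_x^2+(-\frac14+\alpha)\frac1{x^2}$, let $L_{\alpha}^{\max}$ be its restriction to $\{f\in L^2[0,\infty[\,:\,L_\alpha f\in L^2[0,\infty[\}$ (in the sense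 of distributions on $]0,\infty[$) and $L_\alpha^{\min}$ the closure of its restriction to $C_{\mathrm c}^\infty]0,\infty[$; then $H_m$ is the restriction of $L_{m^2}^{\max}$ to $\operatorname{Dom}L_{m^2}^{\min}+\mathbb C\,x^{\frac12+m}\xi$, where $\xi$ is any smooth compactly supported cutoff equal to $1$ near $0$. Set $$\Xi_m(t)=\mathrm e^{\mathrm i\ln(2)t}\,\frac{\Gamma\big(\frac{m+1+\mathrm it}{2}\big)}{\Gamma\big(\frac{m+1-\mathrm it}{2}\big)},\qquad t\in\mathbb R .$$ Then $\Xi_m(A)$ is a well-defined bounded operator with bounded inverse $\Xi_m^{-1}(A)$ (where $\Xi_m^{-1}=1/\Xi_m$), $\mathcal F_m$ is defined on all of $L^2[0,\infty[$, and $$\mathcal F_m=\mathcal I\,\Xi_m(A)=\Xi_m^{-1}(A)\,\mathcal I .$$ Moreover, as an equality of unbounded operators (including domains), $$H_m=\Xi_m^{-1}(A)\,X^{-2}\,\Xi_m(A).$$ -/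

import Mathlib

open MeasureTheory Set Filter Topology
open scoped ContDiff

noncomputable section

/-! ### The Hilbert space and multiplication operators -/

/-- Lebesgue measure on the half-line `]0, ∞[`. -/
abbrev halfLine : Measure ℝ := volume.restrict (Ioi 0)

/-- The Hilbert space `L²[0, ∞[` of complex-valued functions. -/
abbrev HalfLineL2 : Type := Lp ℂ 2 halfLine

/-- The graph of the operator of multiplication by `a` on `L²(ν)`, with its maximal domain. -/
def mulGraph {α : Type*} [MeasurableSpace α] (ν : Measure α) (a : α → ℂ) :
    Submodule ℂ (Lp ℂ 2 ν × Lp ℂ 2 ν) where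
  carrier := {p | ⇑p.2 =ᵐ[ν] fun x => a x * p.1 x}
  zero_mem' := by
    show ⇑(0 : Lp ℂ 2 ν) =ᵐ[ν] fun x => a x * (0 : Lp ℂ 2 ν) x
    filter_upwards [Lp.coeFn_zero ℂ 2 ν] with x hx
    rw [hx]; simp
  add_mem' := by
    rintro ⟨f, g⟩ ⟨f', g'⟩ h h'
    show ⇑(g + g') =ᵐ[ν] fun x => a x * (f + f') x
    filter_upwards [Lp.coeFn_add f f', Lp.coeFn_add g g', h, h'] with x h1 h2 h3 h4
    simp only [h1, h2, Pi.add_apply] at *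
    rw [h3, h4]; ring
  smul_mem' := by
    rintro c ⟨f, g⟩ h
    show ⇑(c • g) =ᵐ[ν] fun x => a x * (c • f) x
    filter_upwards [Lp.coeFn_smul c f, Lp.coeFn_smul c g, h] with x h1 h2 h3
    simp only [h1, h2, Pi.smul_apply, smul_eq_mul] at *
    rw [h3]; ring

/-- The operator of multiplication by `a` on `L²(ν)`, with domain `{f | a f ∈ L²(ν)}`. -/
def mulOp {α : Type*} [MeasurableSpace α] (ν : Measure α) (a : α → ℂ) :
    Lp ℂ 2 ν →ₗ.[ℂ] Lp ℂ 2 ν :=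
  (mulGraph ν a).toLinearPMap

theorem mulOp_graph {α : Type*} [MeasurableSpace α] (ν : Measure α) (a : α → ℂ) :
    (mulOp ν a).graph = mulGraph ν a := by
  refine Submodule.toLinearPMap_graph_eq _ ?_
  rintro ⟨f, g⟩ h (rfl : f = 0)
  change ⇑g =ᵐ[ν] fun x => a x * (0 : Lp ℂ 2 ν) x at h
  refine Lp.ext ?_
  filter_upwards [h, Lp.coeFn_zero ℂ 2 ν] with x h1 h2
  rw [h1, h2]; simp

/-- The operator `W⁻¹ T W`, with domain `{f | W f ∈ Dom T}`. -/
def conjOp {E F : Type*} [AddCommGroup E] [Module ℂ E] [AddCommGroup F] [Module ℂ F]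
    (W : E ≃ₗ[ℂ] F) (T : F →ₗ.[ℂ] F) : E →ₗ.[ℂ] E where
  domain := T.domain.comap W.toLinearMap
  toFun := W.symm.toLinearMap ∘ₗ T.toFun ∘ₗ
    (W.toLinearMap.restrict (p := T.domain.comap W.toLinearMap) (q := T.domain) fun _ h => h)

/-! ### Functions of a self-adjoint operator -/

/-- `B = φ(T)` in the sense of the Borel functional calculus of a self-adjoint operator `T`:
some unitary `W` onto an `L²(ν)` turns `T` into multiplication by a real measurable function `h`
(the spectral theorem), and the same `W` turns `B` into multiplication by `φ ∘ h`. -/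
def IsFunctionOf {E : Type*} [NormedAddCommGroup E] [InnerProductSpace ℂ E]
    (T : E →ₗ.[ℂ] E) (φ : ℝ → ℂ) (B : E →L[ℂ] E) : Prop :=
  Measurable φ ∧
  ∃ (α : Type) (_ : MeasurableSpace α) (ν : Measure α) (W : E ≃ₗᵢ[ℂ] Lp ℂ 2 ν) (h : α → ℝ),
    Measurable h ∧
    T = conjOp W.toLinearEquiv (mulOp ν fun s => (h s : ℂ)) ∧
    ∀ f : E, ⇑(W (B f)) =ᵐ[ν] fun s => φ (h s) * W f s

/-! ### Differential operators on the half-line, in the sense of distributions -/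

/-- Test functions: elements of `C_c^∞ ]0, ∞[`. -/
structure IsTest (φ : ℝ → ℂ) : Prop where
  contDiff : ContDiff ℝ ∞ φ
  compact : HasCompactSupport φ
  supp : tsupport φ ⊆ Ioi 0

theorem IsTest.memLp {φ : ℝ → ℂ} (h : IsTest φ) : MemLp φ 2 halfLine :=
  (h.contDiff.continuous.memLp_of_hasCompactSupport h.compact).restrict _

theorem IsTest.integrable_mul {φ : ℝ → ℂ} (h : IsTest φ) (f : HalfLineL2) :
    Integrable (fun x => f x * φ x) halfLine :=
  (Lp.memLp f).integrable_mul h.memLp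

theorem IsTest.zero : IsTest 0 where
  contDiff := contDiff_const
  compact := HasCompactSupport.zero
  supp := by simp

theorem IsTest.add {φ ψ : ℝ → ℂ} (h : IsTest φ) (h' : IsTest ψ) : IsTest (φ + ψ) where
  contDiff := h.contDiff.add h'.contDiff
  compact := h.compact.add h'.compact
  supp := (tsupport_add φ ψ).trans (union_subset h.supp h'.supp)

theorem IsTest.mul_of_smooth {φ a : ℝ → ℂ} (h : IsTest φ)
    (ha : ∀ x, 0 < x → ContDiffAt ℝ ∞ a x) : IsTest (fun x => a x * φ x) where
  contDiff := by
    rw [contDiff_iff_contDiffAt]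
    intro x
    by_cases hx : x ∈ tsupport φ
    · exact (ha x (h.supp hx)).mul h.contDiff.contDiffAt
    · have h0 : (fun x => a x * φ x) =ᶠ[𝓝 x] fun _ => 0 := by
        filter_upwards [notMem_tsupport_iff_eventuallyEq.mp hx] with y hy
        simp [hy]
      exact contDiffAt_const.congr_of_eventuallyEq h0
  compact := h.compact.mul_left
  supp := (tsupport_mul_subset_right (f := a) (g := φ)).trans h.supp

theorem IsTest.deriv {φ : ℝ → ℂ} (h : IsTest φ) : IsTest (deriv φ) where
  contDiff := (contDiff_infty_iff_deriv.mp h.contDiff).2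
  compact := h.compact.deriv
  supp := tsupport_deriv_subset.trans h.supp

/-- `C_c^∞ ]0, ∞[` as a subspace of `L²[0, ∞[`. -/
def testSubmodule : Submodule ℂ HalfLineL2 where
  carrier := {f | ∃ φ : ℝ → ℂ, IsTest φ ∧ ⇑f =ᵐ[halfLine] φ}
  zero_mem' := ⟨0, IsTest.zero, Lp.coeFn_zero ℂ 2 halfLine⟩
  add_mem' := by
    rintro f g ⟨φ, hφ, hf⟩ ⟨ψ, hψ, hg⟩
    exact ⟨φ + ψ, hφ.add hψ, (Lp.coeFn_add f g).trans (hf.add hg)⟩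
  smul_mem' := by
    rintro c f ⟨φ, hφ, hf⟩
    refine ⟨fun x => c * φ x, hφ.mul_of_smooth fun x _ => contDiffAt_const, ?_⟩
    filter_upwards [Lp.coeFn_smul c f, hf] with x h1 h2
    simp [h1, h2]

/-- Given the formal transpose `P` of a differential expression `D`, the graph of its maximal
realization: all `(f, g)` in `L² × L²` with `D f = g` in the sense of distributions, that is
`∫ g φ = ∫ f (P φ)` for all test functions `φ`. -/
def weakGraph (P : (ℝ → ℂ) → ℝ → ℂ) (hP : ∀ φ, IsTest φ → IsTest (P φ)) :
    Submodule ℂ (HalfLineL2 × HalfLineL2) where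
  carrier := {p | ∀ φ : ℝ → ℂ, IsTest φ →
    ∫ x in Ioi (0 : ℝ), p.2 x * φ x = ∫ x in Ioi (0 : ℝ), p.1 x * P φ x}
  zero_mem' := by
    intro φ _
    have h : ∀ ψ : ℝ → ℂ, ∫ x in Ioi (0 : ℝ), (0 : HalfLineL2) x * ψ x = 0 := by
      intro ψ
      rw [← integral_zero ℝ ℂ (μ := halfLine)]
      refine integral_congr_ae ?_
      filter_upwards [Lp.coeFn_zero ℂ 2 halfLine] with x hx
      rw [hx]; simp
    exact (h φ).trans (h (P φ)).symm
  add_mem' := by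
    rintro ⟨f, g⟩ ⟨f', g'⟩ h h' φ hφ
    have key : ∀ (u v : HalfLineL2) (ψ : ℝ → ℂ), IsTest ψ →
        ∫ x in Ioi (0 : ℝ), (u + v) x * ψ x =
          (∫ x in Ioi (0 : ℝ), u x * ψ x) + ∫ x in Ioi (0 : ℝ), v x * ψ x := by
      intro u v ψ hψ
      rw [← integral_add (hψ.integrable_mul u) (hψ.integrable_mul v)]
      refine integral_congr_ae ?_
      filter_upwards [Lp.coeFn_add u v] with x hx
      rw [hx, Pi.add_apply, add_mul]
    have h1 := h φ hφ
    have h2 := h' φ hφ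
    show ∫ x in Ioi (0 : ℝ), (g + g') x * φ x = ∫ x in Ioi (0 : ℝ), (f + f') x * P φ x
    rw [key g g' φ hφ, key f f' _ (hP φ hφ)]
    exact congrArg₂ (· + ·) h1 h2
  smul_mem' := by
    rintro c ⟨f, g⟩ h φ hφ
    have key : ∀ (u : HalfLineL2) (ψ : ℝ → ℂ),
        ∫ x in Ioi (0 : ℝ), (c • u) x * ψ x = c * ∫ x in Ioi (0 : ℝ), u x * ψ x := by
      intro u ψ
      rw [← integral_const_mul]
      refine integral_congr_ae ?_
      filter_upwards [Lp.coeFn_smul c u] with x hx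
      simp [hx, mul_assoc]
    have h1 := h φ hφ
    show ∫ x in Ioi (0 : ℝ), (c • g) x * φ x = ∫ x in Ioi (0 : ℝ), (c • f) x * P φ x
    rw [key, key]
    exact congrArg (c * ·) h1

/-- The maximal realization on `L²[0, ∞[` of the differential expression with formal
transpose `P`. -/
def weakOp (P : (ℝ → ℂ) → ℝ → ℂ) (hP : ∀ φ, IsTest φ → IsTest (P φ)) :
    HalfLineL2 →ₗ.[ℂ] HalfLineL2 :=
  (weakGraph P hP).toLinearPMap

theorem weakOp_graph (P : (ℝ → ℂ) → ℝ → ℂ) (hP : ∀ φ, IsTest φ → IsTest (P φ)) :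
    (weakOp P hP).graph = weakGraph P hP := by
  refine Submodule.toLinearPMap_graph_eq _ ?_
  rintro ⟨f, g⟩ h (rfl : f = 0)
  have hg : ∀ᵐ x ∂(volume : Measure ℝ), x ∈ Ioi (0 : ℝ) → g x = 0 := by
    have hloc : LocallyIntegrable (⇑g) halfLine :=
      (Lp.memLp g).locallyIntegrable (by norm_num)
    refine isOpen_Ioi.ae_eq_zero_of_integral_contDiff_smul_eq_zero
      ((locallyIntegrableOn_iff isOpen_Ioi.isLocallyClosed).mpr ?_) ?_
    · intro k hk hkc
      have := hloc.integrableOn_isCompact hkc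
      rwa [IntegrableOn, Measure.restrict_restrict hkc.measurableSet,
        inter_eq_left.mpr hk] at this
    · intro ψ h1 h2 h3
      have hsub : tsupport (fun x => (ψ x : ℂ)) ⊆ tsupport ψ :=
        closure_mono fun x hx => by simpa using hx
      have hψ : IsTest (fun x => (ψ x : ℂ)) :=
        ⟨Complex.ofRealCLM.contDiff.comp h1,
          h2.comp_left (g := fun t : ℝ => (t : ℂ)) (by simp), hsub.trans h3⟩
      have h4 := h _ hψ
      have h5 : ∫ x in Ioi (0 : ℝ), (0 : HalfLineL2) x * P (fun x => (ψ x : ℂ)) x = 0 := by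
        rw [← integral_zero ℝ ℂ (μ := halfLine)]
        refine integral_congr_ae ?_
        filter_upwards [Lp.coeFn_zero ℂ 2 halfLine] with x hx
        rw [hx]; simp
      have h6 : ∫ x, ψ x • g x = ∫ x in Ioi (0 : ℝ), ψ x • g x := by
        rw [setIntegral_eq_integral_of_forall_compl_eq_zero]
        intro x hx
        rw [image_eq_zero_of_notMem_tsupport fun h => hx (h3 h), zero_smul]
      rw [h6, ← h5, ← h4]
      refine integral_congr_ae (ae_of_all _ fun x => ?_)
      simp [Complex.real_smul, mul_comm]
  refine Lp.ext ?_
  have hg' : ∀ᵐ x ∂halfLine, g x = 0 := (ae_restrict_iff' measurableSet_Ioi).mpr hg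
  filter_upwards [hg', Lp.coeFn_zero ℂ 2 halfLine] with x h1 h2
  rw [h1, h2, Pi.zero_apply]

/-- The formal transpose of `(1/2i) (x ∂ + ∂ x) = -i (x ∂ + 1/2)`, which is `i (x ∂ + 1/2)`. -/
def dilationTranspose (φ : ℝ → ℂ) (x : ℝ) : ℂ := Complex.I * (x * deriv φ x + φ x / 2)

theorem dilationTranspose_isTest (φ : ℝ → ℂ) (h : IsTest φ) : IsTest (dilationTranspose φ) := by
  have h1 : IsTest (fun x : ℝ => (Complex.I * x) * deriv φ x) :=
    h.deriv.mul_of_smooth fun x _ =>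
      contDiffAt_const.mul Complex.ofRealCLM.contDiff.contDiffAt
  have h2 : IsTest (fun x : ℝ => (Complex.I / 2) * φ x) :=
    h.mul_of_smooth fun x _ => contDiffAt_const
  convert h1.add h2 using 1
  funext x
  simp only [dilationTranspose, Pi.add_apply]
  ring

/-- The self-adjoint generator of dilations `A = (1/2i) (x ∂ + ∂ x)` on `L²[0, ∞[`. -/
def dilationGenerator : HalfLineL2 →ₗ.[ℂ] HalfLineL2 :=
  weakOp dilationTranspose dilationTranspose_isTest

/-- The differential expression `L_α = -∂² + (-1/4 + α) x⁻²`; it is its own formal transpose. -/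
def schrodingerExpr (α : ℂ) (φ : ℝ → ℂ) (x : ℝ) : ℂ :=
  -(deriv (deriv φ) x) + (-1 / 4 + α) / (x : ℂ) ^ 2 * φ x

theorem schrodingerExpr_isTest (α : ℂ) (φ : ℝ → ℂ) (h : IsTest φ) :
    IsTest (schrodingerExpr α φ) := by
  have h1 : IsTest (fun x : ℝ => (-1 : ℂ) * deriv (deriv φ) x) :=
    h.deriv.deriv.mul_of_smooth fun x _ => contDiffAt_const
  have h2 : IsTest (fun x : ℝ => ((-1 / 4 + α) / (x : ℂ) ^ 2) * φ x) :=
    h.mul_of_smooth fun x hx => by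
      have h3 : ContDiffAt ℝ ∞ (fun x : ℝ => (x : ℂ) ^ 2) x :=
        (Complex.ofRealCLM.contDiff.contDiffAt (x := x)).pow 2
      simp only [div_eq_mul_inv]
      exact contDiffAt_const.mul (h3.inv (pow_ne_zero 2 (Complex.ofReal_ne_zero.mpr hx.ne')))
  convert h1.add h2 using 1
  funext x
  simp [schrodingerExpr]

/-- The maximal operator `L_α^max`: all `f ∈ L²` with `L_α f ∈ L²`. -/
def LMax (α : ℂ) : HalfLineL2 →ₗ.[ℂ] HalfLineL2 :=
  weakOp (schrodingerExpr α) (schrodingerExpr_isTest α)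

/-- The minimal operator `L_α^min`: the closure of `L_α` on `C_c^∞ ]0, ∞[`. -/
def LMin (α : ℂ) : HalfLineL2 →ₗ.[ℂ] HalfLineL2 :=
  ((LMax α).domRestrict testSubmodule).closure

/-- The homogeneous Schrödinger operator `H_m`: the restriction of `L_{m²}^max` to
`Dom L_{m²}^min + ℂ x^{1/2+m} ξ`, where `ξ` is a cutoff. -/
def homogeneousSchrodinger (m : ℂ) (ξ : ℝ → ℝ) : HalfLineL2 →ₗ.[ℂ] HalfLineL2 :=
  (LMax (m ^ 2)).domRestrict ((LMin (m ^ 2)).domain ⊔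
    Submodule.span ℂ {f | ⇑f =ᵐ[halfLine] fun x => (x : ℂ) ^ (1 / 2 + m) * ξ x})

/-! ### The Hankel transformation -/

/-- The Bessel function `J_m` of complex order `m` on `]0, ∞[`. -/
def besselJ (m : ℂ) (x : ℝ) : ℂ :=
  ∑' n : ℕ, (-1) ^ n / (n.factorial * Complex.Gamma (n + m + 1)) * ((x / 2 : ℝ) : ℂ) ^ (2 * n + m)

/-- The truncated Hankel integral `k ↦ ∫_0^R J_m(kx) √(kx) f(x) dx`. -/
def hankelTrunc (m : ℂ) (R : ℝ) (f : ℝ → ℂ) (k : ℝ) : ℂ :=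
  ∫ x in Ioo 0 R, besselJ m (k * x) * (Real.sqrt (k * x) : ℂ) * f x

theorem ae_Ioo_of_halfLine (R : ℝ) {p : ℝ → Prop} (h : ∀ᵐ x ∂halfLine, p x) :
    ∀ᵐ x ∂volume.restrict (Ioo 0 R), p x :=
  ae_mono (Measure.restrict_mono (fun _ hx => hx.1) le_rfl) h

theorem hankelTrunc_congr (m : ℂ) (R : ℝ) {f g : ℝ → ℂ} (h : f =ᵐ[halfLine] g) :
    hankelTrunc m R f = hankelTrunc m R g := by
  funext k
  refine integral_congr_ae ?_
  filter_upwards [ae_Ioo_of_halfLine R h] with x hx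
  simp [hx]

/-- The graph of the Hankel transformation: `g = F_m f` when, for every `R`, the truncated
integrals converge absolutely and lie in `L²`, and they tend to `g` in `L²` as `R → ∞`. -/
def hankelGraph (m : ℂ) : Submodule ℂ (HalfLineL2 × HalfLineL2) where
  carrier := {p |
    (∀ R > 0, ∀ k > 0,
      IntegrableOn (fun x => besselJ m (k * x) * (Real.sqrt (k * x) : ℂ) * p.1 x) (Ioo 0 R)) ∧
    (∀ R > 0, MemLp (hankelTrunc m R p.1) 2 halfLine) ∧
    Tendsto (fun R => eLpNorm (hankelTrunc m R p.1 - ⇑p.2) 2 halfLine) atTop (𝓝 0)}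
  zero_mem' := by
    have h : ∀ R, hankelTrunc m R (0 : HalfLineL2) = 0 := fun R => by
      rw [hankelTrunc_congr m R (Lp.coeFn_zero ℂ 2 halfLine)]
      funext k
      simp [hankelTrunc]
    refine ⟨fun R _ k _ => ?_, fun R _ => ?_, ?_⟩
    · refine (integrable_zero ℝ ℂ (volume.restrict (Ioo 0 R))).congr ?_
      filter_upwards [ae_Ioo_of_halfLine R (Lp.coeFn_zero ℂ 2 halfLine)] with x hx
      show (0 : ℂ) = _ * (0 : HalfLineL2) x
      rw [hx]; simp
    · show MemLp (hankelTrunc m R (0 : HalfLineL2)) 2 halfLine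
      rw [h]; exact MemLp.zero
    · refine tendsto_const_nhds.congr fun R => ?_
      show 0 = eLpNorm (hankelTrunc m R (0 : HalfLineL2) - ⇑(0 : HalfLineL2)) 2 halfLine
      rw [h, eLpNorm_congr_ae ((ae_eq_refl _).sub (Lp.coeFn_zero ℂ 2 halfLine))]
      simp
  add_mem' := by
    rintro ⟨f, g⟩ ⟨f', g'⟩ ⟨h1, h2, h3⟩ ⟨h1', h2', h3'⟩
    have hint : ∀ R > 0, ∀ k > 0, IntegrableOn
        (fun x => besselJ m (k * x) * (Real.sqrt (k * x) : ℂ) * (f + f') x) (Ioo 0 R) := by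
      intro R hR k hk
      refine ((h1 R hR k hk).add (h1' R hR k hk)).congr ?_
      filter_upwards [ae_Ioo_of_halfLine R (Lp.coeFn_add f f')] with x hx
      rw [hx, Pi.add_apply, Pi.add_apply, mul_add]
    have hadd : ∀ R > 0,
        hankelTrunc m R ⇑(f + f') =ᵐ[halfLine] hankelTrunc m R f + hankelTrunc m R f' := by
      intro R hR
      filter_upwards [ae_restrict_mem measurableSet_Ioi] with k hk
      have e := integral_add (h1 R hR k hk) (h1' R hR k hk)
      rw [Pi.add_apply]
      refine Eq.trans ?_ e
      refine integral_congr_ae ?_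
      filter_upwards [ae_Ioo_of_halfLine R (Lp.coeFn_add f f')] with x hx
      rw [hx, Pi.add_apply, mul_add]
    refine ⟨hint, fun R hR => ((h2 R hR).add (h2' R hR)).ae_eq (hadd R hR).symm, ?_⟩
    have hlim := h3.add h3'
    rw [add_zero] at hlim
    refine tendsto_of_tendsto_of_tendsto_of_le_of_le' tendsto_const_nhds hlim
      (Eventually.of_forall fun _ => bot_le) ?_
    filter_upwards [eventually_gt_atTop (0 : ℝ)] with R hR
    have e : hankelTrunc m R ⇑(f + f') - ⇑(g + g') =ᵐ[halfLine]
        (hankelTrunc m R f - ⇑g) + (hankelTrunc m R f' - ⇑g') := by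
      filter_upwards [hadd R hR, Lp.coeFn_add g g'] with x hx hx'
      simp only [Pi.sub_apply, Pi.add_apply] at *
      rw [hx, hx']; ring
    show eLpNorm (hankelTrunc m R ⇑(f + f') - ⇑(g + g')) 2 halfLine ≤ _
    rw [eLpNorm_congr_ae e]
    exact eLpNorm_add_le ((h2 R hR).sub (Lp.memLp g)).1 ((h2' R hR).sub (Lp.memLp g')).1
      (by norm_num)
  smul_mem' := by
    rintro c ⟨f, g⟩ ⟨h1, h2, h3⟩
    have hint : ∀ R > 0, ∀ k > 0, IntegrableOn
        (fun x => besselJ m (k * x) * (Real.sqrt (k * x) : ℂ) * (c • f) x) (Ioo 0 R) := by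
      intro R hR k hk
      refine ((h1 R hR k hk).const_mul c).congr ?_
      filter_upwards [ae_Ioo_of_halfLine R (Lp.coeFn_smul c f)] with x hx
      simp only [hx, Pi.smul_apply, smul_eq_mul]
      ring
    have hsmul : ∀ R, hankelTrunc m R ⇑(c • f) = c • hankelTrunc m R f := by
      intro R
      rw [hankelTrunc_congr m R (Lp.coeFn_smul c f)]
      funext k
      simp only [hankelTrunc, Pi.smul_apply, smul_eq_mul]
      rw [← integral_const_mul]
      congr 1
      funext x
      ring
    refine ⟨hint, fun R hR => ?_, ?_⟩
    · show MemLp (hankelTrunc m R ⇑(c • f)) 2 halfLine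
      rw [hsmul]
      exact (h2 R hR).const_smul c
    · have hlim : Tendsto (fun R => ‖c‖ₑ * eLpNorm (hankelTrunc m R f - ⇑g) 2 halfLine)
          atTop (𝓝 (‖c‖ₑ * 0)) := ENNReal.Tendsto.const_mul h3 (Or.inr (by simp))
      rw [mul_zero] at hlim
      refine hlim.congr fun R => ?_
      show _ = eLpNorm (hankelTrunc m R ⇑(c • f) - ⇑(c • g)) 2 halfLine
      rw [eLpNorm_congr_ae ((ae_eq_refl _).sub (Lp.coeFn_smul c g)), hsmul, ← smul_sub,
        eLpNorm_const_smul]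

/-- The Hankel transformation `F_m f(k) = ∫_0^∞ J_m(kx) √(kx) f(x) dx` on `L²[0, ∞[`, the
integral being the limit in `L²` of the integrals over `]0, R[` as `R → ∞`. -/
def hankel (m : ℂ) : HalfLineL2 →ₗ.[ℂ] HalfLineL2 := (hankelGraph m).toLinearPMap

theorem hankel_graph (m : ℂ) : (hankel m).graph = hankelGraph m := by
  refine Submodule.toLinearPMap_graph_eq _ ?_
  rintro ⟨f, g⟩ ⟨_, _, h3⟩ (rfl : f = 0)
  have h : ∀ R, hankelTrunc m R (0 : HalfLineL2) = 0 := fun R => by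
    rw [hankelTrunc_congr m R (Lp.coeFn_zero ℂ 2 halfLine)]
    funext k
    simp [hankelTrunc]
  simp only [h, zero_sub, eLpNorm_neg] at h3
  have h4 : eLpNorm (⇑g) 2 halfLine = 0 := tendsto_nhds_unique tendsto_const_nhds h3
  rw [eLpNorm_eq_zero_iff (Lp.aestronglyMeasurable g) (by norm_num)] at h4
  exact (Lp.eq_zero_iff_ae_eq_zero).mpr h4

/-! ### The inversion and the function `Ξ_m` -/

theorem inversion_image : (fun x : ℝ => x⁻¹) '' Ioi 0 = Ioi 0 := by
  ext y
  constructor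
  · rintro ⟨x, hx, rfl⟩
    exact mem_Ioi.mpr (inv_pos.mpr (mem_Ioi.mp hx))
  · intro hy
    exact ⟨y⁻¹, mem_Ioi.mpr (inv_pos.mpr (mem_Ioi.mp hy)), inv_inv y⟩

theorem inversion_lintegral (u : ℝ → ENNReal) :
    ∫⁻ x in Ioi (0 : ℝ), ENNReal.ofReal (x⁻¹ ^ 2) * u x⁻¹ = ∫⁻ x in Ioi (0 : ℝ), u x := by
  have h := lintegral_image_eq_lintegral_abs_deriv_mul (s := Ioi (0 : ℝ))
    (f := fun x : ℝ => x⁻¹) (f' := fun x => -(x ^ 2)⁻¹) measurableSet_Ioi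
    (fun x hx => (hasDerivAt_inv (ne_of_gt hx)).hasDerivWithinAt)
    (inv_injective.injOn) u
  rw [inversion_image] at h
  rw [h]
  refine lintegral_congr fun x => ?_
  rw [abs_neg, abs_of_nonneg (by positivity), inv_pow]

theorem inversion_qmp : Measure.QuasiMeasurePreserving (fun x : ℝ => x⁻¹) halfLine halfLine := by
  refine ⟨measurable_inv, Measure.AbsolutelyContinuous.mk fun s hs h0 => ?_⟩
  rw [Measure.map_apply measurable_inv hs]
  have h := inversion_lintegral (s.indicator 1)
  rw [lintegral_indicator_one hs, h0, lintegral_eq_zero_iff (by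
    refine Measurable.mul (by fun_prop) ?_
    exact (measurable_one.indicator hs).comp measurable_inv)] at h
  refine measure_mono_null (t := {x | ¬ (x ∉ (fun x : ℝ => x⁻¹) ⁻¹' s)})
    (fun x hx => not_not.mpr hx) ?_
  refine ae_iff.mp ?_
  filter_upwards [h, ae_restrict_mem measurableSet_Ioi] with x hx hpos hxs
  have hpos' : 0 < x := hpos
  have hxs' : x⁻¹ ∈ s := hxs
  simp only [Pi.zero_apply, mul_eq_zero, indicator_of_mem hxs', Pi.one_apply, one_ne_zero,
    or_false, ENNReal.ofReal_eq_zero] at hx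
  exact absurd hx (not_le.mpr (by positivity))

theorem inversion_eLpNorm (f : ℝ → ℂ) :
    eLpNorm (fun x : ℝ => (x : ℂ)⁻¹ * f x⁻¹) 2 halfLine = eLpNorm f 2 halfLine := by
  rw [eLpNorm_eq_lintegral_rpow_enorm_toReal (by norm_num) (by norm_num),
    eLpNorm_eq_lintegral_rpow_enorm_toReal (by norm_num) (by norm_num)]
  congr 1
  rw [← inversion_lintegral fun x => ‖f x‖ₑ ^ (2 : ENNReal).toReal]
  refine setLIntegral_congr_fun measurableSet_Ioi fun x hx => ?_
  have hx' : 0 < x := hx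
  have h1 : ‖(x : ℂ)⁻¹‖ₑ = ENNReal.ofReal x⁻¹ := by
    rw [← ofReal_norm, norm_inv, Complex.norm_real, Real.norm_of_nonneg hx'.le]
  simp only [enorm_mul, h1]
  rw [ENNReal.mul_rpow_of_nonneg _ _ (by norm_num)]
  congr 1
  rw [ENNReal.ofReal_pow (by positivity)]
  simp

theorem inversion_memLp (f : HalfLineL2) :
    MemLp (fun x : ℝ => (x : ℂ)⁻¹ * f x⁻¹) 2 halfLine := by
  refine ⟨?_, ?_⟩
  · refine AEStronglyMeasurable.mul ?_ ?_
    · exact (Complex.measurable_ofReal.inv).aestronglyMeasurable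
    · exact (Lp.aestronglyMeasurable f).comp_quasiMeasurePreserving inversion_qmp
  · rw [inversion_eLpNorm]
    exact (Lp.memLp f).2

/-- The inversion `(I f)(x) = x⁻¹ f(x⁻¹)` on `L²[0, ∞[`. -/
def inversion : HalfLineL2 →ₗᵢ[ℂ] HalfLineL2 where
  toFun f := (inversion_memLp f).toLp _
  map_add' f g := by
    refine Lp.ext ?_
    filter_upwards [(inversion_memLp (f + g)).coeFn_toLp, (inversion_memLp f).coeFn_toLp,
      (inversion_memLp g).coeFn_toLp, inversion_qmp.ae (Lp.coeFn_add f g),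
      Lp.coeFn_add ((inversion_memLp f).toLp _) ((inversion_memLp g).toLp _)] with x h1 h2 h3 h4 h5
    rw [h1, h5, Pi.add_apply, h2, h3, h4, Pi.add_apply, mul_add]
  map_smul' c f := by
    refine Lp.ext ?_
    filter_upwards [(inversion_memLp (c • f)).coeFn_toLp, (inversion_memLp f).coeFn_toLp,
      inversion_qmp.ae (Lp.coeFn_smul c f),
      Lp.coeFn_smul c ((inversion_memLp f).toLp _)] with x h1 h2 h3 h4
    rw [RingHom.id_apply, h1, h4, Pi.smul_apply, h2, h3, Pi.smul_apply, smul_eq_mul, smul_eq_mul]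
    ring
  norm_map' f := by
    show ‖(inversion_memLp f).toLp _‖ = ‖f‖
    rw [Lp.norm_toLp, inversion_eLpNorm, Lp.norm_def]

/-- `Ξ_m(t) = e^{i ln(2) t} Γ((m+1+it)/2) / Γ((m+1-it)/2)`. -/
def Xi (m : ℂ) (t : ℝ) : ℂ :=
  Complex.exp (Complex.I * Real.log 2 * t) *
    (Complex.Gamma ((m + 1 + Complex.I * t) / 2) / Complex.Gamma ((m + 1 - Complex.I * t) / 2))

end

/-! ### Quotients of Gamma functions on vertical lines -/

/-! In the coordinate `x = e^{-u}` the generator `A` becomes `i d/du` on `L²(ℝ)`, and the Fourier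
transformation then turns it into multiplication by `-2πx`. The composite is the Mellin
transformation on the line `Re s = 1/2`. It diagonalizes every function of `A` and turns the
inversion into the reflection `x ↦ -x`. Since `Ξ_m(t)⁻¹ = Ξ_m(-t)`, the identity `I Ξ_m(A) =
Ξ_m⁻¹(A) I` is immediate, and this operator `F` is an involution. Boundedness of `Ξ_m` is a
comparison of `|Γ|` at two points of a vertical line whose distance is fixed
(`Complex.norm_Gamma_vertical_le`). Because functions of `A` are defined through an arbitrary
diagonalization, independence of that choice is needed (`IsFunctionOf.unique`).

Everything else is tested on the Gaussians `g_a = x^{m+1/2} e^{-a x²/2}`. Their Mellin transforms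
are Gamma functions, so that `F g_a = a^{-(m+1)} g_{1/a}` (`hankelCLM_gaussL2`) and `F L g_a = x² F
g_a` (`hankelCLM_gaussLap`), where `L` is the Schrödinger expression. They determine functions on
the half-line by Weierstrass approximation in the variable `e^{-x²/2}`
(`ae_zero_of_integral_gauss`).

Hankel transformation: termwise integration of the Bessel series against `g_a` gives again
`a^{-(m+1)} g_{1/a}`. With Fubini and the symmetry of `F` for the bilinear pairing
(`pairing_hankelCLM`), the truncated integral of `f` is `F` applied to the truncation of `f`
(`hankelTrunc_ae_eq`). Boundedness of `F` then gives the limit `R → ∞` on all of `L²`. No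
asymptotics of Bessel functions are needed.

Schrödinger operator: let `K = Ξ_m⁻¹(A) X⁻² Ξ_m(A) = F X² F`. Pairing with Gaussians shows `L^min ⊆
K` (`LMin_graph_le_hankelConj`), and the Gaussians span a core of `K` (`hankelConj_graph_le`). Each
`g_a` differs from `x^{m+1/2} ξ` by an element of `Dom L^min` (`exists_mem_LMin_graph_gaussL2_sub`).
Hence `H_m ⊆ K`; conversely the graph of `L^min` plus one line is closed and contains the core. The
argument is the same for all `m` with `Re m > -1`. -/

theorem sum_inv_add_sq_le {c : ℝ} (hc : 0 < c) (n : ℕ) :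
    ∑ j ∈ Finset.range (n + 1), 1 / (c + j) ^ 2 ≤ 1 / c ^ 2 + 1 / c - 1 / (c + n) := by
  induction n with
  | zero => simp
  | succ n ih =>
    rw [Finset.sum_range_succ]
    have h1 : 0 < c + n := by positivity
    have h2 : 0 < c + (n + 1 : ℕ) := by positivity
    have h3 : 1 / (c + (n + 1 : ℕ)) ^ 2 ≤ 1 / (c + n) - 1 / (c + (n + 1 : ℕ)) := by
      rw [div_sub_div _ _ h1.ne' h2.ne', div_le_div_iff₀ (by positivity) (by positivity)]
      push_cast at *
      nlinarith
    linarith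

/-- For the squared moduli, the shift by `b` adds at most `b² + 2|b||y|`, while `(σ + |y| + j)² ≤
2((σ + j)² + y²)`. Expressing the relative error through `σ + |y| + j` makes its sum over `j`
telescope. -/
theorem Complex.norm_add_natCast_le_exp {σ y b : ℝ} (hσ : 0 < σ) (j : ℕ) :
    ‖(σ + (y - b : ℝ) * Complex.I + j : ℂ)‖ ≤ ‖(σ + y * Complex.I + j : ℂ)‖ *
      Real.exp (2 * (b ^ 2 + 2 * |b| * |y|) * (1 / (σ + |y| + j) ^ 2)) := by
  have key : ∀ u : ℝ, ‖(σ + u * Complex.I + j : ℂ)‖ ^ 2 = (σ + j) ^ 2 + u ^ 2 := fun u => by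
    rw [Complex.sq_norm, Complex.normSq_apply]
    simp
    ring
  set e := 2 * (b ^ 2 + 2 * |b| * |y|) * (1 / (σ + |y| + j) ^ 2) with he
  have he0 : 0 ≤ e := by positivity
  have h1 : (σ + j) ^ 2 + (y - b) ^ 2 ≤ ((σ + j) ^ 2 + y ^ 2) * (1 + e) := by
    have hy : y ^ 2 = |y| ^ 2 := (sq_abs y).symm
    have h2 : (σ + |y| + j) ^ 2 ≤ 2 * ((σ + j) ^ 2 + y ^ 2) := by
      rw [hy]; nlinarith [sq_nonneg (σ + j - |y|)]
    have h3 : b ^ 2 + 2 * |b| * |y| ≤ ((σ + j) ^ 2 + y ^ 2) * e := by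
      have h4 : 0 < (σ + |y| + j) ^ 2 := by positivity
      rw [he, mul_one_div, mul_div_assoc', le_div_iff₀ h4]
      have : 0 ≤ b ^ 2 + 2 * |b| * |y| := by positivity
      nlinarith
    have h5 : -(y * b) ≤ |b| * |y| := by
      rw [← abs_mul, mul_comm]; exact neg_le_abs _
    nlinarith
  refine le_of_sq_le_sq ?_ (by positivity)
  rw [mul_pow, key, key]
  refine h1.trans (mul_le_mul_of_nonneg_left ?_ (by positivity))
  have h6 := Real.add_one_le_exp e
  have h7 : 1 ≤ Real.exp e := Real.one_le_exp he0
  nlinarith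

/-- In Euler's limit formula `|n^s|` depends only on `σ`, so the ratio of the two moduli is a
product of ratios of linear factors. The exponents contain `b² + 2|b||y|`, which grows with `y`, but
the sum of `1/(σ + |y| + j)²` decays like `1/|y|`. The two effects balance and the bound is uniform
in `y` and `n`. -/
theorem Complex.norm_Gamma_vertical_le {σ : ℝ} (hσ : 0 < σ) (b : ℝ) :
    ∃ C : ℝ, 0 < C ∧ ∀ y : ℝ, ‖Complex.Gamma (σ + y * Complex.I)‖ ≤
      C * ‖Complex.Gamma (σ + (y - b : ℝ) * Complex.I)‖ := by
  refine ⟨Real.exp (2 * (b ^ 2 / σ + 2 * |b|) * (1 / σ + 1)), Real.exp_pos _, fun y => ?_⟩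
  set C := Real.exp (2 * (b ^ 2 / σ + 2 * |b|) * (1 / σ + 1))
  refine le_of_tendsto_of_tendsto (Complex.GammaSeq_tendsto_Gamma _).norm
    ((Complex.GammaSeq_tendsto_Gamma _).norm.const_mul C) ?_
  filter_upwards [eventually_gt_atTop 0] with n hn
  have hc : 0 < σ + |y| := by positivity
  have hprod : ∏ j ∈ Finset.range (n + 1), ‖(σ + (y - b : ℝ) * Complex.I + j : ℂ)‖ ≤
      (∏ j ∈ Finset.range (n + 1), ‖(σ + y * Complex.I + j : ℂ)‖) * C := by
    refine (Finset.prod_le_prod (fun _ _ => norm_nonneg _)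
      fun j _ => Complex.norm_add_natCast_le_exp hσ j).trans ?_
    rw [Finset.prod_mul_distrib, ← Real.exp_sum, ← Finset.mul_sum]
    refine mul_le_mul_of_nonneg_left (Real.exp_le_exp.mpr ?_)
      (Finset.prod_nonneg fun _ _ => norm_nonneg _)
    have h1 := sum_inv_add_sq_le hc n
    have h2 : (0:ℝ) ≤ 1 / (σ + |y| + n) := by positivity
    calc 2 * (b ^ 2 + 2 * |b| * |y|) * ∑ j ∈ Finset.range (n + 1), 1 / (σ + |y| + j) ^ 2
        ≤ 2 * (b ^ 2 + 2 * |b| * |y|) * (1 / (σ + |y|) ^ 2 + 1 / (σ + |y|)) :=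
          mul_le_mul_of_nonneg_left (by linarith) (by positivity)
      _ = 2 * ((b ^ 2 + 2 * |b| * |y|) / (σ + |y|)) * (1 / (σ + |y|) + 1) := by
          field_simp
      _ ≤ 2 * (b ^ 2 / σ + 2 * |b|) * (1 / σ + 1) := by
          have h3 : σ ≤ σ + |y| := by simp
          have h4 : (b ^ 2 + 2 * |b| * |y|) / (σ + |y|) ≤ b ^ 2 / σ + 2 * |b| := by
            rw [add_div]
            refine add_le_add (by gcongr) ?_
            rw [div_le_iff₀ hc]
            nlinarith [abs_nonneg b, abs_nonneg y, mul_nonneg (abs_nonneg b) hσ.le]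
          gcongr
  have hpos : ∀ u : ℝ, 0 < ∏ j ∈ Finset.range (n + 1), ‖(σ + u * Complex.I + j : ℂ)‖ := by
    intro u
    refine Finset.prod_pos fun j _ => norm_pos_iff.mpr fun h => ?_
    have := congrArg Complex.re h
    simp at this
    have : (0:ℝ) ≤ j := by positivity
    linarith
  have hn' : (0:ℝ) < n := by exact_mod_cast hn
  have hGs : ∀ u : ℝ, ‖Complex.GammaSeq (σ + u * Complex.I) n‖ = (n:ℝ) ^ σ * n.factorial /
      ∏ j ∈ Finset.range (n + 1), ‖(σ + u * Complex.I + j : ℂ)‖ := by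
    intro u
    rw [Complex.GammaSeq, norm_div, norm_mul, norm_prod, Complex.norm_natCast,
      Complex.norm_natCast_cpow_of_pos hn]
    simp
  rw [hGs, hGs, mul_div_assoc', div_le_div_iff₀ (hpos _) (hpos _)]
  calc _ ≤ (n:ℝ) ^ σ * n.factorial * ((∏ j ∈ Finset.range (n + 1), ‖(σ + y * Complex.I + j : ℂ)‖) * C) :=
        mul_le_mul_of_nonneg_left hprod (by positivity)
    _ = _ := by ring

/-! ### The function `Ξ_m` -/

theorem Xi_numerator_ne_zero {m : ℂ} (hm : -1 < m.re) (t : ℝ) : Complex.Gamma ((m + 1 + Complex.I * t) / 2) ≠ 0 := by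
  refine Complex.Gamma_ne_zero_of_re_pos ?_
  simp
  linarith

theorem Xi_denominator_ne_zero {m : ℂ} (hm : -1 < m.re) (t : ℝ) : Complex.Gamma ((m + 1 - Complex.I * t) / 2) ≠ 0 := by
  simpa [← sub_eq_add_neg] using Xi_numerator_ne_zero hm (-t)

theorem Xi_ne_zero {m : ℂ} (hm : -1 < m.re) (t : ℝ) : Xi m t ≠ 0 :=
  mul_ne_zero (Complex.exp_ne_zero _)
    (div_ne_zero (Xi_numerator_ne_zero hm t) (Xi_denominator_ne_zero hm t))

/-- This symmetry makes every bound on `Ξ_m` a bound on its inverse. It also produces the second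
factorization of the Hankel transformation, because the inversion conjugates `A` to `-A`. -/
theorem Xi_inv {m : ℂ} (hm : -1 < m.re) (t : ℝ) : (Xi m t)⁻¹ = Xi m (-t) := by
  have h1 := Xi_numerator_ne_zero hm t
  have h2 := Xi_denominator_ne_zero hm t
  simp only [Xi, Complex.ofReal_neg, mul_neg, sub_neg_eq_add, ← sub_eq_add_neg, Complex.exp_neg]
  rw [mul_inv, inv_div]

theorem continuous_Xi {m : ℂ} (hm : -1 < m.re) : Continuous (Xi m) := by
  have h : ∀ s : ℂ, 0 < s.re → ContinuousAt Complex.Gamma s := fun s hs =>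
    (Complex.differentiableAt_Gamma s fun n h => by
      rw [h] at hs; simp at hs; linarith [(Nat.cast_nonneg n : (0:ℝ) ≤ n)]).continuousAt
  refine Continuous.mul (by fun_prop) (Continuous.div ?_ ?_ (Xi_denominator_ne_zero hm))
  · refine continuous_iff_continuousAt.mpr fun t =>
      ContinuousAt.comp (f := fun t : ℝ => (m + 1 + Complex.I * t) / 2) (h _ ?_) (by fun_prop)
    simp; linarith
  · refine continuous_iff_continuousAt.mpr fun t =>
      ContinuousAt.comp (f := fun t : ℝ => (m + 1 - Complex.I * t) / 2) (h _ ?_) (by fun_prop)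
    simp; linarith

/-- Complex conjugation moves the denominator to the vertical line of the numerator, at a point
lower by exactly `Im m`. For real `m` the modulus is 1; otherwise the comparison of Gamma functions
at distance `Im m` applies. -/
theorem Xi_bounded {m : ℂ} (hm : -1 < m.re) : ∃ C : ℝ, ∀ t, ‖Xi m t‖ ≤ C := by
  obtain ⟨C, hC, h⟩ := Complex.norm_Gamma_vertical_le (σ := (m.re + 1) / 2) (by linarith) m.im
  refine ⟨C, fun t => ?_⟩
  have h1 : ‖Complex.exp (Complex.I * Real.log 2 * t)‖ = 1 := by
    rw [Complex.norm_exp]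
    simp only [Complex.mul_re, Complex.mul_im, Complex.I_re, Complex.I_im, Complex.ofReal_re,
      Complex.ofReal_im]
    simp
  rw [Xi, norm_mul, h1, one_mul, norm_div, div_le_iff₀ (norm_pos_iff.mpr (Xi_denominator_ne_zero hm t))]
  have h2 : (m + 1 + Complex.I * t) / 2 =
      ((m.re + 1) / 2 : ℝ) + ((m.im + t) / 2 : ℝ) * Complex.I := by
    apply Complex.ext <;> simp
  have h3 : (m + 1 - Complex.I * t) / 2 = (starRingEnd ℂ)
      (((m.re + 1) / 2 : ℝ) + ((m.im + t) / 2 - m.im : ℝ) * Complex.I) := by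
    rw [Complex.ext_iff, Complex.conj_re, Complex.conj_im]
    constructor
    · simp
    · simp
      ring
  rw [h2, h3, Complex.Gamma_conj, Complex.norm_conj]
  exact h _

/-! ### Bounded multiplication operators -/

theorem memLp_bounded_mul {α : Type*} [MeasurableSpace α] {ν : Measure α} {a : α → ℂ}
    (ha : Measurable a) {C : ℝ} (hC : ∀ s, ‖a s‖ ≤ C) (f : Lp ℂ 2 ν) :
    MemLp (fun s => a s * f s) 2 ν := by
  refine (Lp.memLp f).of_le_mul (c := C)
    (ha.aestronglyMeasurable.mul (Lp.aestronglyMeasurable f)) (ae_of_all _ fun s => ?_)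
  rw [norm_mul]
  exact mul_le_mul_of_nonneg_right (hC s) (norm_nonneg _)

/-- Multiplication by a bounded measurable function, as a bounded operator on `L²(ν)`. -/
noncomputable def boundedMul {α : Type*} [MeasurableSpace α] (ν : Measure α) (a : α → ℂ)
    (ha : Measurable a) (C : ℝ) (hC : ∀ s, ‖a s‖ ≤ C) : Lp ℂ 2 ν →L[ℂ] Lp ℂ 2 ν :=
  LinearMap.mkContinuous
    { toFun := fun f => (memLp_bounded_mul ha hC f).toLp _
      map_add' := fun f g => by
        refine Lp.ext ?_
        filter_upwards [(memLp_bounded_mul ha hC (f + g)).coeFn_toLp,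
          (memLp_bounded_mul ha hC f).coeFn_toLp, (memLp_bounded_mul ha hC g).coeFn_toLp,
          Lp.coeFn_add f g, Lp.coeFn_add ((memLp_bounded_mul ha hC f).toLp _)
            ((memLp_bounded_mul ha hC g).toLp _)] with s h1 h2 h3 h4 h5
        rw [h1, h5, Pi.add_apply, h2, h3, h4, Pi.add_apply, mul_add]
      map_smul' := fun c f => by
        refine Lp.ext ?_
        filter_upwards [(memLp_bounded_mul ha hC (c • f)).coeFn_toLp,
          (memLp_bounded_mul ha hC f).coeFn_toLp, Lp.coeFn_smul c f,
          Lp.coeFn_smul c ((memLp_bounded_mul ha hC f).toLp _)] with s h1 h2 h3 h4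
        rw [RingHom.id_apply, h1, h4, Pi.smul_apply, h2, h3, Pi.smul_apply, smul_eq_mul,
          smul_eq_mul]
        ring } C fun f => by
      refine Lp.norm_le_mul_norm_of_ae_le_mul ?_
      filter_upwards [(memLp_bounded_mul ha hC f).coeFn_toLp] with s h1
      refine (congrArg norm h1).trans_le ?_
      rw [norm_mul]
      exact mul_le_mul_of_nonneg_right (hC s) (norm_nonneg _)

theorem boundedMul_coe {α : Type*} [MeasurableSpace α] {ν : Measure α} {a : α → ℂ}
    (ha : Measurable a) {C : ℝ} (hC : ∀ s, ‖a s‖ ≤ C) (f : Lp ℂ 2 ν) :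
    ⇑(boundedMul ν a ha C hC f) =ᵐ[ν] fun s => a s * f s :=
  (memLp_bounded_mul ha hC f).coeFn_toLp

/-! ### Uniqueness of the functional calculus -/

theorem mem_conjOp_graph {E F : Type*} [AddCommGroup E] [Module ℂ E] [AddCommGroup F] [Module ℂ F]
    (W : E ≃ₗ[ℂ] F) (T : F →ₗ.[ℂ] F) (p : E × E) :
    p ∈ (conjOp W T).graph ↔ (W p.1, W p.2) ∈ T.graph := by
  obtain ⟨x, y⟩ := p
  constructor
  · intro h
    obtain ⟨z, hz, hz'⟩ := (LinearPMap.mem_graph_iff _).mp h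
    have hz2 : (z : E) = x := hz
    have hz3 : W.symm (T ⟨W z, z.2⟩) = y := hz'
    refine (LinearPMap.mem_graph_iff _).mpr ⟨⟨W z, z.2⟩, ?_, ?_⟩
    · rw [← hz2]
    · rw [← hz3, W.apply_symm_apply]
  · intro h
    obtain ⟨z, hz, hz'⟩ := (LinearPMap.mem_graph_iff _).mp h
    have hx : W x ∈ T.domain := by
      have : (z : F) = W x := hz
      rw [← this]; exact z.2
    refine (LinearPMap.mem_graph_iff _).mpr ⟨⟨x, hx⟩, rfl, ?_⟩
    show W.symm (T ⟨W x, hx⟩) = y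
    rw [LinearEquiv.symm_apply_eq]
    rw [← (show T z = W y from hz')]
    congr 1
    exact Subtype.ext hz.symm

/-- The Cayley transform, from the real line to the unit circle. -/
noncomputable def cayley (t : ℝ) : Metric.sphere (0 : ℂ) 1 :=
  ⟨(t - Complex.I) / (t + Complex.I), by
    have h1 : ‖(t - Complex.I : ℂ)‖ = ‖(t + Complex.I : ℂ)‖ := by
      rw [← Complex.norm_conj]; simp
    have h2 : (t + Complex.I : ℂ) ≠ 0 := fun h => by simpa using congrArg Complex.im h
    rw [mem_sphere_zero_iff_norm, norm_div, h1, div_self (norm_ne_zero_iff.mpr h2)]⟩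

theorem ofReal_add_I_ne_zero (t : ℝ) : (t + Complex.I : ℂ) ≠ 0 := fun h => by
  simpa using congrArg Complex.im h

theorem continuous_cayley : Continuous cayley :=
  Continuous.subtype_mk (Continuous.div (by fun_prop) (by fun_prop) ofReal_add_I_ne_zero) _

/-- The operator `c(u)` where `u` is the Cayley transform of multiplication by `h`. -/
noncomputable def circleMul {α : Type*} [MeasurableSpace α] (ν : Measure α) {h : α → ℝ}
    (hh : Measurable h) (c : C(Metric.sphere (0 : ℂ) 1, ℂ)) : Lp ℂ 2 ν →L[ℂ] Lp ℂ 2 ν :=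
  boundedMul ν (fun s => c (cayley (h s)))
    ((c.continuous.comp continuous_cayley).measurable.comp hh) ‖c‖ fun _ => c.norm_coe_le_norm _

theorem circleMul_coe {α : Type*} [MeasurableSpace α] (ν : Measure α) {h : α → ℝ}
    (hh : Measurable h) (c : C(Metric.sphere (0 : ℂ) 1, ℂ)) (f : Lp ℂ 2 ν) :
    ⇑(circleMul ν hh c f) =ᵐ[ν] fun s => c (cayley (h s)) * f s :=
  boundedMul_coe _ _ f

theorem circleMul_const {α : Type*} [MeasurableSpace α] (ν : Measure α) {h : α → ℝ}
    (hh : Measurable h) (r : ℂ) (f : Lp ℂ 2 ν) : circleMul ν hh (.const _ r) f = r • f := by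
  refine Lp.ext ?_
  filter_upwards [circleMul_coe ν hh (.const _ r) f, Lp.coeFn_smul r f] with s h1 h2
  rw [h1, h2]; simp

theorem circleMul_add {α : Type*} [MeasurableSpace α] (ν : Measure α) {h : α → ℝ}
    (hh : Measurable h) (c d : C(Metric.sphere (0 : ℂ) 1, ℂ)) (f : Lp ℂ 2 ν) :
    circleMul ν hh (c + d) f = circleMul ν hh c f + circleMul ν hh d f := by
  refine Lp.ext ?_
  filter_upwards [circleMul_coe ν hh (c + d) f, circleMul_coe ν hh c f, circleMul_coe ν hh d f,
    Lp.coeFn_add (circleMul ν hh c f) (circleMul ν hh d f)] with s h1 h2 h3 h4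
  rw [h1, h4, Pi.add_apply, h2, h3, ContinuousMap.add_apply, add_mul]

theorem circleMul_mul {α : Type*} [MeasurableSpace α] (ν : Measure α) {h : α → ℝ}
    (hh : Measurable h) (c d : C(Metric.sphere (0 : ℂ) 1, ℂ)) (f : Lp ℂ 2 ν) :
    circleMul ν hh (c * d) f = circleMul ν hh c (circleMul ν hh d f) := by
  refine Lp.ext ?_
  filter_upwards [circleMul_coe ν hh (c * d) f, circleMul_coe ν hh d f,
    circleMul_coe ν hh c (circleMul ν hh d f)] with s h1 h2 h3
  rw [h1, h3, h2, ContinuousMap.mul_apply, mul_assoc]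

theorem continuous_circleMul {α : Type*} [MeasurableSpace α] (ν : Measure α) {h : α → ℝ}
    (hh : Measurable h) (f : Lp ℂ 2 ν) : Continuous fun c => circleMul ν hh c f := by
  have key : ∀ c d, ‖circleMul ν hh c f - circleMul ν hh d f‖ ≤ ‖c - d‖ * ‖f‖ := by
    intro c d
    have h1 : circleMul ν hh c f - circleMul ν hh d f = circleMul ν hh (c - d) f := by
      rw [sub_eq_iff_eq_add, ← circleMul_add, sub_add_cancel]
    rw [h1]
    refine Lp.norm_le_mul_norm_of_ae_le_mul ?_
    filter_upwards [circleMul_coe ν hh (c - d) f] with s h1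
    rw [h1, norm_mul]
    exact mul_le_mul_of_nonneg_right ((c - d).norm_coe_le_norm _) (norm_nonneg _)
  refine (LipschitzWith.of_dist_le_mul (K := ‖f‖₊) fun c d => ?_).continuous
  rw [dist_eq_norm, dist_eq_norm, mul_comm]
  exact key c d

/-- An isometry intertwining multiplication by `h₁` and by `h₂` intertwines all continuous
functions of their Cayley transforms. -/
theorem circleMul_intertwine {α β : Type*} [MeasurableSpace α] [MeasurableSpace β]
    {ν₁ : Measure α} {ν₂ : Measure β} {h₁ : α → ℝ} {h₂ : β → ℝ} (hh₁ : Measurable h₁)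
    (hh₂ : Measurable h₂) (U : Lp ℂ 2 ν₁ →L[ℂ] Lp ℂ 2 ν₂)
    (hU : ∀ f g : Lp ℂ 2 ν₁, ⇑g =ᵐ[ν₁] (fun s => (h₁ s : ℂ) * f s) →
      ⇑(U g) =ᵐ[ν₂] fun s => (h₂ s : ℂ) * U f s)
    (c : C(Metric.sphere (0 : ℂ) 1, ℂ)) (f : Lp ℂ 2 ν₁) :
    U (circleMul ν₁ hh₁ c f) = circleMul ν₂ hh₂ c (U f) := by
  set z : C(Metric.sphere (0 : ℂ) 1, ℂ) := .restrict (Metric.sphere (0 : ℂ) 1) (.id ℂ) with hz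
  have hid : ∀ f, U (circleMul ν₁ hh₁ z f) = circleMul ν₂ hh₂ z (U f) := by
    intro f
    set g := circleMul ν₁ hh₁ z f with hg
    -- For `z = (h - i)/(h + i)` one has `h (1 - z) = i (1 + z)`. Thus `f - z f` lies in the domain
    -- of multiplication by `h₁` and is sent to `i (f + z f)`. The image of this relation under `U`
    -- can be solved for `U (z f)`.
    have h1 := hU (f - g) (Complex.I • (f + g)) (by
      filter_upwards [circleMul_coe ν₁ hh₁ z f, Lp.coeFn_sub f g, Lp.coeFn_add f g,
        Lp.coeFn_smul Complex.I (f + g)] with s h1 h2 h3 h4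
      rw [← hg] at h1
      rw [h4, Pi.smul_apply, h3, h2, Pi.add_apply, Pi.sub_apply, h1]
      simp only [hz, cayley, ContinuousMap.restrict_apply, ContinuousMap.id_apply, smul_eq_mul]
      have := ofReal_add_I_ne_zero (h₁ s)
      field_simp
      ring)
    rw [map_sub, map_smul, map_add] at h1
    refine Lp.ext ?_
    filter_upwards [h1, circleMul_coe ν₂ hh₂ z (U f), Lp.coeFn_sub (U f) (U g),
      Lp.coeFn_add (U f) (U g), Lp.coeFn_smul Complex.I (U f + U g)] with s h1 h2 h3 h4 h5
    rw [h2]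
    rw [h5, Pi.smul_apply, h4, h3, Pi.add_apply, Pi.sub_apply, smul_eq_mul] at h1
    simp only [hz, cayley, ContinuousMap.restrict_apply, ContinuousMap.id_apply]
    have := ofReal_add_I_ne_zero (h₂ s)
    field_simp
    linear_combination h1
  -- On the circle the conjugate of `z` is its inverse, so intertwining for `star z` follows from
  -- that for `z`. Stone–Weierstrass and continuity in `c` then reach all continuous functions.
  have hstar : star z * z = 1 := by
    ext x
    have : ‖(x : ℂ)‖ = 1 := by simp
    simp [hz, ContinuousMap.restrict_apply, Complex.conj_mul', this]
  have hone : ∀ {γ : Type _} [MeasurableSpace γ] (ν : Measure γ) {h : γ → ℝ} (hh : Measurable h)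
      (f : Lp ℂ 2 ν), circleMul ν hh (star z) (circleMul ν hh z f) = f := by
    intro γ _ ν h hh f
    rw [← circleMul_mul, hstar]
    exact (circleMul_const ν hh 1 f).trans (one_smul _ _)
  have hone' : ∀ {γ : Type _} [MeasurableSpace γ] (ν : Measure γ) {h : γ → ℝ} (hh : Measurable h)
      (f : Lp ℂ 2 ν), circleMul ν hh z (circleMul ν hh (star z) f) = f := by
    intro γ _ ν h hh f
    rw [← circleMul_mul, mul_comm, hstar]
    exact (circleMul_const ν hh 1 f).trans (one_smul _ _)
  revert f
  induction c using ContinuousMap.induction_on_of_compact with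
  | const r => intro f; rw [circleMul_const, circleMul_const, map_smul]
  | id => exact hid
  | star_id =>
    intro f
    have h1 := hid (circleMul ν₁ hh₁ (star z) f)
    rw [hone'] at h1
    rw [h1]
    exact (hone ν₂ hh₂ _).symm
  | add c d hc hd => intro f; rw [circleMul_add, circleMul_add, map_add, hc, hd]
  | mul c d hc hd => intro f; rw [circleMul_mul, circleMul_mul, hc, hd]
  | frequently c hc =>
    intro f
    have hcl : IsClosed {c | U (circleMul ν₁ hh₁ c f) = circleMul ν₂ hh₂ c (U f)} :=
      isClosed_eq (U.continuous.comp (continuous_circleMul ν₁ hh₁ f))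
        (continuous_circleMul ν₂ hh₂ (U f))
    rw [← mem_ofPred_eq (p := fun c => U (circleMul ν₁ hh₁ c f) = circleMul ν₂ hh₂ c (U f)),
      ← hcl.closure_eq, mem_closure_iff_frequently]
    exact hc.mono fun d hd => hd f

/-- The function on the circle that is `φ(t) / (t + i)` at the Cayley transform of `t`. -/
theorem exists_circle_resolvent {φ : ℝ → ℂ} (hφ : Continuous φ) {C : ℝ} (hC : ∀ t, ‖φ t‖ ≤ C) :
    ∃ c : C(Metric.sphere (0 : ℂ) 1, ℂ), ∀ t, c (cayley t) = φ t / (t + Complex.I) := by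
  -- `τ` is the inverse Cayley transform, and `1/(t + i) = (1 - z)/(2i)`. At `z = 1`, the image of
  -- infinity, `φ ∘ τ` has no limit in general; the factor `1 - z` and the boundedness of `φ` give
  -- continuity there, whatever value division by zero assigns to `τ 1`.
  let τ : Metric.sphere (0 : ℂ) 1 → ℝ := fun z => (Complex.I * (1 + z) / (1 - z)).re
  refine ⟨⟨fun z => (1 - z) / (2 * Complex.I) * φ (τ z), ?_⟩, fun t => ?_⟩
  · rw [continuous_iff_continuousAt]
    intro z
    by_cases hz : (z : ℂ) = 1
    · have h0 : Tendsto (fun w : Metric.sphere (0 : ℂ) 1 =>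
          ‖(1 - (w : ℂ)) / (2 * Complex.I)‖ * C) (𝓝 z) (𝓝 0) := by
        have : Continuous fun w : Metric.sphere (0 : ℂ) 1 =>
          ‖(1 - (w : ℂ)) / (2 * Complex.I)‖ * C := by fun_prop
        simpa [hz] using this.tendsto z
      rw [ContinuousAt]
      have h1 : (1 - (z : ℂ)) / (2 * Complex.I) * φ (τ z) = 0 := by rw [hz]; simp
      rw [h1]
      refine squeeze_zero_norm (fun w => ?_) h0
      rw [norm_mul]
      exact mul_le_mul_of_nonneg_left (hC _) (norm_nonneg _)
    · refine ContinuousAt.mul (by fun_prop) (hφ.continuousAt.comp ?_)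
      refine Complex.continuous_re.continuousAt.comp (ContinuousAt.div (by fun_prop) (by fun_prop) ?_)
      exact sub_ne_zero.mpr (Ne.symm hz)
  · have h1 := ofReal_add_I_ne_zero t
    have h2 : (1 - (cayley t : ℂ)) = 2 * Complex.I / (t + Complex.I) := by
      simp only [cayley]; field_simp; ring
    have h3 : τ (cayley t) = t := by
      have : Complex.I * (1 + (cayley t : ℂ)) / (1 - cayley t) = t := by
        rw [h2]; simp only [cayley]; field_simp; ring
      simp only [τ, this, Complex.ofReal_re]
    simp only [ContinuousMap.coe_mk, h3, h2]
    field_simp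

/-- Two diagonalizations of `T` are related by a unitary which intertwines the two multiplication
operators, hence also the continuous functions of their Cayley transforms. A bounded continuous `φ`
need not extend to the circle, but `φ(t)/(t + i)` does. Since `1/(t + i)` extends too and never
vanishes on the real line, it can be divided out afterwards. -/
theorem IsFunctionOf.unique {E : Type*} [NormedAddCommGroup E] [InnerProductSpace ℂ E]
    {T : E →ₗ.[ℂ] E} {φ : ℝ → ℂ} (hφ : Continuous φ) {C : ℝ} (hC : ∀ t, ‖φ t‖ ≤ C)
    {B B' : E →L[ℂ] E} (hB : IsFunctionOf T φ B) (hB' : IsFunctionOf T φ B') : B = B' := by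
  obtain ⟨-, α, _, ν₁, W₁, h₁, hh₁, hT₁, hf₁⟩ := hB
  obtain ⟨-, β, _, ν₂, W₂, h₂, hh₂, hT₂, hf₂⟩ := hB'
  set U : Lp ℂ 2 ν₁ →L[ℂ] Lp ℂ 2 ν₂ := 
    ((W₁.symm.trans W₂).toContinuousLinearEquiv : Lp ℂ 2 ν₁ ≃L[ℂ] Lp ℂ 2 ν₂).toContinuousLinearMap
  have hUW : ∀ f, U (W₁ f) = W₂ f := fun f => by
    show W₂ (W₁.symm (W₁ f)) = W₂ f
    rw [W₁.symm_apply_apply]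
  have hU : ∀ f g : Lp ℂ 2 ν₁, ⇑g =ᵐ[ν₁] (fun s => (h₁ s : ℂ) * f s) →
      ⇑(U g) =ᵐ[ν₂] fun s => (h₂ s : ℂ) * U f s := by
    intro f g hfg
    have h1 : (W₁.symm f, W₁.symm g) ∈ T.graph := by
      rw [hT₁, mem_conjOp_graph, mulOp_graph]
      show ⇑(W₁ (W₁.symm g)) =ᵐ[ν₁] fun s => (h₁ s : ℂ) * W₁ (W₁.symm f) s
      rwa [W₁.apply_symm_apply, W₁.apply_symm_apply]
    rw [hT₂, mem_conjOp_graph, mulOp_graph] at h1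
    exact h1
  obtain ⟨c, hc⟩ := exists_circle_resolvent hφ hC
  obtain ⟨q, hq⟩ := exists_circle_resolvent (φ := fun _ => 1) continuous_const (C := 1) (by simp)
  ext f
  refine W₂.injective (Lp.ext ?_)
  have e1 := circleMul_intertwine hh₁ hh₂ U hU c (W₁ f)
  have e2 := circleMul_intertwine hh₁ hh₂ U hU q (W₁ (B f))
  have e3 : circleMul ν₁ hh₁ c (W₁ f) = circleMul ν₁ hh₁ q (W₁ (B f)) := by
    refine Lp.ext ?_
    filter_upwards [circleMul_coe ν₁ hh₁ c (W₁ f), circleMul_coe ν₁ hh₁ q (W₁ (B f)), hf₁ f]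
      with s a1 a2 a3
    rw [a1, a2, a3, hc, hq]
    ring
  rw [hUW] at e1 e2
  rw [e3, e2] at e1
  filter_upwards [circleMul_coe ν₂ hh₂ c (W₂ f), circleMul_coe ν₂ hh₂ q (W₂ (B f)), hf₂ f]
    with s a1 a2 a3
  rw [e1, a1, hc, hq] at a2
  rw [a3]
  have := ofReal_add_I_ne_zero (h₂ s)
  field_simp at a2
  exact a2.symm

open scoped FourierTransform SchwartzMap

/-! ### The Fourier transformation on `L²(ℝ)` -/

/-- The Hilbert space `L²(ℝ)`. -/
abbrev LineL2 : Type := Lp ℂ 2 (volume : Measure ℝ)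

theorem SchwartzMap.memLp_two (χ : 𝓢(ℝ, ℂ)) : MemLp χ 2 := χ.memLp 2 volume

theorem LineL2.integrable_mul (f : LineL2) (χ : 𝓢(ℝ, ℂ)) : Integrable fun x => f x * χ x :=
  (Lp.memLp f).integrable_mul χ.memLp_two

theorem LineL2.locallyIntegrable (f : LineL2) : LocallyIntegrable f :=
  (Lp.memLp f).locallyIntegrable (by norm_num)

/-- The `L²` Fourier transformation is handled throughout by moving it onto a Schwartz function,
which reduces its properties to classical ones. -/
theorem fourier_duality (f : LineL2) (χ : 𝓢(ℝ, ℂ)) :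
    ∫ x, (𝓕 f : LineL2) x * χ x = ∫ x, f x * (𝓕 χ : 𝓢(ℝ, ℂ)) x := by
  have h := congrArg (fun T => T χ) (Lp.fourier_toTemperedDistribution_eq f)
  simp only [TemperedDistribution.fourier_apply, Lp.toTemperedDistribution_apply] at h
  simpa [mul_comm] using h.symm

/-- The Schwartz function given by a smooth compactly supported real function. -/
noncomputable def schwartzOfReal {ψ : ℝ → ℝ} (h1 : ContDiff ℝ ∞ ψ) (h2 : HasCompactSupport ψ) :
    𝓢(ℝ, ℂ) :=
  (h2.comp_left (g := fun t : ℝ => (t : ℂ)) (by simp)).toSchwartzMap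
    (Complex.ofRealCLM.contDiff.comp h1)

theorem schwartzOfReal_apply {ψ : ℝ → ℝ} (h1 : ContDiff ℝ ∞ ψ) (h2 : HasCompactSupport ψ)
    (x : ℝ) : schwartzOfReal h1 h2 x = ψ x := rfl

theorem ae_eq_of_integral_schwartz {f g : ℝ → ℂ} (hf : LocallyIntegrable f)
    (hg : LocallyIntegrable g)
    (h : ∀ (ψ : ℝ → ℝ) (h1 : ContDiff ℝ ∞ ψ) (h2 : HasCompactSupport ψ),
      ∫ x, f x * schwartzOfReal h1 h2 x = ∫ x, g x * schwartzOfReal h1 h2 x) : f =ᵐ[volume] g := by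
  refine ae_eq_of_integral_contDiff_smul_eq hf hg fun ψ h1 h2 => ?_
  simpa [schwartzOfReal_apply, Complex.real_smul, mul_comm] using h ψ h1 h2

/-- Needed to compute the `L²` Mellin transforms of Gaussians by an actual integral. -/
theorem fourier_toLp_of_integrable {f : ℝ → ℂ} (h1 : Integrable f) (h2 : MemLp f 2) :
    ⇑(𝓕 (h2.toLp f) : LineL2) =ᵐ[volume] 𝓕 f := by
  have hcont : Continuous (𝓕 f) :=
    VectorFourier.fourierIntegral_continuous Real.continuous_fourierChar (innerSL ℝ).continuous₂ h1
  refine ae_eq_of_integral_schwartz (LineL2.locallyIntegrable _) hcont.locallyIntegrable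
    fun ψ hψ hψc => ?_
  rw [fourier_duality]
  have e := VectorFourier.integral_fourierIntegral_smul_eq_flip (L := innerₗ ℝ)
    (μ := volume) (ν := volume) Real.continuous_fourierChar continuous_inner h1
    (schwartzOfReal hψ hψc).integrable
  have e2 : (innerₗ ℝ).flip = innerₗ ℝ := flip_innerₗ ℝ
  rw [e2] at e
  simp only [smul_eq_mul] at e
  refine Eq.trans ?_ e.symm
  refine integral_congr_ae ?_
  filter_upwards [h2.coeFn_toLp] with x hx
  rw [hx, SchwartzMap.fourier_coe]
  rfl

theorem fourier_comp_neg (f g : LineL2) (h : ⇑g =ᵐ[volume] fun x => f (-x)) :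
    ⇑(𝓕 g : LineL2) =ᵐ[volume] fun x => (𝓕 f : LineL2) (-x) := by
  have hf : LocallyIntegrable fun x => (𝓕 f : LineL2) (-x) := by
    refine MemLp.locallyIntegrable (p := 2) ?_ (by norm_num)
    exact (Lp.memLp (𝓕 f : LineL2)).comp_measurePreserving (Measure.measurePreserving_neg volume)
  refine ae_eq_of_integral_schwartz (LineL2.locallyIntegrable _) hf fun ψ hψ hψc => ?_
  set χ := schwartzOfReal hψ hψc
  set χ' : 𝓢(ℝ, ℂ) := SchwartzMap.compCLMOfContinuousLinearEquiv ℂ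
    (LinearIsometryEquiv.neg ℝ (E := ℝ)).toContinuousLinearEquiv χ with hχ'
  have hc : ∀ x, χ' x = χ (-x) := fun x => rfl
  have hF : ∀ x, (𝓕 χ' : 𝓢(ℝ, ℂ)) x = (𝓕 χ : 𝓢(ℝ, ℂ)) (-x) := by
    intro x
    rw [SchwartzMap.fourier_coe, SchwartzMap.fourier_coe, Real.fourier_real_eq, Real.fourier_real_eq,
      ← integral_neg_eq_self]
    simp [hc]
  have e1 : ∫ x, (𝓕 f : LineL2) (-x) * χ x = ∫ x, (𝓕 f : LineL2) x * χ' x := by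
    rw [← integral_neg_eq_self]
    simp [hc]
  rw [e1, fourier_duality, fourier_duality, ← integral_neg_eq_self]
  refine integral_congr_ae ?_
  have h' := (Measure.measurePreserving_neg (volume : Measure ℝ)).quasiMeasurePreserving.ae h
  filter_upwards [h'] with x hx
  rw [hx, hF, neg_neg]

/-! ### Logarithmic coordinates -/

theorem exp_neg_image : (fun u : ℝ => Real.exp (-u)) '' univ = Ioi 0 := by
  ext y
  constructor
  · rintro ⟨x, -, rfl⟩
    exact Real.exp_pos _
  · intro hy
    exact ⟨-Real.log y, mem_univ _, by simp [Real.exp_log (mem_Ioi.mp hy)]⟩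

theorem hasDerivAt_exp_neg (u : ℝ) :
    HasDerivAt (fun u : ℝ => Real.exp (-u)) (-Real.exp (-u)) u := by
  simpa using (hasDerivAt_neg u).exp

theorem exp_neg_injOn : InjOn (fun u : ℝ => Real.exp (-u)) univ := fun a _ b _ h => by
  simpa using h

/-- With the substitution `x = e^{-u}`, rather than `e^u`, the Fourier transform of `e^{-u/2}
f(e^{-u})` at `x` is the Mellin transform of `f` at `1/2 + 2πix`. -/
theorem lintegral_halfLine_exp (F : ℝ → ENNReal) :
    ∫⁻ x in Ioi (0 : ℝ), F x = ∫⁻ u, ENNReal.ofReal (Real.exp (-u)) * F (Real.exp (-u)) := by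
  rw [← exp_neg_image, lintegral_image_eq_lintegral_abs_deriv_mul MeasurableSet.univ
    (fun u _ => (hasDerivAt_exp_neg u).hasDerivWithinAt) exp_neg_injOn]
  simp

theorem integral_halfLine_exp (F : ℝ → ℂ) :
    ∫ x in Ioi (0 : ℝ), F x = ∫ u, (Real.exp (-u) : ℂ) * F (Real.exp (-u)) := by
  rw [← exp_neg_image, integral_image_eq_integral_abs_deriv_smul MeasurableSet.univ
    (fun u _ => (hasDerivAt_exp_neg u).hasDerivWithinAt) exp_neg_injOn]
  simp [Complex.real_smul]

theorem exp_neg_qmp : Measure.QuasiMeasurePreserving (fun u : ℝ => Real.exp (-u)) volume halfLine := by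
  refine ⟨by fun_prop, Measure.AbsolutelyContinuous.mk fun s hs h0 => ?_⟩
  rw [Measure.map_apply (by fun_prop) hs]
  have h := lintegral_halfLine_exp (s.indicator 1)
  rw [lintegral_indicator_one hs, h0, eq_comm, lintegral_eq_zero_iff (by
    refine Measurable.mul (by fun_prop) ?_
    exact (measurable_one.indicator hs).comp (by fun_prop))] at h
  refine measure_mono_null (fun x hx => ?_) (ae_iff.mp h)
  have hx' : Real.exp (-x) ∈ s := hx
  simp [hx', Real.exp_pos]

theorem neg_log_qmp : Measure.QuasiMeasurePreserving (fun x : ℝ => -Real.log x) halfLine volume := by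
  refine ⟨by fun_prop, Measure.AbsolutelyContinuous.mk fun s hs h0 => ?_⟩
  have hm : Measurable fun x : ℝ => -Real.log x := by fun_prop
  rw [Measure.map_apply hm hs, ← lintegral_indicator_one (hm hs), lintegral_halfLine_exp,
    lintegral_eq_zero_iff (by
      refine Measurable.mul (by fun_prop) ?_
      exact (measurable_one.indicator (hm hs)).comp (by fun_prop))]
  have h1 : ∀ᵐ u, u ∉ s := measure_eq_zero_iff_ae_notMem.mp h0
  filter_upwards [h1] with u hu
  simp [indicator, hu]

/-- The function `u ↦ e^{-u/2} f(e^{-u})`. -/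
noncomputable def logPullback (f : ℝ → ℂ) (u : ℝ) : ℂ := (Real.exp (-u / 2) : ℂ) * f (Real.exp (-u))

theorem logPullback_mul (f g : ℝ → ℂ) (u : ℝ) :
    logPullback f u * logPullback g u = (Real.exp (-u) : ℂ) * (f (Real.exp (-u)) * g (Real.exp (-u))) := by
  have : (Real.exp (-u) : ℂ) = Real.exp (-u / 2) * Real.exp (-u / 2) := by
    rw [← Complex.ofReal_mul, ← Real.exp_add]; ring_nf
  rw [this, logPullback, logPullback]; ring

theorem integral_logPullback_mul (f g : ℝ → ℂ) :
    ∫ u, logPullback f u * logPullback g u = ∫ x in Ioi (0 : ℝ), f x * g x := by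
  rw [integral_halfLine_exp]
  simp only [logPullback_mul]

theorem eLpNorm_logPullback (f : ℝ → ℂ) : eLpNorm (logPullback f) 2 = eLpNorm f 2 halfLine := by
  rw [eLpNorm_eq_lintegral_rpow_enorm_toReal (by norm_num) (by norm_num),
    eLpNorm_eq_lintegral_rpow_enorm_toReal (by norm_num) (by norm_num), lintegral_halfLine_exp]
  congr 1
  refine lintegral_congr fun u => ?_
  have h1 : ‖(Real.exp (-u / 2) : ℂ)‖ₑ = ENNReal.ofReal (Real.exp (-u / 2)) := by
    rw [← ofReal_norm, Complex.norm_real, Real.norm_of_nonneg (Real.exp_pos _).le]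
  rw [logPullback, enorm_mul, h1, ENNReal.mul_rpow_of_nonneg _ _ (by norm_num)]
  congr 1
  rw [ENNReal.ofReal_rpow_of_pos (Real.exp_pos _), ← Real.exp_mul]
  simp

theorem logPullback_congr {f g : ℝ → ℂ} (h : f =ᵐ[halfLine] g) :
    logPullback f =ᵐ[volume] logPullback g := by
  filter_upwards [exp_neg_qmp.ae h] with u hu
  rw [logPullback, logPullback, hu]

theorem logPullback_memLp {f : ℝ → ℂ} (hf : MemLp f 2 halfLine) : MemLp (logPullback f) 2 := by
  refine ⟨?_, ?_⟩
  · refine AEStronglyMeasurable.mul (by fun_prop) ?_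
    exact hf.1.comp_quasiMeasurePreserving exp_neg_qmp
  · rw [eLpNorm_logPullback]
    exact hf.2

/-- The isometry `f ↦ (u ↦ e^{-u/2} f(e^{-u}))` from `L²[0, ∞[` to `L²(ℝ)`. -/
noncomputable def logIsometry : HalfLineL2 →ₗᵢ[ℂ] LineL2 where
  toFun f := (logPullback_memLp (Lp.memLp f)).toLp _
  map_add' f g := by
    refine Lp.ext ?_
    filter_upwards [(logPullback_memLp (Lp.memLp (f + g))).coeFn_toLp,
      (logPullback_memLp (Lp.memLp f)).coeFn_toLp, (logPullback_memLp (Lp.memLp g)).coeFn_toLp,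
      logPullback_congr (Lp.coeFn_add f g),
      Lp.coeFn_add ((logPullback_memLp (Lp.memLp f)).toLp _)
        ((logPullback_memLp (Lp.memLp g)).toLp _)] with x h1 h2 h3 h4 h5
    rw [h1, h5, Pi.add_apply, h2, h3, h4]
    simp only [logPullback, Pi.add_apply, mul_add]
  map_smul' c f := by
    refine Lp.ext ?_
    filter_upwards [(logPullback_memLp (Lp.memLp (c • f))).coeFn_toLp,
      (logPullback_memLp (Lp.memLp f)).coeFn_toLp, logPullback_congr (Lp.coeFn_smul c f),
      Lp.coeFn_smul c ((logPullback_memLp (Lp.memLp f)).toLp _)] with x h1 h2 h3 h4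
    rw [RingHom.id_apply, h1, h4, Pi.smul_apply, h2, h3]
    simp only [logPullback, Pi.smul_apply, smul_eq_mul]
    ring
  norm_map' f := by
    show ‖(logPullback_memLp (Lp.memLp f)).toLp _‖ = ‖f‖
    rw [Lp.norm_toLp, eLpNorm_logPullback, Lp.norm_def]

theorem logIsometry_coe (f : HalfLineL2) : ⇑(logIsometry f) =ᵐ[volume] logPullback f :=
  (logPullback_memLp (Lp.memLp f)).coeFn_toLp

theorem logIsometry_toLp {f : ℝ → ℂ} (hf : MemLp f 2 halfLine) :
    logIsometry (hf.toLp f) = (logPullback_memLp hf).toLp _ := by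
  refine Lp.ext ?_
  filter_upwards [logIsometry_coe (hf.toLp f), logPullback_congr hf.coeFn_toLp,
    (logPullback_memLp hf).coeFn_toLp] with u h1 h2 h3
  rw [h1, h2, h3]

theorem logIsometry_surjective : Function.Surjective logIsometry := by
  intro g
  -- The factor is `x^{-1/2}` on the half-line, the inverse of `e^{-u/2}` at `u = -log x`.
  let f : ℝ → ℂ := fun x => (Real.exp (-Real.log x / 2) : ℂ) * g (-Real.log x)
  have hfg : logPullback f = g := by
    funext u
    simp only [logPullback, f, Real.log_exp, neg_neg]
    rw [← mul_assoc, ← Complex.ofReal_mul, ← Real.exp_add]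
    simp [neg_div]
  have hf : MemLp f 2 halfLine := by
    refine ⟨?_, ?_⟩
    · refine AEStronglyMeasurable.mul ?_ ?_
      · exact Measurable.aestronglyMeasurable (by fun_prop)
      · exact (Lp.aestronglyMeasurable g).comp_quasiMeasurePreserving neg_log_qmp
    · rw [← eLpNorm_logPullback, hfg]
      exact (Lp.memLp g).2
  refine ⟨hf.toLp f, ?_⟩
  rw [logIsometry_toLp]
  refine Lp.ext ?_
  filter_upwards [(logPullback_memLp hf).coeFn_toLp] with u h1
  rw [h1, hfg]

/-- The Mellin transformation, as a unitary operator from `L²[0, ∞[` onto `L²(ℝ)`. -/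
noncomputable def mellinL2 : HalfLineL2 ≃ₗᵢ[ℂ] LineL2 :=
  (LinearIsometryEquiv.ofSurjective logIsometry logIsometry_surjective).trans
    (Lp.fourierTransformₗᵢ ℝ ℂ)

theorem mellinL2_apply (f : HalfLineL2) : mellinL2 f = 𝓕 (logIsometry f) := rfl

/-- In the coordinate `u` the inversion is the reflection `u ↦ -u`, which commutes with the Fourier
transformation. -/
theorem mellinL2_inversion (f : HalfLineL2) :
    ⇑(mellinL2 (inversion f)) =ᵐ[volume] fun x => mellinL2 f (-x) := by
  refine fourier_comp_neg (logIsometry f) (logIsometry (inversion f)) ?_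
  have h1 : ⇑(inversion f) =ᵐ[halfLine] fun x : ℝ => (x : ℂ)⁻¹ * f x⁻¹ :=
    (inversion_memLp f).coeFn_toLp
  have h2 := (Measure.measurePreserving_neg (volume : Measure ℝ)).quasiMeasurePreserving.ae
    (logIsometry_coe f)
  filter_upwards [logIsometry_coe (inversion f), logPullback_congr h1, h2] with u h3 h4 h5
  rw [h3, h4, h5, logPullback, logPullback, ← mul_assoc, ← Complex.ofReal_inv, ← Complex.ofReal_mul,
    ← Real.exp_neg, ← Real.exp_add]
  ring_nf

/-! ### Test functions in logarithmic coordinates -/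

/-- The support lies in some `[e^{-R}, e^R]`, away from the origin, so extension by zero is smooth.
This serves to transport test functions from the line and later to build cutoffs that are functions
of `log x`. -/
theorem IsTest.of_comp_log {ψ : ℝ → ℂ} (h1 : ContDiff ℝ ∞ ψ) (h2 : HasCompactSupport ψ) :
    IsTest ((Ioi (0 : ℝ)).indicator fun x => ψ (Real.log x)) := by
  set φ := (Ioi (0 : ℝ)).indicator fun x => ψ (Real.log x) with hφ
  obtain ⟨R, hR⟩ := h2.isCompact.isBounded.subset_closedBall 0
  have hsupp : ∀ x, x ∉ Icc (Real.exp (-R)) (Real.exp R) → φ x = 0 := by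
    intro x hx
    by_cases h0 : 0 < x
    · rw [hφ, indicator_of_mem (mem_Ioi.mpr h0)]
      by_contra hne
      have h3 := hR (subset_tsupport ψ hne)
      rw [mem_closedBall_zero_iff, Real.norm_eq_abs, abs_le] at h3
      refine hx ⟨?_, ?_⟩
      · rw [← Real.le_log_iff_exp_le h0]; exact h3.1
      · rw [← Real.log_le_iff_le_exp h0]; exact h3.2
    · rw [hφ, indicator_of_notMem]
      exact h0
  have hts : tsupport φ ⊆ Icc (Real.exp (-R)) (Real.exp R) :=
    closure_minimal (fun x hx => by_contra fun hn => hx (hsupp x hn)) isClosed_Icc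
  have hpos : Icc (Real.exp (-R)) (Real.exp R) ⊆ Ioi 0 := fun x hx =>
    (Real.exp_pos _).trans_le hx.1
  refine ⟨?_, HasCompactSupport.intro isCompact_Icc hsupp, hts.trans hpos⟩
  rw [contDiff_iff_contDiffAt]
  intro x
  by_cases h0 : 0 < x
  · have h3 : φ =ᶠ[𝓝 x] fun x => ψ (Real.log x) := by
      filter_upwards [lt_mem_nhds h0] with y hy
      rw [hφ, indicator_of_mem (mem_Ioi.mpr hy)]
    exact (h1.contDiffAt.comp x (Real.contDiffAt_log.mpr h0.ne')).congr_of_eventuallyEq h3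
  · have h3 : φ =ᶠ[𝓝 x] fun _ => 0 :=
      notMem_tsupport_iff_eventuallyEq.mp fun h => h0 (hpos (hts h))
    exact contDiffAt_const.congr_of_eventuallyEq h3

theorem contDiff_exp_neg_half : ContDiff ℝ ∞ fun u : ℝ => (Real.exp (-u / 2) : ℂ) :=
  Complex.ofRealCLM.contDiff.comp
    (Real.contDiff_exp.comp (contDiff_id.neg.div_const 2) : ContDiff ℝ ∞ fun u : ℝ => Real.exp (-u / 2))

theorem IsTest.logPullback_contDiff {φ : ℝ → ℂ} (h : IsTest φ) : ContDiff ℝ ∞ (logPullback φ) :=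
  contDiff_exp_neg_half.mul (h.contDiff.comp (by fun_prop))

theorem IsTest.logPullback_compact {φ : ℝ → ℂ} (h : IsTest φ) :
    HasCompactSupport (logPullback φ) := by
  have hK : IsCompact ((fun x => -Real.log x) '' tsupport φ) :=
    h.compact.isCompact.image_of_continuousOn
      ((Real.continuousOn_log.mono fun x hx => (h.supp hx).ne').neg)
  refine HasCompactSupport.intro hK fun u hu => ?_
  rw [logPullback, mul_eq_zero]
  right
  refine image_eq_zero_of_notMem_tsupport fun hx => hu ⟨_, hx, by simp⟩

theorem logPullback_dilationTranspose {φ : ℝ → ℂ} (h : IsTest φ) (u : ℝ) :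
    logPullback (dilationTranspose φ) u = -Complex.I * deriv (logPullback φ) u := by
  have h1 : HasDerivAt (fun u : ℝ => (Real.exp (-u / 2) : ℂ))
      ((Real.exp (-u / 2) * (-1 / 2) : ℝ) : ℂ) u :=
    HasDerivAt.ofReal_comp ((((hasDerivAt_id u).neg).div_const 2).exp)
  have h2 : HasDerivAt (fun u : ℝ => φ (Real.exp (-u)))
      ((-Real.exp (-u)) • deriv φ (Real.exp (-u))) u :=
    ((h.contDiff.differentiable (by simp)) _).hasDerivAt.scomp u (hasDerivAt_exp_neg u)
  have h3 := (h1.mul h2).deriv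
  have h4 : deriv (logPullback φ) u = _ := h3
  rw [h4, logPullback, dilationTranspose, Complex.real_smul]
  push_cast
  ring

theorem exists_isTest_logPullback {ψ : ℝ → ℂ} (h1 : ContDiff ℝ ∞ ψ) (h2 : HasCompactSupport ψ) :
    ∃ φ, IsTest φ ∧ logPullback φ = ψ := by
  have h3 : ContDiff ℝ ∞ fun v : ℝ => (Real.exp (-v / 2) : ℂ) * ψ (-v) :=
    contDiff_exp_neg_half.mul (h1.comp (by fun_prop))
  have h4 : HasCompactSupport fun v : ℝ => (Real.exp (-v / 2) : ℂ) * ψ (-v) :=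
    HasCompactSupport.mul_left (h2.comp_homeomorph (Homeomorph.neg ℝ))
  refine ⟨_, IsTest.of_comp_log h3 h4, ?_⟩
  funext u
  rw [logPullback, indicator_of_mem (mem_Ioi.mpr (Real.exp_pos _)), Real.log_exp, neg_neg,
    ← mul_assoc, ← Complex.ofReal_mul, ← Real.exp_add]
  simp [neg_div]

/-! ### The generator of dilations -/

/-- A weak derivative of an `L²` function, tested on smooth compactly supported functions, can be
tested on Schwartz functions. -/
theorem weak_deriv_schwartz {F G : LineL2} {c : ℂ}
    (h : ∀ ψ : ℝ → ℂ, ContDiff ℝ ∞ ψ → HasCompactSupport ψ →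
      ∫ u, G u * ψ u = c * ∫ u, F u * deriv ψ u) (χ : 𝓢(ℝ, ℂ)) :
    ∫ u, G u * χ u = c * ∫ u, F u * deriv χ u := by
  let θ : ContDiffBump (0 : ℝ) := ⟨1, 2, one_pos, by norm_num⟩
  have hθs : ContDiff ℝ ∞ θ := θ.contDiff
  obtain ⟨D, hD⟩ := (θ.hasCompactSupport.deriv (𝕜 := ℝ)).exists_bound_of_continuous
    ((contDiff_infty_iff_deriv.mp hθs).2.continuous)
  have hD0 : 0 ≤ D := (norm_nonneg _).trans (hD 0)
  -- The cutoffs `θ(t_n u)` tend to 1 pointwise, and the extra term in the derivative of `θ(t_n u)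
  -- χ(u)` carries the factor `t_n → 0`, so it disappears in the limit.
  let t : ℕ → ℝ := fun n => ((n : ℝ) + 1)⁻¹
  have ht0 : ∀ n, 0 < t n := fun n => by positivity
  have ht1 : ∀ n, t n ≤ 1 := fun n => inv_le_one_of_one_le₀ (by simp)
  have htlim : Tendsto t atTop (𝓝 0) := by
    simpa [t] using tendsto_one_div_add_atTop_nhds_zero_nat (𝕜 := ℝ)
  have hθ1 : ∀ u, Tendsto (fun n => θ (t n * u)) atTop (𝓝 1) := by
    intro u
    have : Tendsto (fun n => t n * u) atTop (𝓝 0) := by simpa using htlim.mul_const u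
    have h2 : θ 0 = 1 := θ.one_of_mem_closedBall (by simp [θ])
    rw [← h2]
    exact (θ.continuous.tendsto 0).comp this
  let χ' : 𝓢(ℝ, ℂ) := SchwartzMap.derivCLM ℂ ℂ χ
  have hχ' : ∀ u, χ' u = deriv χ u := fun u => SchwartzMap.derivCLM_apply ℂ χ u
  let ψ : ℕ → ℝ → ℂ := fun n u => (θ (t n * u) : ℂ) * χ u
  have hψd : ∀ n u, deriv (ψ n) u =
      (θ (t n * u) : ℂ) * χ' u + (t n * deriv θ (t n * u) : ℝ) * χ u := by
    intro n u
    have h1 : HasDerivAt (fun u => θ (t n * u)) (deriv θ (t n * u) * t n) u :=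
      HasDerivAt.comp (h₂ := ⇑θ) (h := fun u => t n * u) u
        (hθs.differentiable (by simp) (t n * u)).hasDerivAt
        (by simpa using (hasDerivAt_id u).const_mul (t n))
    have h2 := (h1.ofReal_comp.mul (χ.differentiable u).hasDerivAt).deriv
    have h3 : deriv (ψ n) u = _ := h2
    rw [h3, hχ']
    push_cast
    ring
  have hψ1 : ∀ n, ContDiff ℝ ∞ (ψ n) := fun n =>
    (Complex.ofRealCLM.contDiff.comp (hθs.comp (by fun_prop))).mul (χ.smooth ⊤)
  have hψ2 : ∀ n, HasCompactSupport (ψ n) := by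
    intro n
    refine HasCompactSupport.mul_right ?_
    have h3 : HasCompactSupport fun u => θ (t n * u) :=
      θ.hasCompactSupport.comp_homeomorph (Homeomorph.mulLeft₀ (t n) (ht0 n).ne')
    exact h3.comp_left (g := fun r : ℝ => (r : ℂ)) (by simp)
  have hθm : ∀ n, Continuous fun u => (θ (t n * u) : ℂ) := fun n =>
    Complex.continuous_ofReal.comp (θ.continuous.comp (by fun_prop))
  have hθn : ∀ n u, ‖(θ (t n * u) : ℂ)‖ ≤ 1 := fun n u => by
    rw [Complex.norm_real, Real.norm_of_nonneg θ.nonneg]; exact θ.le_one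
  have hlim1 : ∀ (p : LineL2) (η : 𝓢(ℝ, ℂ)),
      Tendsto (fun n => ∫ u, p u * ((θ (t n * u) : ℂ) * η u)) atTop (𝓝 (∫ u, p u * η u)) := by
    intro p η
    refine tendsto_integral_of_dominated_convergence (fun u => ‖p u * η u‖) (fun n => ?_)
      (p.integrable_mul η).norm (fun n => ae_of_all _ fun u => ?_) (ae_of_all _ fun u => ?_)
    · exact (Lp.aestronglyMeasurable p).mul ((hθm n).mul η.continuous).aestronglyMeasurable
    · rw [norm_mul, norm_mul, norm_mul]
      have := mul_le_mul_of_nonneg_right (hθn n u) (mul_nonneg (norm_nonneg (p u)) (norm_nonneg (η u)))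
      linarith
    · have h3 := (Complex.continuous_ofReal.tendsto 1).comp (hθ1 u)
      have h4 := (h3.mul_const (η u)).const_mul (p u)
      simpa using h4
  have hlim2 : Tendsto (fun n => ∫ u, F u * ((t n * deriv θ (t n * u) : ℝ) * χ u)) atTop (𝓝 0) := by
    have h0 : (0 : ℂ) = ∫ _ : ℝ, (0 : ℂ) := by simp
    rw [h0]
    refine tendsto_integral_of_dominated_convergence (fun u => D * ‖F u * χ u‖) (fun n => ?_)
      ((F.integrable_mul χ).norm.const_mul D) (fun n => ae_of_all _ fun u => ?_)
      (ae_of_all _ fun u => ?_)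
    · refine (Lp.aestronglyMeasurable F).mul (Continuous.aestronglyMeasurable ?_)
      have h5 : Continuous (deriv θ) :=
        (contDiff_infty_iff_deriv.mp hθs).2.continuous
      exact (Complex.continuous_ofReal.comp (by fun_prop)).mul χ.continuous
    · rw [norm_mul, norm_mul, norm_mul, Complex.norm_real, norm_mul, Real.norm_of_nonneg (ht0 n).le]
      have h6 : t n * ‖deriv θ (t n * u)‖ ≤ D := by
        have := mul_le_mul (ht1 n) (hD (t n * u)) (norm_nonneg _) zero_le_one
        linarith
      have := mul_le_mul_of_nonneg_right h6 (mul_nonneg (norm_nonneg (F u)) (norm_nonneg (χ u)))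
      linarith
    · have h7 : Tendsto (fun n => t n * deriv θ (t n * u)) atTop (𝓝 0) := by
        refine squeeze_zero_norm (a := fun n => t n * D) (fun n => ?_) (by simpa using htlim.mul_const D)
        rw [norm_mul, Real.norm_of_nonneg (ht0 n).le]
        exact mul_le_mul_of_nonneg_left (hD _) (ht0 n).le
      have h8 := (((Complex.continuous_ofReal.tendsto 0).comp h7).mul_const (χ u)).const_mul (F u)
      simpa using h8
  have hint2 : ∀ n, Integrable fun u => F u * ((t n * deriv θ (t n * u) : ℝ) * χ u) := by
    intro n
    have h5 : Continuous (deriv θ) :=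
      (contDiff_infty_iff_deriv.mp hθs).2.continuous
    refine ((F.integrable_mul χ).bdd_mul (c := t n * D)
      (f := fun u => ((t n * deriv θ (t n * u) : ℝ) : ℂ))
      (Complex.continuous_ofReal.comp (by fun_prop)).aestronglyMeasurable
      (ae_of_all _ fun u => ?_)).congr (ae_of_all _ fun u => ?_)
    · rw [Complex.norm_real, norm_mul, Real.norm_of_nonneg (ht0 n).le]
      exact mul_le_mul_of_nonneg_left (hD _) (ht0 n).le
    · simp only; ring
  have hint1 : ∀ n, Integrable fun u => F u * ((θ (t n * u) : ℂ) * χ' u) := by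
    intro n
    refine ((F.integrable_mul χ').bdd_mul (c := 1) (f := fun u => (θ (t n * u) : ℂ))
      (hθm n).aestronglyMeasurable (ae_of_all _ fun u => hθn n u)).congr (ae_of_all _ fun u => ?_)
    simp only; ring
  have hl := hlim1 G χ
  have hr := ((hlim1 F χ').add hlim2).const_mul c
  rw [add_zero] at hr
  have he : ∀ n, ∫ u, G u * ((θ (t n * u) : ℂ) * χ u) =
      c * ((∫ u, F u * ((θ (t n * u) : ℂ) * χ' u)) +
        ∫ u, F u * ((t n * deriv θ (t n * u) : ℝ) * χ u)) := by
    intro n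
    rw [← integral_add (hint1 n) (hint2 n)]
    refine (h (ψ n) (hψ1 n) (hψ2 n)).trans ?_
    congr 2
    funext u
    rw [hψd, mul_add]
  simp only [he] at hl
  have hfin := tendsto_nhds_unique hl hr
  simpa only [hχ'] using hfin

/-- The left side says `G = i F'` weakly, so the multiplier is `i · 2πix = -2πx`. In one direction
the Fourier transform of a test function occurs as the test function; it is no longer compactly
supported, which is why Schwartz functions must be admitted. In the other direction the test
function is written as the Fourier transform of its inverse transform. -/
theorem weak_deriv_iff_fourier (F G : LineL2) :
    (∀ ψ : ℝ → ℂ, ContDiff ℝ ∞ ψ → HasCompactSupport ψ →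
      ∫ u, G u * ψ u = -Complex.I * ∫ u, F u * deriv ψ u) ↔
    ⇑(𝓕 G : LineL2) =ᵐ[volume] fun x => ((-2 * Real.pi * x : ℝ) : ℂ) * (𝓕 F : LineL2) x := by
  constructor
  · intro h
    refine ae_eq_of_integral_schwartz (LineL2.locallyIntegrable _) ?_ fun ψ hψ hψc => ?_
    · have h1 : Continuous fun x : ℝ => ((-2 * Real.pi * x : ℝ) : ℂ) :=
        Complex.continuous_ofReal.comp (by fun_prop)
      have h2 := (locallyIntegrableOn_univ.mpr (LineL2.locallyIntegrable (𝓕 F))).continuousOn_mul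
        h1.continuousOn isOpen_univ.isLocallyClosed
      exact locallyIntegrableOn_univ.mp h2
    · set η := schwartzOfReal hψ hψc
      have hη2 : HasCompactSupport fun x : ℝ => (-2 * Real.pi * Complex.I * x) * η x :=
        HasCompactSupport.mul_left (hψc.comp_left (g := fun t : ℝ => (t : ℂ)) (by simp))
      have hη1 : ContDiff ℝ ∞ fun x : ℝ => (-2 * Real.pi * Complex.I * x) * η x :=
        (contDiff_const.mul Complex.ofRealCLM.contDiff).mul (η.smooth ⊤)
      set ζ : 𝓢(ℝ, ℂ) := hη2.toSchwartzMap hη1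
      have hζ : ∀ x, ζ x = (-2 * Real.pi * Complex.I * x) * η x := fun x => rfl
      have hd : deriv (𝓕 η : 𝓢(ℝ, ℂ)) = (𝓕 ζ : 𝓢(ℝ, ℂ)) := by
        rw [SchwartzMap.fourier_coe, SchwartzMap.fourier_coe, Real.deriv_fourier η.integrable]
        · rfl
        · refine (ζ.integrable.const_mul (Complex.I / (2 * Real.pi))).congr (ae_of_all _ fun x => ?_)
          have : (Real.pi : ℂ) ≠ 0 := by exact_mod_cast Real.pi_ne_zero
          simp only [hζ, Complex.real_smul]
          field_simp
          rw [Complex.I_sq]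
          ring
      have h1 := weak_deriv_schwartz h (𝓕 η : 𝓢(ℝ, ℂ))
      rw [fourier_duality, h1, hd, ← fourier_duality, ← integral_const_mul]
      congr 1
      funext x
      rw [hζ]
      push_cast
      linear_combination (-2 * Real.pi * x * (𝓕 F : LineL2) x * η x) * (-Complex.I_sq)
  · intro h ψ hψ hψc
    set χ : 𝓢(ℝ, ℂ) := hψc.toSchwartzMap hψ
    set χ' : 𝓢(ℝ, ℂ) := SchwartzMap.derivCLM ℂ ℂ χ
    have hχ' : ⇑χ' = deriv ψ := funext fun u => SchwartzMap.derivCLM_apply ℂ χ u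
    have hF : ∀ x, (𝓕⁻ χ' : 𝓢(ℝ, ℂ)) x = (-2 * Real.pi * Complex.I * x) * (𝓕⁻ χ : 𝓢(ℝ, ℂ)) x := by
      intro x
      rw [SchwartzMap.fourierInv_coe, SchwartzMap.fourierInv_coe, Real.fourierInv_eq_fourier_neg,
        Real.fourierInv_eq_fourier_neg, hχ']
      have h1 := Real.fourier_deriv (f := χ) χ.integrable χ.differentiable
        (by rw [← show ⇑χ' = deriv χ from hχ']; exact χ'.integrable)
      have h2 : 𝓕 (deriv ψ) (-x) = _ := congrFun h1 (-x)
      rw [h2]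
      push_cast
      rw [smul_eq_mul]
      ring
    have e1 : ∫ u, G u * ψ u = ∫ x, (𝓕 G : LineL2) x * (𝓕⁻ χ : 𝓢(ℝ, ℂ)) x := by
      rw [fourier_duality, FourierTransform.fourier_fourierInv_eq]
      rfl
    have e2 : ∫ u, F u * deriv ψ u = ∫ x, (𝓕 F : LineL2) x * (𝓕⁻ χ' : 𝓢(ℝ, ℂ)) x := by
      rw [fourier_duality, FourierTransform.fourier_fourierInv_eq, hχ']
    rw [e1, e2, ← integral_const_mul]
    refine integral_congr_ae ?_
    filter_upwards [h] with x hx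
    rw [hx, hF]
    push_cast
    linear_combination (-2 * Real.pi * x * (𝓕 F : LineL2) x * (𝓕⁻ χ : 𝓢(ℝ, ℂ)) x) * (Complex.I_sq)

/-- Test functions on the half-line and on the line correspond under `logPullback`, so the weak
definition of `A` becomes that of `i d/du`. The domains agree because the preceding equivalence
characterizes the whole graph. -/
theorem dilationGenerator_eq_conjOp : dilationGenerator =
    conjOp mellinL2.toLinearEquiv (mulOp volume fun x : ℝ => ((-2 * Real.pi * x : ℝ) : ℂ)) := by
  refine LinearPMap.eq_of_eq_graph (Submodule.ext fun p => ?_)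
  rw [mem_conjOp_graph, mulOp_graph, dilationGenerator, weakOp_graph]
  refine Iff.trans ?_ (weak_deriv_iff_fourier (logIsometry p.1) (logIsometry p.2))
  have key : ∀ (f : HalfLineL2) (φ : ℝ → ℂ),
      ∫ x in Ioi (0 : ℝ), f x * φ x = ∫ u, logIsometry f u * logPullback φ u := by
    intro f φ
    rw [← integral_logPullback_mul]
    refine integral_congr_ae ?_
    filter_upwards [logIsometry_coe f] with u hu
    rw [hu]
  have key2 : ∀ (f : HalfLineL2) (φ : ℝ → ℂ), IsTest φ →
      ∫ x in Ioi (0 : ℝ), f x * dilationTranspose φ x =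
        -Complex.I * ∫ u, logIsometry f u * deriv (logPullback φ) u := by
    intro f φ hφ
    rw [key, ← integral_const_mul]
    congr 1
    funext u
    rw [logPullback_dilationTranspose hφ]
    ring
  constructor
  · intro h ψ hψ hψc
    obtain ⟨φ, hφ, rfl⟩ := exists_isTest_logPullback hψ hψc
    rw [← key, ← key2 _ _ hφ]
    exact h φ hφ
  · intro h φ hφ
    rw [key, key2 _ _ hφ]
    exact h _ hφ.logPullback_contDiff hφ.logPullback_compact

/-! ### Bounded functions of the generator of dilations -/

/-- `φ(A)` for a bounded measurable function `φ` of the generator of dilations `A`. -/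
noncomputable def dilationFunction (φ : ℝ → ℂ) (hφ : Measurable φ) (C : ℝ) (hC : ∀ t, ‖φ t‖ ≤ C) :
    HalfLineL2 →L[ℂ] HalfLineL2 :=
  (mellinL2.symm.toContinuousLinearEquiv : LineL2 →L[ℂ] HalfLineL2) ∘L
    boundedMul volume (fun x : ℝ => φ (-2 * Real.pi * x)) (hφ.comp (by fun_prop)) C (fun _ => hC _) ∘L
    (mellinL2.toContinuousLinearEquiv : HalfLineL2 →L[ℂ] LineL2)

theorem mellinL2_dilationFunction {φ : ℝ → ℂ} (hφ : Measurable φ) {C : ℝ} (hC : ∀ t, ‖φ t‖ ≤ C)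
    (f : HalfLineL2) : ⇑(mellinL2 (dilationFunction φ hφ C hC f)) =ᵐ[volume]
      fun x => φ (-2 * Real.pi * x) * mellinL2 f x := by
  have h : mellinL2 (dilationFunction φ hφ C hC f) = boundedMul volume
      (fun x : ℝ => φ (-2 * Real.pi * x)) (hφ.comp (by fun_prop)) C (fun _ => hC _) (mellinL2 f) :=
    mellinL2.apply_symm_apply _
  rw [h]
  exact boundedMul_coe _ _ _

theorem isFunctionOf_dilationFunction {φ : ℝ → ℂ} (hφ : Measurable φ) {C : ℝ}
    (hC : ∀ t, ‖φ t‖ ≤ C) : IsFunctionOf dilationGenerator φ (dilationFunction φ hφ C hC) :=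
  ⟨hφ, ℝ, inferInstance, volume, mellinL2, fun x => -2 * Real.pi * x, by fun_prop,
    dilationGenerator_eq_conjOp, mellinL2_dilationFunction hφ hC⟩

theorem isFunctionOf_dilationGenerator_iff {φ : ℝ → ℂ} (hφ : Continuous φ) {C : ℝ}
    (hC : ∀ t, ‖φ t‖ ≤ C) (B : HalfLineL2 →L[ℂ] HalfLineL2) :
    IsFunctionOf dilationGenerator φ B ↔ B = dilationFunction φ hφ.measurable C hC :=
  ⟨fun h => h.unique hφ hC (isFunctionOf_dilationFunction _ _),
    fun h => h ▸ isFunctionOf_dilationFunction _ _⟩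

theorem dilationFunction_mul_eq_id {φ ψ : ℝ → ℂ} (hφ : Measurable φ) {C : ℝ}
    (hC : ∀ t, ‖φ t‖ ≤ C) (hψ : Measurable ψ) {C' : ℝ} (hC' : ∀ t, ‖ψ t‖ ≤ C')
    (h : ∀ t, φ t * ψ t = 1) (f : HalfLineL2) :
    dilationFunction φ hφ C hC (dilationFunction ψ hψ C' hC' f) = f := by
  refine mellinL2.injective (Lp.ext ?_)
  filter_upwards [mellinL2_dilationFunction hφ hC (dilationFunction ψ hψ C' hC' f),
    mellinL2_dilationFunction hψ hC' f] with x h1 h2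
  rw [h1, h2, ← mul_assoc, h, one_mul]

theorem Xi_inv_bounded {m : ℂ} (hm : -1 < m.re) (t : ℝ) :
    ‖(Xi m t)⁻¹‖ ≤ (Xi_bounded hm).choose := by
  rw [Xi_inv hm]; exact (Xi_bounded hm).choose_spec _

theorem continuous_Xi_inv {m : ℂ} (hm : -1 < m.re) : Continuous fun t => (Xi m t)⁻¹ :=
  (continuous_Xi hm).inv₀ (Xi_ne_zero hm)

/-- The operator `Ξ_m(A)`. -/
noncomputable def XiA {m : ℂ} (hm : -1 < m.re) : HalfLineL2 ≃L[ℂ] HalfLineL2 :=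
  ContinuousLinearEquiv.equivOfInverse
    (dilationFunction (Xi m) (continuous_Xi hm).measurable _ (Xi_bounded hm).choose_spec)
    (dilationFunction (fun t => (Xi m t)⁻¹) (continuous_Xi_inv hm).measurable _ (Xi_inv_bounded hm))
    (dilationFunction_mul_eq_id _ _ _ _ fun t => inv_mul_cancel₀ (Xi_ne_zero hm t))
    (dilationFunction_mul_eq_id _ _ _ _ fun t => mul_inv_cancel₀ (Xi_ne_zero hm t))

theorem isFunctionOf_Xi_iff {m : ℂ} (hm : -1 < m.re) (B : HalfLineL2 →L[ℂ] HalfLineL2) :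
    IsFunctionOf dilationGenerator (Xi m) B ↔ B = XiA hm :=
  isFunctionOf_dilationGenerator_iff (continuous_Xi hm) (Xi_bounded hm).choose_spec B

theorem isFunctionOf_Xi_inv_iff {m : ℂ} (hm : -1 < m.re) (B : HalfLineL2 →L[ℂ] HalfLineL2) :
    IsFunctionOf dilationGenerator (fun t => (Xi m t)⁻¹) B ↔ B = (XiA hm).symm :=
  isFunctionOf_dilationGenerator_iff (continuous_Xi_inv hm) (Xi_inv_bounded hm) B

theorem mellinL2_XiA {m : ℂ} (hm : -1 < m.re) (f : HalfLineL2) :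
    ⇑(mellinL2 (XiA hm f)) =ᵐ[volume] fun x => Xi m (-2 * Real.pi * x) * mellinL2 f x :=
  mellinL2_dilationFunction (continuous_Xi hm).measurable (Xi_bounded hm).choose_spec f

theorem mellinL2_XiA_symm {m : ℂ} (hm : -1 < m.re) (f : HalfLineL2) :
    ⇑(mellinL2 ((XiA hm).symm f)) =ᵐ[volume] fun x => (Xi m (-2 * Real.pi * x))⁻¹ * mellinL2 f x :=
  mellinL2_dilationFunction (continuous_Xi_inv hm).measurable (Xi_inv_bounded hm) f

theorem inversion_inversion (f : HalfLineL2) : inversion (inversion f) = f := by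
  refine mellinL2.injective (Lp.ext ?_)
  have h := (Measure.measurePreserving_neg (volume : Measure ℝ)).quasiMeasurePreserving.ae
    (mellinL2_inversion f)
  filter_upwards [mellinL2_inversion (inversion f), h] with x h1 h2
  rw [h1, h2, neg_neg]

/-- The bounded operator `I Ξ_m(A)`, which turns out to be the Hankel transformation. -/
noncomputable def hankelCLM {m : ℂ} (hm : -1 < m.re) : HalfLineL2 →L[ℂ] HalfLineL2 :=
  inversion.toContinuousLinearMap ∘L (XiA hm : HalfLineL2 →L[ℂ] HalfLineL2)

theorem hankelCLM_apply {m : ℂ} (hm : -1 < m.re) (f : HalfLineL2) :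
    hankelCLM hm f = inversion (XiA hm f) := rfl

theorem mellinL2_hankelCLM {m : ℂ} (hm : -1 < m.re) (f : HalfLineL2) :
    ⇑(mellinL2 (hankelCLM hm f)) =ᵐ[volume]
      fun x => Xi m (2 * Real.pi * x) * mellinL2 f (-x) := by
  have h := (Measure.measurePreserving_neg (volume : Measure ℝ)).quasiMeasurePreserving.ae
    (mellinL2_XiA hm f)
  filter_upwards [mellinL2_inversion (XiA hm f), h] with x h1 h2
  rw [hankelCLM_apply, h1, h2]
  ring_nf

/-- After the Mellin transformation both sides multiply the reflected function, by `Ξ_m(2πx)` and by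
`Ξ_m(-2πx)⁻¹` respectively. -/
theorem hankelCLM_eq_symm {m : ℂ} (hm : -1 < m.re) (f : HalfLineL2) :
    hankelCLM hm f = (XiA hm).symm (inversion f) := by
  refine mellinL2.injective (Lp.ext ?_)
  filter_upwards [mellinL2_hankelCLM hm f, mellinL2_XiA_symm hm (inversion f),
    mellinL2_inversion f] with x h1 h2 h3
  rw [h1, h2, h3, Xi_inv hm]
  ring_nf

theorem hankelCLM_hankelCLM {m : ℂ} (hm : -1 < m.re) (f : HalfLineL2) :
    hankelCLM hm (hankelCLM hm f) = f := by
  rw [hankelCLM_eq_symm hm (hankelCLM hm f), hankelCLM_apply, inversion_inversion,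
    ContinuousLinearEquiv.symm_apply_apply]

/-! ### Gaussians and their Mellin transforms -/

/-- The function `x^{m+1/2} e^{-a x²/2}`. -/
noncomputable def gauss (m : ℂ) (a : ℝ) (x : ℝ) : ℂ := (x : ℂ) ^ (m + 1 / 2) * Real.exp (-(a / 2) * x ^ 2)

theorem measurable_gauss (m : ℂ) (a : ℝ) : Measurable (gauss m a) := by
  unfold gauss
  refine Measurable.mul ?_ (by fun_prop)
  exact Complex.measurable_ofReal.pow_const _

theorem norm_gauss (m : ℂ) (a : ℝ) {x : ℝ} (hx : 0 < x) :
    ‖gauss m a x‖ = x ^ (m.re + 1 / 2) * Real.exp (-(a / 2) * x ^ 2) := by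
  rw [gauss, norm_mul, Complex.norm_cpow_eq_rpow_re_of_pos hx, Complex.norm_real,
    Real.norm_of_nonneg (Real.exp_pos _).le]
  simp

theorem memLp_gauss {m : ℂ} (hm : -1 < m.re) {a : ℝ} (ha : 0 < a) : MemLp (gauss m a) 2 halfLine := by
  refine (memLp_two_iff_integrable_sq_norm (measurable_gauss m a).aestronglyMeasurable).mpr ?_
  refine (integrableOn_rpow_mul_exp_neg_mul_sq (b := a) (s := 2 * m.re + 1) ha (by linarith)).congr ?_
  filter_upwards [ae_restrict_mem measurableSet_Ioi] with x hx
  have hx' : 0 < x := hx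
  rw [norm_gauss m a hx', mul_pow, ← Real.rpow_mul_natCast hx'.le, ← Real.exp_nat_mul]
  congr 1
  · congr 1; push_cast; ring
  · congr 1; push_cast; ring

theorem integrable_logPullback_gauss {m : ℂ} (hm : -1 < m.re) {a : ℝ} (ha : 0 < a) :
    Integrable (logPullback (gauss m a)) := by
  have h1 := integrableOn_rpow_mul_exp_neg_mul_sq (b := a / 2) (s := m.re) (by positivity) hm
  rw [← exp_neg_image, integrableOn_image_iff_integrableOn_abs_deriv_smul MeasurableSet.univ
    (fun u _ => (hasDerivAt_exp_neg u).hasDerivWithinAt) exp_neg_injOn, integrableOn_univ] at h1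
  refine h1.mono' (logPullback_memLp (memLp_gauss hm ha)).1 (ae_of_all _ fun u => le_of_eq ?_)
  rw [logPullback, norm_mul, norm_gauss m a (Real.exp_pos _), Complex.norm_real,
    Real.norm_of_nonneg (Real.exp_pos _).le, abs_neg, abs_of_pos (Real.exp_pos _), smul_eq_mul]
  simp only [← Real.exp_mul, ← Real.exp_add]
  congr 1
  ring

/-- Substituting `y = x²` turns the integral into Euler's integral for the Gamma function. -/
theorem mellin_gauss (m : ℂ) {a : ℝ} (ha : 0 < a) {s : ℂ} (hs : 0 < s.re + m.re + 1 / 2) :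
    mellin (gauss m a) s = 1 / 2 * ((2 / a : ℝ) : ℂ) ^ ((s + m + 1 / 2) / 2) *
      Complex.Gamma ((s + m + 1 / 2) / 2) := by
  have h1 : gauss m a = fun x : ℝ => (x : ℂ) ^ (m + 1 / 2) •
      (fun y : ℝ => (fun t : ℝ => Complex.exp (-(((a / 2 : ℝ) : ℂ) * t))) (y ^ (2 : ℝ))) x := by
    funext x
    simp only [gauss, smul_eq_mul]
    congr 1
    rw [Complex.ofReal_exp]
    congr 1
    rw [Real.rpow_two]
    push_cast
    ring
  rw [h1, mellin_cpow_smul,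
    mellin_comp_rpow (fun t : ℝ => Complex.exp (-(((a / 2 : ℝ) : ℂ) * t)))]
  have h2 : (s + (m + 1 / 2)) / ((2 : ℝ) : ℂ) = (s + m + 1 / 2) / 2 := by push_cast; ring
  rw [h2, mellin]
  have h3 := Complex.integral_cpow_mul_exp_neg_mul_Ioi (a := (s + m + 1 / 2) / 2) (r := a / 2)
    (by simp; linarith) (by positivity)
  simp only [smul_eq_mul]
  rw [h3]
  have h4 : (1 / ((a / 2 : ℝ) : ℂ)) = ((2 / a : ℝ) : ℂ) := by push_cast; field_simp
  rw [h4, abs_of_pos (by norm_num : (0:ℝ) < 2), Complex.real_smul]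
  push_cast
  ring

/-- `x^{m+1/2} e^{-a x²/2}` as an element of `L²`. -/
noncomputable def gaussL2 {m : ℂ} (hm : -1 < m.re) {a : ℝ} (ha : 0 < a) : HalfLineL2 :=
  (memLp_gauss hm ha).toLp _

theorem gaussL2_coe {m : ℂ} (hm : -1 < m.re) {a : ℝ} (ha : 0 < a) :
    ⇑(gaussL2 hm ha) =ᵐ[halfLine] gauss m a := (memLp_gauss hm ha).coeFn_toLp

theorem mellinL2_gaussL2 {m : ℂ} (hm : -1 < m.re) {a : ℝ} (ha : 0 < a) :
    ⇑(mellinL2 (gaussL2 hm ha)) =ᵐ[volume] fun x : ℝ =>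
      1 / 2 * ((2 / a : ℝ) : ℂ) ^ ((m + 1 + Complex.I * (2 * Real.pi * x : ℝ)) / 2) *
        Complex.Gamma ((m + 1 + Complex.I * (2 * Real.pi * x : ℝ)) / 2) := by
  rw [mellinL2_apply, gaussL2, logIsometry_toLp]
  refine (fourier_toLp_of_integrable (integrable_logPullback_gauss hm ha) _).trans
    (ae_of_all _ fun x => ?_)
  have h := mellin_eq_fourier (gauss m a) (s := 1 / 2 + Complex.I * (2 * Real.pi * x : ℝ))
  have h1 : (1 / 2 + Complex.I * (2 * Real.pi * x : ℝ) : ℂ).re = 1 / 2 := by simp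
  have h2 : (1 / 2 + Complex.I * (2 * Real.pi * x : ℝ) : ℂ).im = 2 * Real.pi * x := by simp
  rw [h1, h2, mellin_gauss m ha (by rw [h1]; linarith)] at h
  have h3 : (fun u : ℝ => Real.exp (-(1 / 2) * u) • gauss m a (Real.exp (-u))) =
      logPullback (gauss m a) := by
    funext u
    rw [logPullback, Complex.real_smul]
    ring_nf
  have h4 : 2 * Real.pi * x / (2 * Real.pi) = x := by
    field_simp
  rw [h3, h4] at h
  rw [← h]
  ring_nf

/-- The Mellin transform of `x^{m+1/2} e^{-a x²/2}` on the critical line. -/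
noncomputable def gaussMellin (m : ℂ) (a t : ℝ) : ℂ :=
  1 / 2 * ((2 / a : ℝ) : ℂ) ^ ((m + 1 + Complex.I * t) / 2) *
    Complex.Gamma ((m + 1 + Complex.I * t) / 2)

/-- The Gamma factor of the Gaussian at `-t` is the denominator of `Ξ_m(t)` and is replaced by the
numerator, which is the Gamma factor at `t`. The phase `e^{i ln(2) t}` converts `2^{(m+1-it)/2}`
into `2^{(m+1+it)/2}`, and the powers of `a` leave `a^{-(m+1)}`. -/
theorem Xi_mul_gaussMellin {m : ℂ} (hm : -1 < m.re) {a : ℝ} (ha : 0 < a) (t : ℝ) :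
    Xi m t * gaussMellin m a (-t) = (a : ℂ) ^ (-(m + 1)) * gaussMellin m a⁻¹ t := by
  have hden := Xi_denominator_ne_zero hm t
  have e1 : (m + 1 + Complex.I * ((-t : ℝ) : ℂ)) / 2 = (m + 1 - Complex.I * t) / 2 := by
    push_cast; ring
  rw [Xi, gaussMellin, gaussMellin, e1]
  have hcpow : ∀ {b : ℝ} (_ : 0 < b) (z : ℂ), (b : ℂ) ^ z = Complex.exp (Real.log b * z) := by
    intro b hb z
    rw [Complex.cpow_def_of_ne_zero (by exact_mod_cast hb.ne'), Complex.ofReal_log hb.le]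
  rw [hcpow (b := 2 / a) (by positivity), hcpow (b := 2 / a⁻¹) (by positivity), hcpow ha,
    Real.log_div (by norm_num) ha.ne', Real.log_div (by norm_num) (by positivity), Real.log_inv]
  have e2 : Complex.exp (Complex.I * Real.log 2 * t) *
      Complex.exp (((Real.log 2 - Real.log a : ℝ) : ℂ) * ((m + 1 - Complex.I * t) / 2)) =
      Complex.exp (Real.log a * -(m + 1)) *
      Complex.exp (((Real.log 2 - -Real.log a : ℝ) : ℂ) * ((m + 1 + Complex.I * t) / 2)) := by
    rw [← Complex.exp_add, ← Complex.exp_add]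
    congr 1
    push_cast
    ring
  generalize Complex.exp (Complex.I * Real.log 2 * t) = p at e2 ⊢
  generalize Complex.exp (((Real.log 2 - Real.log a : ℝ) : ℂ) * ((m + 1 - Complex.I * t) / 2)) = q
    at e2 ⊢
  generalize Complex.exp (Real.log a * -(m + 1)) = r at e2 ⊢
  generalize Complex.exp (((Real.log 2 - -Real.log a : ℝ) : ℂ) * ((m + 1 + Complex.I * t) / 2)) = s
    at e2 ⊢
  field_simp
  linear_combination (Complex.Gamma ((m + 1 + Complex.I * t) / 2)) * e2

theorem gaussMellin_add_two {m : ℂ} (hm : -1 < m.re) {a : ℝ} (ha : 0 < a) (t : ℝ) :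
    gaussMellin (m + 2) a t = (m + 1 + Complex.I * t) / a * gaussMellin m a t := by
  have h0 : (m + 1 + Complex.I * t) / 2 ≠ 0 := fun h => by
    have := congrArg Complex.re h
    simp at this
    linarith
  have e1 : (m + 2 + 1 + Complex.I * t) / 2 = (m + 1 + Complex.I * t) / 2 + 1 := by ring
  have h2 : ((2 / a : ℝ) : ℂ) ≠ 0 := by
    have : 2 / a ≠ 0 := by positivity
    exact_mod_cast this
  rw [gaussMellin, gaussMellin, e1, Complex.Gamma_add_one _ h0, Complex.cpow_add _ _ h2,
    Complex.cpow_one]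
  push_cast
  ring

theorem mellinL2_gaussL2_eq {m : ℂ} (hm : -1 < m.re) {a : ℝ} (ha : 0 < a) :
    ⇑(mellinL2 (gaussL2 hm ha)) =ᵐ[volume] fun x : ℝ => gaussMellin m a (2 * Real.pi * x) :=
  mellinL2_gaussL2 hm ha

theorem hankelCLM_gaussL2 {m : ℂ} (hm : -1 < m.re) {a : ℝ} (ha : 0 < a) :
    hankelCLM hm (gaussL2 hm ha) = (a : ℂ) ^ (-(m + 1)) • gaussL2 hm (inv_pos.mpr ha) := by
  refine mellinL2.injective (Lp.ext ?_)
  have h := (Measure.measurePreserving_neg (volume : Measure ℝ)).quasiMeasurePreserving.ae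
    (mellinL2_gaussL2_eq hm ha)
  rw [map_smul]
  filter_upwards [mellinL2_hankelCLM hm (gaussL2 hm ha), h,
    mellinL2_gaussL2_eq hm (inv_pos.mpr ha),
    Lp.coeFn_smul ((a : ℂ) ^ (-(m + 1))) (mellinL2 (gaussL2 hm (inv_pos.mpr ha)))] with x h1 h2 h3 h4
  rw [h1, h2, h4, Pi.smul_apply, h3, smul_eq_mul, ← Xi_mul_gaussMellin hm ha, mul_neg]

theorem add_two_re {m : ℂ} (hm : -1 < m.re) : -1 < (m + 2).re := by
  simp; linarith

theorem gauss_add_two (m : ℂ) (a : ℝ) {x : ℝ} (hx : 0 < x) :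
    gauss (m + 2) a x = (x : ℂ) ^ 2 * gauss m a x := by
  have hx' : (x : ℂ) ≠ 0 := by exact_mod_cast hx.ne'
  rw [gauss, gauss, show m + 2 + 1 / 2 = (m + 1 / 2) + (2 : ℕ) by push_cast; ring,
    Complex.cpow_add _ _ hx', Complex.cpow_natCast]
  ring

/-- The image of `x^{m+1/2} e^{-a x²/2}` under the differential expression `L_{m²}`. -/
noncomputable def gaussLap {m : ℂ} (hm : -1 < m.re) {a : ℝ} (ha : 0 < a) : HalfLineL2 :=
  ((2 * m + 2) * a) • gaussL2 hm ha - ((a : ℂ) ^ 2) • gaussL2 (add_two_re hm) ha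

theorem gaussLap_coe {m : ℂ} (hm : -1 < m.re) {a : ℝ} (ha : 0 < a) :
    ⇑(gaussLap hm ha) =ᵐ[halfLine]
      fun x => ((2 * m + 2) * a - (a : ℂ) ^ 2 * (x : ℂ) ^ 2) * gauss m a x := by
  filter_upwards [Lp.coeFn_sub (((2 * m + 2) * a) • gaussL2 hm ha)
      (((a : ℂ) ^ 2) • gaussL2 (add_two_re hm) ha),
    Lp.coeFn_smul ((2 * m + 2) * a) (gaussL2 hm ha), gaussL2_coe hm ha,
    Lp.coeFn_smul ((a : ℂ) ^ 2) (gaussL2 (add_two_re hm) ha), gaussL2_coe (add_two_re hm) ha,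
    ae_restrict_mem measurableSet_Ioi] with x h1 h2 h3 h4 h5 hx
  rw [gaussLap, h1, Pi.sub_apply, h2, h4, Pi.smul_apply, Pi.smul_apply, h3, h5, gauss_add_two m a hx,
    smul_eq_mul, smul_eq_mul]
  ring

/-- In view of `hankelCLM_gaussL2` this says that the Hankel transformation turns the Schrödinger
expression into multiplication by the squared variable, on Gaussians. By `Γ(z + 1) = z Γ(z)`, both
sides have the same extra factor `a (m + 1 + it)` in Mellin space: on the left it is `(2m + 2)a -
a(m + 1 - it)`. -/
theorem hankelCLM_gaussLap {m : ℂ} (hm : -1 < m.re) {a : ℝ} (ha : 0 < a) :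
    hankelCLM hm (gaussLap hm ha) =
      (a : ℂ) ^ (-(m + 1)) • gaussL2 (add_two_re hm) (inv_pos.mpr ha) := by
  refine mellinL2.injective (Lp.ext ?_)
  have hq := (Measure.measurePreserving_neg (volume : Measure ℝ)).quasiMeasurePreserving
  have e : mellinL2 (gaussLap hm ha) = ((2 * m + 2) * a) • mellinL2 (gaussL2 hm ha) -
      ((a : ℂ) ^ 2) • mellinL2 (gaussL2 (add_two_re hm) ha) := by
    rw [gaussLap, map_sub, map_smul, map_smul]
  have hl : ⇑(mellinL2 (gaussLap hm ha)) =ᵐ[volume] fun x =>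
      (2 * m + 2) * a * gaussMellin m a (2 * Real.pi * x) -
        (a : ℂ) ^ 2 * gaussMellin (m + 2) a (2 * Real.pi * x) := by
    rw [e]
    filter_upwards [Lp.coeFn_sub (((2 * m + 2) * a) • mellinL2 (gaussL2 hm ha))
        (((a : ℂ) ^ 2) • mellinL2 (gaussL2 (add_two_re hm) ha)),
      Lp.coeFn_smul ((2 * m + 2) * a) (mellinL2 (gaussL2 hm ha)), mellinL2_gaussL2_eq hm ha,
      Lp.coeFn_smul ((a : ℂ) ^ 2) (mellinL2 (gaussL2 (add_two_re hm) ha)),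
      mellinL2_gaussL2_eq (add_two_re hm) ha] with x h1 h2 h3 h4 h5
    rw [h1, Pi.sub_apply, h2, h4, Pi.smul_apply, Pi.smul_apply, h3, h5, smul_eq_mul, smul_eq_mul]
  rw [map_smul]
  filter_upwards [mellinL2_hankelCLM hm (gaussLap hm ha), hq.ae hl,
    mellinL2_gaussL2_eq (add_two_re hm) (inv_pos.mpr ha),
    Lp.coeFn_smul ((a : ℂ) ^ (-(m + 1))) (mellinL2 (gaussL2 (add_two_re hm) (inv_pos.mpr ha)))]
    with x h1 h2 h3 h4
  rw [h1, h2, h4, Pi.smul_apply, h3, smul_eq_mul, gaussMellin_add_two hm ha,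
    gaussMellin_add_two hm (inv_pos.mpr ha), mul_neg]
  have h5 := Xi_mul_gaussMellin hm ha (2 * Real.pi * x)
  have ha' : (a : ℂ) ≠ 0 := by exact_mod_cast ha.ne'
  generalize gaussMellin m a (-(2 * Real.pi * x)) = p at h5 ⊢
  generalize gaussMellin m a⁻¹ (2 * Real.pi * x) = q at h5 ⊢
  generalize (a : ℂ) ^ (-(m + 1)) = r at h5 ⊢
  generalize 2 * Real.pi * x = t at h5 ⊢
  push_cast
  field_simp
  linear_combination (m + 1 + Complex.I * t) * h5

/-! ### Uniqueness for integrals against Gaussians -/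

theorem integral_polynomial_exp_eq_zero {E : ℝ → ℂ} (hE : IntegrableOn E (Ioi 0))
    (h : ∀ n : ℕ, ∫ x in Ioi (0 : ℝ), E x * (Real.exp (-(1 / 2) * x ^ 2) ^ n : ℝ) = 0)
    (p : Polynomial ℝ) :
    (IntegrableOn (fun x => E x * (p.eval (Real.exp (-(1 / 2) * x ^ 2)) : ℝ)) (Ioi 0)) ∧
    ∫ x in Ioi (0 : ℝ), E x * (p.eval (Real.exp (-(1 / 2) * x ^ 2)) : ℝ) = 0 := by
  induction p using Polynomial.induction_on' with
  | add p q hp hq =>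
    simp only [Polynomial.eval_add, Complex.ofReal_add, mul_add]
    refine ⟨hp.1.add hq.1, ?_⟩
    rw [integral_add hp.1 hq.1, hp.2, hq.2, add_zero]
  | monomial n c =>
    simp only [Polynomial.eval_monomial]
    have e : (fun x => E x * ((c * Real.exp (-(1 / 2) * x ^ 2) ^ n : ℝ) : ℂ)) =
        fun x => (c : ℂ) * (E x * ((Real.exp (-(1 / 2) * x ^ 2) ^ n : ℝ) : ℂ)) := by
      funext x; push_cast; ring
    rw [e]
    refine ⟨Integrable.const_mul ?_ _, by rw [integral_const_mul, h, mul_zero]⟩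
    refine (hE.bdd_mul (c := 1) (f := fun x => ((Real.exp (-(1 / 2) * x ^ 2) ^ n : ℝ) : ℂ))
      (Continuous.aestronglyMeasurable (by fun_prop)) (ae_of_all _ fun x => ?_)).congr
      (ae_of_all _ fun x => mul_comm _ _)
    rw [Complex.norm_real, norm_pow, Real.norm_of_nonneg (Real.exp_pos _).le]
    exact pow_le_one₀ (Real.exp_pos _).le (Real.exp_le_one_iff.mpr (by nlinarith [sq_nonneg x]))

theorem gauss_add (m : ℂ) (a b x : ℝ) :
    gauss m (a + b) x = gauss m a x * Real.exp (-(b / 2) * x ^ 2) := by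
  rw [gauss, gauss, mul_assoc, ← Complex.ofReal_mul, ← Real.exp_add]
  ring_nf

theorem gauss_ne_zero (m : ℂ) (a : ℝ) {x : ℝ} (hx : 0 < x) : gauss m a x ≠ 0 := by
  rw [← norm_ne_zero_iff, norm_gauss m a hx]
  positivity

/-- A function on the half-line is determined by its integrals against Gaussians. -/
theorem ae_zero_of_integral_gauss {m : ℂ} {D : ℝ → ℂ} {a₀ : ℝ}
    (hD : IntegrableOn (fun x => D x * gauss m a₀ x) (Ioi 0))
    (h : ∀ a ≥ a₀, ∫ x in Ioi (0 : ℝ), D x * gauss m a x = 0) : D =ᵐ[halfLine] 0 := by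
  set E : ℝ → ℂ := fun x => D x * gauss m a₀ x with hE
  have h0 : ∀ n : ℕ, ∫ x in Ioi (0 : ℝ), E x * (Real.exp (-(1 / 2) * x ^ 2) ^ n : ℝ) = 0 := by
    intro n
    rw [← h (a₀ + n) (by simp)]
    congr 1
    funext x
    rw [gauss_add, ← Real.exp_nat_mul, hE, mul_assoc]
    congr 3
    ring_nf
  have key : ∀ᵐ x ∂(volume : Measure ℝ), x ∈ Ioi (0 : ℝ) → E x = 0 := by
    refine isOpen_Ioi.ae_eq_zero_of_integral_contDiff_smul_eq_zero hD.locallyIntegrableOn ?_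
    intro ψ h1 h2 h3
    have hψ0 : ∀ x ≤ 0, ψ x = 0 := fun x hx =>
      image_eq_zero_of_notMem_tsupport fun h4 => absurd (h3 h4) (not_lt.mpr hx)
    obtain ⟨R, hR⟩ := h2.isCompact.isBounded.subset_closedBall 0
    -- The variable `y = e^{-x²/2}` maps the half-line onto `]0, 1[`, and `q` is the test function
    -- in this variable. It is continuous on `[0, 1]`, hence a uniform limit of polynomials, against
    -- which `E` integrates to zero.
    set q : ℝ → ℝ := fun y => ψ (Real.sqrt (-2 * Real.log y)) with hq
    have hqe : ∀ x : ℝ, 0 < x → q (Real.exp (-(1 / 2) * x ^ 2)) = ψ x := by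
      intro x hx
      rw [hq]
      simp only [Real.log_exp]
      congr 1
      rw [show -2 * (-(1 / 2) * x ^ 2) = x ^ 2 by ring, Real.sqrt_sq hx.le]
    have hqc : ContinuousOn q (Icc 0 1) := by
      intro y hy
      refine ContinuousAt.continuousWithinAt ?_
      rcases hy.1.eq_or_lt with hy0 | hy0
      · have h4 : q =ᶠ[𝓝 y] fun _ => 0 := by
          have h5 : Tendsto (fun y => -2 * Real.log y) (𝓝[≠] 0) atTop :=
            Real.tendsto_log_nhdsNE_zero.const_mul_atBot_of_neg (by norm_num)
          have h6 := h5.eventually_gt_atTop (R ^ 2)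
          rw [eventually_nhdsWithin_iff] at h6
          rw [← hy0]
          filter_upwards [h6] with z hz
          -- At the endpoint the convention `Real.log 0 = 0` gives the value `ψ 0 = 0`. At the other
          -- nearby `z`, of either sign, the square root exceeds the radius `R` of the support.
          by_cases hz0 : z = 0
          · rw [hq]; simp only [hz0]; simp [hψ0]
          · have h7 := hz hz0
            show ψ (Real.sqrt (-2 * Real.log z)) = 0
            refine image_eq_zero_of_notMem_tsupport fun h8 => ?_
            have h9 := hR h8
            rw [mem_closedBall_zero_iff, Real.norm_eq_abs, abs_of_nonneg (Real.sqrt_nonneg _)] at h9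
            have h10 := Real.lt_sqrt_of_sq_lt h7
            linarith
        exact continuousAt_const.congr h4.symm
      · exact (h1.continuous.continuousAt.comp
          ((Real.continuous_sqrt.continuousAt).comp
            (continuousAt_const.mul (Real.continuousAt_log hy0.ne'))))
    have h6 : ∫ x, ψ x • E x = ∫ x in Ioi (0 : ℝ), E x * (ψ x : ℂ) := by
      rw [← setIntegral_eq_integral_of_forall_compl_eq_zero (s := Ioi 0)]
      · simp only [Complex.real_smul, mul_comm]
      · intro x hx
        rw [hψ0 x (not_lt.mp hx), zero_smul]
    rw [h6]
    have hle : ∀ ε > 0, ‖∫ x in Ioi (0 : ℝ), E x * (ψ x : ℂ)‖ ≤ ε * ∫ x in Ioi (0 : ℝ), ‖E x‖ := by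
      intro ε hε
      obtain ⟨p, hp⟩ := exists_polynomial_near_of_continuousOn 0 1 q hqc ε hε
      obtain ⟨hpi, hp0⟩ := integral_polynomial_exp_eq_zero hD h0 p
      have hψi : IntegrableOn (fun x => E x * (ψ x : ℂ)) (Ioi 0) := by
        obtain ⟨B, hB⟩ := h2.exists_bound_of_continuous h1.continuous
        refine (hD.bdd_mul (c := B) (f := fun x => (ψ x : ℂ))
          (Complex.continuous_ofReal.comp h1.continuous).aestronglyMeasurable
          (ae_of_all _ fun x => ?_)).congr (ae_of_all _ fun x => mul_comm _ _)
        rw [Complex.norm_real]; exact hB x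
      have e : ∫ x in Ioi (0 : ℝ), E x * (ψ x : ℂ) =
          ∫ x in Ioi (0 : ℝ), (E x * (ψ x : ℂ) - E x * (p.eval (Real.exp (-(1 / 2) * x ^ 2)) : ℝ)) := by
        rw [integral_sub hψi hpi, hp0, sub_zero]
      rw [e, ← integral_const_mul]
      refine norm_integral_le_of_norm_le (hD.norm.const_mul ε) ?_
      filter_upwards [ae_restrict_mem measurableSet_Ioi] with x hx
      have h7 := hp (Real.exp (-(1 / 2) * x ^ 2))
        ⟨(Real.exp_pos _).le, Real.exp_le_one_iff.mpr (by nlinarith [sq_nonneg x])⟩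
      rw [hqe x hx] at h7
      rw [← mul_sub, ← Complex.ofReal_sub, norm_mul, Complex.norm_real, Real.norm_eq_abs, abs_sub_comm,
        mul_comm]
      exact mul_le_mul_of_nonneg_right h7.le (norm_nonneg _)
    set I := ∫ x in Ioi (0 : ℝ), ‖E x‖
    have hI : 0 ≤ I := integral_nonneg fun x => norm_nonneg _
    refine norm_le_zero_iff.mp (le_of_forall_pos_le_add fun ε hε => ?_)
    have := hle (ε / (I + 1)) (by positivity)
    have h8 : ε / (I + 1) * I ≤ ε := by
      rw [div_mul_eq_mul_div, div_le_iff₀ (by positivity)]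
      nlinarith
    linarith
  have key' : ∀ᵐ x ∂halfLine, E x = 0 := (ae_restrict_iff' measurableSet_Ioi).mpr key
  filter_upwards [key', ae_restrict_mem measurableSet_Ioi] with x h1 h2
  exact (mul_eq_zero.mp h1).resolve_right (gauss_ne_zero m a₀ h2)

/-! ### Totality of the Gaussians -/

/-- A vector orthogonal to `S` has, after conjugation and multiplication by the weight, vanishing
integrals against all Gaussians. Weight 1 gives totality of the Gaussians; weight `1 + x²` is what
the core property of `X²` requires. -/
theorem eq_top_of_gauss_mem {m : ℂ} {wt : ℝ → ℂ} (hwt : ∀ x > 0, wt x ≠ 0)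
    {S : Submodule ℂ HalfLineL2} (hS : IsClosed (S : Set HalfLineL2))
    (h : ∀ b > 0, ∃ G ∈ S, ⇑G =ᵐ[halfLine] fun x => wt x * gauss m b x) : S = ⊤ := by
  have h1 : Sᗮ = ⊥ := by
    rw [eq_bot_iff]
    intro v hv
    rw [Submodule.mem_orthogonal'] at hv
    have key : ∀ b > 0, IntegrableOn (fun x => (wt x * starRingEnd ℂ (v x)) * gauss m b x) (Ioi 0) ∧
        ∫ x in Ioi (0 : ℝ), (wt x * starRingEnd ℂ (v x)) * gauss m b x = 0 := by
      intro b hb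
      obtain ⟨G, hG, hGe⟩ := h b hb
      have e : (fun x => inner ℂ (v x) (G x)) =ᵐ[halfLine]
          fun x => (wt x * starRingEnd ℂ (v x)) * gauss m b x := by
        filter_upwards [hGe] with x hx
        rw [hx, RCLike.inner_apply]
        ring
      refine ⟨(L2.integrable_inner (𝕜 := ℂ) v G).congr e, ?_⟩
      rw [← integral_congr_ae e, ← L2.inner_def]
      exact hv G hG
    have h0 := ae_zero_of_integral_gauss (key 1 one_pos).1
      fun a ha => (key a (by linarith [show a ≥ 1 from ha])).2
    refine (Lp.eq_zero_iff_ae_eq_zero).mpr ?_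
    filter_upwards [h0, ae_restrict_mem measurableSet_Ioi] with x hx hx'
    simpa [hwt x hx'] using hx
  rw [← hS.submodule_topologicalClosure_eq]
  exact (Submodule.topologicalClosure_eq_top_iff).mpr h1

theorem eq_top_of_gaussL2_mem {m : ℂ} (hm : -1 < m.re) {S : Submodule ℂ HalfLineL2}
    (hS : IsClosed (S : Set HalfLineL2)) (h : ∀ b (hb : 0 < b), gaussL2 hm hb ∈ S) : S = ⊤ :=
  eq_top_of_gauss_mem (m := m) (wt := fun _ => 1) (fun _ _ => one_ne_zero) hS fun b hb =>
    ⟨_, h b hb, by simpa using gaussL2_coe hm hb⟩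

/-! ### The bilinear pairing -/

/-- The bilinear pairing `∫ f g` on `L²[0, ∞[`. -/
noncomputable def pairing (f : HalfLineL2) : HalfLineL2 →L[ℂ] ℂ := innerSL ℂ (star f)

theorem pairing_apply (f g : HalfLineL2) : pairing f g = ∫ x in Ioi (0 : ℝ), f x * g x := by
  rw [pairing, innerSL_apply_apply, L2.inner_def]
  refine integral_congr_ae ?_
  filter_upwards [Lp.coeFn_star f] with x hx
  rw [hx, RCLike.inner_apply, Pi.star_apply]
  simp [mul_comm]

theorem pairing_comm (f g : HalfLineL2) : pairing f g = pairing g f := by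
  rw [pairing_apply, pairing_apply]
  simp only [mul_comm]

theorem pairing_gaussL2 {m : ℂ} (hm : -1 < m.re) {a b : ℝ} (ha : 0 < a) (hb : 0 < b) :
    pairing (gaussL2 hm ha) (gaussL2 hm hb) =
      1 / 2 * ((2 / (a + b) : ℝ) : ℂ) ^ (m + 1) * Complex.Gamma (m + 1) := by
  have h := mellin_gauss m (add_pos ha hb) (s := m + 3 / 2) (by simp; linarith)
  have e1 : (m + 3 / 2 + m + 1 / 2) / 2 = m + 1 := by ring
  rw [e1] at h
  rw [← h, pairing_apply, mellin]
  refine integral_congr_ae ?_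
  filter_upwards [gaussL2_coe hm ha, gaussL2_coe hm hb, ae_restrict_mem measurableSet_Ioi]
    with x h1 h2 hx
  have hx' : (x : ℂ) ≠ 0 := by exact_mod_cast (ne_of_gt hx)
  rw [h1, h2, gauss_add, gauss, gauss, smul_eq_mul,
    show m + 3 / 2 - 1 = m + 1 / 2 by ring]
  ring

/-- On two Gaussians the pairing is a function of the product `a b`, hence symmetric; totality
extends this to one argument and then to the other. The pairing is bilinear because for nonreal `m`
the operator is symmetric but not self-adjoint. -/
theorem pairing_hankelCLM {m : ℂ} (hm : -1 < m.re) (f g : HalfLineL2) :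
    pairing (hankelCLM hm f) g = pairing f (hankelCLM hm g) := by
  have key : ∀ {a b : ℝ} (ha : 0 < a) (hb : 0 < b),
      pairing (hankelCLM hm (gaussL2 hm ha)) (gaussL2 hm hb) =
        1 / 2 * ((2 / (1 + a * b) : ℝ) : ℂ) ^ (m + 1) * Complex.Gamma (m + 1) := by
    intro a b ha hb
    rw [hankelCLM_gaussL2, pairing_comm, map_smul, pairing_gaussL2, smul_eq_mul]
    have e1 : (2 / (b + a⁻¹)) = a * (2 / (1 + a * b)) := by field_simp; ring
    have ha' : (a : ℂ) ^ (m + 1) ≠ 0 :=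
      (Complex.cpow_ne_zero_iff_of_exponent_ne_zero fun h => by
        have := congrArg Complex.re h; simp at this; linarith).mpr (by exact_mod_cast ha.ne')
    rw [e1, Complex.ofReal_mul, Complex.mul_cpow_ofReal_nonneg ha.le (by positivity),
      Complex.cpow_neg]
    field_simp
  have step : ∀ {a : ℝ} (ha : 0 < a) (g : HalfLineL2),
      pairing (hankelCLM hm (gaussL2 hm ha)) g = pairing (gaussL2 hm ha) (hankelCLM hm g) := by
    intro a ha g
    let T : HalfLineL2 →L[ℂ] ℂ :=
      pairing (hankelCLM hm (gaussL2 hm ha)) - (pairing (gaussL2 hm ha)) ∘L hankelCLM hm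
    have hT : T.ker = ⊤ := eq_top_of_gaussL2_mem hm T.isClosed_ker fun b hb => by
      rw [LinearMap.mem_ker]
      show pairing (hankelCLM hm (gaussL2 hm ha)) (gaussL2 hm hb) -
        pairing (gaussL2 hm ha) (hankelCLM hm (gaussL2 hm hb)) = 0
      rw [pairing_comm (gaussL2 hm ha), key, key, mul_comm b a, sub_self]
    have : g ∈ T.ker := hT ▸ Submodule.mem_top
    exact sub_eq_zero.mp this
  let T : HalfLineL2 →L[ℂ] ℂ := (pairing g) ∘L hankelCLM hm - pairing (hankelCLM hm g)
  have hT : T.ker = ⊤ := eq_top_of_gaussL2_mem hm T.isClosed_ker fun b hb => by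
    rw [LinearMap.mem_ker]
    show pairing g (hankelCLM hm (gaussL2 hm hb)) - pairing (hankelCLM hm g) (gaussL2 hm hb) = 0
    rw [pairing_comm g, step, pairing_comm, sub_self]
  have : f ∈ T.ker := hT ▸ Submodule.mem_top
  rw [pairing_comm, pairing_comm f]
  exact sub_eq_zero.mp this

/-! ### Dominated convergence in `L²` -/

theorem tendsto_eLpNorm_mul_of_bounded {ι : Type*} {l : Filter ι} [l.IsCountablyGenerated]
    {θ : ι → ℝ → ℂ} {f : ℝ → ℂ} (hf : MemLp f 2 halfLine) {C : ℝ}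
    (hθm : ∀ i, AEStronglyMeasurable (θ i) halfLine) (hθ : ∀ i x, ‖θ i x‖ ≤ C)
    (hlim : ∀ x > 0, Tendsto (fun i => θ i x) l (𝓝 0)) :
    Tendsto (fun i => eLpNorm (fun x => θ i x * f x) 2 halfLine) l (𝓝 0) := by
  simp only [eLpNorm_eq_lintegral_rpow_enorm_toReal (show (2 : ENNReal) ≠ 0 by norm_num)
    (show (2 : ENNReal) ≠ ⊤ by norm_num)]
  have h0 : (0 : ENNReal) = (∫⁻ _ in Ioi (0 : ℝ), (0 : ENNReal)) ^ (1 / (2 : ENNReal).toReal) := by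
    simp
  rw [h0]
  refine Filter.Tendsto.ennrpow_const _ ?_
  have hfin : ∫⁻ x in Ioi (0 : ℝ), ‖(C : ℂ) * f x‖ₑ ^ (2 : ENNReal).toReal ≠ ⊤ :=
    (lintegral_rpow_enorm_lt_top_of_eLpNorm_lt_top (by norm_num) (by norm_num)
      (hf.const_mul (C : ℂ)).2).ne
  refine tendsto_of_seq_tendsto fun i hi => tendsto_lintegral_of_dominated_convergence' _
    (fun n => ?_) (fun n => ae_of_all _ fun x => ?_) hfin ?_
  · exact ((hθm (i n)).mul hf.1).enorm.pow_const _
  · refine ENNReal.rpow_le_rpow ?_ (by norm_num)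
    rw [← ofReal_norm, ← ofReal_norm, norm_mul, norm_mul, Complex.norm_real]
    refine ENNReal.ofReal_le_ofReal (mul_le_mul_of_nonneg_right ?_ (norm_nonneg _))
    exact (hθ (i n) x).trans (le_abs_self C)
  · filter_upwards [ae_restrict_mem measurableSet_Ioi] with x hx
    have h1 : Tendsto (fun n => ‖θ (i n) x * f x‖ₑ) atTop (𝓝 0) := by
      have := (((hlim x hx).comp hi).mul_const (f x)).enorm
      simpa using this
    have h2 := Filter.Tendsto.ennrpow_const (2 : ENNReal).toReal h1
    simpa using h2

/-! ### The kernel of the Hankel transformation -/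

/-- For `n ≥ 1` the real part of `n + m + 1` is at least 1, so `|Γ(n + m + 1)|` does not decrease
from there on. The value at `n = 0` is kept separately since `Re (m + 1)` may be below 1. -/
theorem exists_inv_Gamma_bound {m : ℂ} (hm : -1 < m.re) :
    ∃ C : ℝ, 0 < C ∧ ∀ n : ℕ, ‖Complex.Gamma (n + m + 1)‖⁻¹ ≤ C := by
  have hne : ∀ n : ℕ, 0 < ‖Complex.Gamma (n + m + 1)‖ := fun n =>
    norm_pos_iff.mpr (Complex.Gamma_ne_zero_of_re_pos (by
      simp; linarith [(Nat.cast_nonneg n : (0:ℝ) ≤ n)]))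
  refine ⟨max ‖Complex.Gamma ((0 : ℕ) + m + 1)‖⁻¹ ‖Complex.Gamma ((1 : ℕ) + m + 1)‖⁻¹,
    lt_max_of_lt_left (inv_pos.mpr (hne 0)), fun n => ?_⟩
  rcases n with _ | n
  · exact le_max_left _ _
  · induction n with
    | zero => exact le_max_right _ _
    | succ n ih =>
      refine le_trans ?_ ih
      have hre : 1 ≤ ((n + 1 : ℕ) + m + 1).re := by
        simp; linarith [(Nat.cast_nonneg n : (0:ℝ) ≤ n)]
      have h1 : ((n + 1 + 1 : ℕ) + m + 1 : ℂ) = ((n + 1 : ℕ) + m + 1) + 1 := by push_cast; ring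
      have h2 : ((n + 1 : ℕ) + m + 1 : ℂ) ≠ 0 := fun h => by rw [h] at hre; simp at hre; linarith
      refine inv_anti₀ (hne _) ?_
      rw [h1, Complex.Gamma_add_one _ h2, norm_mul]
      exact le_mul_of_one_le_left (norm_nonneg _) (hre.trans (Complex.re_le_norm _))

/-- The kernel `J_m(y) √y`. -/
noncomputable def besselKernel (m : ℂ) (y : ℝ) : ℂ := besselJ m y * (Real.sqrt y : ℂ)

/-- The `n`-th term of the power series of `J_m(y) √y`. -/
noncomputable def besselTerm (m : ℂ) (n : ℕ) (y : ℝ) : ℂ :=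
  (-1) ^ n / (n.factorial * Complex.Gamma (n + m + 1)) * ((y / 2 : ℝ) : ℂ) ^ (2 * n + m) *
    (Real.sqrt y : ℂ)

/-- A crude majorant which sums to growth `e^{y²/4}`. This suffices because the kernel is only
integrated over bounded intervals or against sufficiently narrow Gaussians. -/
theorem exists_besselTerm_bound {m : ℂ} (hm : -1 < m.re) :
    ∃ C : ℝ, 0 < C ∧ ∀ (n : ℕ) (y : ℝ), 0 < y →
      ‖besselTerm m n y‖ ≤ C * y ^ (m.re + 1 / 2) * ((y ^ 2 / 4) ^ n / n.factorial) := by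
  obtain ⟨C, hC, h⟩ := exists_inv_Gamma_bound hm
  refine ⟨C / 2 ^ m.re, by positivity, fun n y hy => ?_⟩
  have hf : (0:ℝ) < n.factorial := by exact_mod_cast n.factorial_pos
  have e1 : (y / 2) ^ (2 * (n:ℝ) + m.re) = (y ^ 2 / 4) ^ n * (y ^ m.re / 2 ^ m.re) := by
    rw [Real.rpow_add (by positivity), Real.div_rpow hy.le (by norm_num) m.re]
    congr 1
    rw [show (2 * (n:ℝ)) = ((2 * n : ℕ) : ℝ) by push_cast; ring, Real.rpow_natCast, pow_mul]
    congr 1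
    ring
  have e2 : ‖besselTerm m n y‖ = (‖Complex.Gamma (n + m + 1)‖⁻¹ / 2 ^ m.re) * y ^ (m.re + 1 / 2) *
      ((y ^ 2 / 4) ^ n / n.factorial) := by
    rw [besselTerm, norm_mul, norm_mul, norm_div, norm_mul, norm_pow, norm_neg, norm_one, one_pow,
      Complex.norm_natCast, Complex.norm_cpow_eq_rpow_re_of_pos (by positivity), Complex.norm_real,
      Real.norm_of_nonneg (Real.sqrt_nonneg _)]
    have : (2 * (n:ℂ) + m).re = 2 * (n:ℝ) + m.re := by simp
    rw [this, e1, Real.rpow_add hy, Real.sqrt_eq_rpow]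
    field_simp
  rw [e2]
  gcongr
  exact h n

theorem summable_besselBound (c y : ℝ) :
    HasSum (fun n : ℕ => c * ((y ^ 2 / 4) ^ n / n.factorial)) (c * Real.exp (y ^ 2 / 4)) := by
  rw [Real.exp_eq_exp_ℝ]
  exact (NormedSpace.expSeries_div_hasSum_exp (y ^ 2 / 4)).mul_left c

theorem hasSum_besselTerm {m : ℂ} (hm : -1 < m.re) {y : ℝ} (hy : 0 < y) :
    HasSum (fun n => besselTerm m n y) (besselKernel m y) := by
  obtain ⟨C, hC, h⟩ := exists_besselTerm_bound hm
  have h1 : Summable fun n => besselTerm m n y :=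
    Summable.of_norm_bounded (summable_besselBound _ y).summable fun n => h n y hy
  rw [besselKernel, besselJ, ← tsum_mul_right]
  exact h1.hasSum

theorem exists_besselKernel_bound {m : ℂ} (hm : -1 < m.re) :
    ∃ C : ℝ, 0 < C ∧ ∀ y : ℝ, 0 < y →
      ‖besselKernel m y‖ ≤ C * y ^ (m.re + 1 / 2) * Real.exp (y ^ 2 / 4) := by
  obtain ⟨C, hC, h⟩ := exists_besselTerm_bound hm
  refine ⟨C, hC, fun y hy => ?_⟩
  rw [← (hasSum_besselTerm hm hy).tsum_eq]
  exact tsum_of_norm_bounded (summable_besselBound _ y) fun n => h n y hy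

theorem measurable_besselKernel (m : ℂ) : Measurable (besselKernel m) := by
  refine Measurable.mul (Measurable.tsum fun n => ?_) (by fun_prop)
  refine Measurable.const_mul ?_ _
  exact (Complex.measurable_ofReal.comp (by fun_prop)).pow_const _

theorem measurable_besselTerm (m : ℂ) (n : ℕ) : Measurable (besselTerm m n) := by
  refine Measurable.mul (Measurable.const_mul ?_ _) (by fun_prop)
  exact (Complex.measurable_ofReal.comp (by fun_prop)).pow_const _

theorem ofReal_cpow_eq_exp {b : ℝ} (hb : 0 < b) (z : ℂ) :
    (b : ℂ) ^ z = Complex.exp (Real.log b * z) := by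
  rw [Complex.cpow_def_of_ne_zero (by exact_mod_cast hb.ne'), Complex.ofReal_log hb.le]

/-- The integral is the Mellin transform of the Gaussian at `2n + m + 3/2`, where its factor `Γ(n +
m + 1)` cancels the one in the Bessel coefficient. What remains is a term of the exponential series
of `-x²/(2a)`. -/
theorem integral_besselTerm_mul_gauss {m : ℂ} (hm : -1 < m.re) {a x : ℝ} (ha : 0 < a) (hx : 0 < x)
    (n : ℕ) : ∫ k in Ioi (0 : ℝ), besselTerm m n (k * x) * gauss m a k =
      (a : ℂ) ^ (-(m + 1)) * (x : ℂ) ^ (m + 1 / 2) *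
        (((-(a⁻¹ / 2) * x ^ 2 : ℝ) : ℂ) ^ n / n.factorial) := by
  have hs : 0 < (2 * n + m + 3 / 2 : ℂ).re + m.re + 1 / 2 := by
    simp; linarith [(Nat.cast_nonneg n : (0:ℝ) ≤ n)]
  have h1 := mellin_gauss m ha hs
  have e1 : (2 * n + m + 3 / 2 + m + 1 / 2 : ℂ) / 2 = n + m + 1 := by ring
  rw [e1] at h1
  have hG : Complex.Gamma (n + m + 1) ≠ 0 :=
    Complex.Gamma_ne_zero_of_re_pos (by simp; linarith [(Nat.cast_nonneg n : (0:ℝ) ≤ n)])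
  have hf : (n.factorial : ℂ) ≠ 0 := by exact_mod_cast n.factorial_ne_zero
  set c : ℂ := (-1) ^ n / (n.factorial * Complex.Gamma (n + m + 1)) *
    ((x / 2 : ℝ) : ℂ) ^ (2 * n + m) * (Real.sqrt x : ℂ) with hc
  have e2 : ∫ k in Ioi (0 : ℝ), besselTerm m n (k * x) * gauss m a k =
      c * mellin (gauss m a) (2 * n + m + 3 / 2) := by
    rw [mellin, ← integral_const_mul]
    refine setIntegral_congr_fun measurableSet_Ioi fun k hk => ?_
    have hk' : (0:ℝ) < k := hk
    have e3 : ((k * x / 2 : ℝ) : ℂ) ^ (2 * n + m) =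
        (k : ℂ) ^ (2 * n + m) * ((x / 2 : ℝ) : ℂ) ^ (2 * n + m) := by
      rw [mul_div_assoc, Complex.ofReal_mul, Complex.mul_cpow_ofReal_nonneg hk'.le (by positivity)]
    have e4 : ((Real.sqrt (k * x) : ℝ) : ℂ) = (k : ℂ) ^ (1 / 2 : ℂ) * Real.sqrt x := by
      rw [Real.sqrt_mul hk'.le, Complex.ofReal_mul, Real.sqrt_eq_rpow k,
        Complex.ofReal_cpow hk'.le]
      norm_num
    have e5 : (k : ℂ) ^ (2 * n + m + 3 / 2 - 1 : ℂ) = (k : ℂ) ^ (2 * n + m) * (k : ℂ) ^ (1 / 2 : ℂ) := by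
      rw [← Complex.cpow_add _ _ (by exact_mod_cast hk'.ne')]
      congr 1
      ring
    simp only [besselTerm, e3, e4, smul_eq_mul, e5, hc]
    ring
  rw [e2, h1, hc]
  have e6 : (Real.sqrt x : ℂ) = (x : ℂ) ^ (1 / 2 : ℂ) := by
    rw [Real.sqrt_eq_rpow, Complex.ofReal_cpow hx.le]; norm_num
  have e7 : (((-(a⁻¹ / 2) * x ^ 2 : ℝ) : ℂ) ^ n) =
      (-1) ^ n * Complex.exp (n * (2 * Real.log x - Real.log a - Real.log 2 : ℝ)) := by
    rw [Complex.exp_nat_mul, ← mul_pow]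
    congr 1
    have : (a⁻¹ / 2 * x ^ 2) = Real.exp (2 * Real.log x - Real.log a - Real.log 2) := by
      rw [Real.exp_sub, Real.exp_sub, Real.exp_log ha, Real.exp_log (by norm_num),
        two_mul, Real.exp_add, Real.exp_log hx]
      field_simp
    rw [← Complex.ofReal_exp, ← this]
    push_cast
    ring
  rw [e6, e7, ofReal_cpow_eq_exp (b := x / 2) (by positivity), ofReal_cpow_eq_exp hx,
    ofReal_cpow_eq_exp (b := 2 / a) (by positivity), ofReal_cpow_eq_exp ha, ofReal_cpow_eq_exp hx,
    Real.log_div hx.ne' (by norm_num), Real.log_div (by norm_num) ha.ne']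
  have e8 : (1 / 2 : ℂ) = Complex.exp (-(Real.log 2 : ℝ)) := by
    rw [← Complex.ofReal_neg, ← Complex.ofReal_exp, Real.exp_neg, Real.exp_log (by norm_num)]
    push_cast; ring
  have e9 : Complex.exp (((Real.log x - Real.log 2 : ℝ) : ℂ) * (2 * n + m)) *
      Complex.exp (Real.log x * (1 / 2 : ℂ)) * (Complex.exp (-(Real.log 2 : ℝ)) *
      Complex.exp (((Real.log 2 - Real.log a : ℝ) : ℂ) * (n + m + 1))) =
      Complex.exp (Real.log a * (-(m + 1))) * Complex.exp (Real.log x * (m + 1 / 2)) *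
      Complex.exp (n * (2 * Real.log x - Real.log a - Real.log 2 : ℝ)) := by
    simp only [← Complex.exp_add]
    congr 1
    push_cast
    ring
  rw [← e8] at e9
  generalize Complex.exp (((Real.log x - Real.log 2 : ℝ) : ℂ) * (2 * n + m)) = p1 at e9 ⊢
  generalize Complex.exp (Real.log x * (1 / 2 : ℂ)) = p2 at e9 ⊢
  generalize Complex.exp (((Real.log 2 - Real.log a : ℝ) : ℂ) * (n + m + 1)) = p3 at e9 ⊢
  generalize Complex.exp (Real.log a * (-(m + 1))) = p4 at e9 ⊢
  generalize Complex.exp (Real.log x * (m + 1 / 2)) = p5 at e9 ⊢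
  generalize Complex.exp (n * (2 * Real.log x - Real.log a - Real.log 2 : ℝ)) = p6 at e9 ⊢
  have e10 : (-1 : ℂ) ^ n / (n.factorial * Complex.Gamma (n + m + 1)) * p1 * p2 *
      (1 / 2 * p3 * Complex.Gamma (n + m + 1)) =
      (-1) ^ n / n.factorial * (p1 * p2 * (1 / 2 * p3)) := by
    field_simp
  rw [e10, e9]
  ring

/-- The Hankel transform of a Gaussian. -/
theorem integral_besselKernel_mul_gauss {m : ℂ} (hm : -1 < m.re) {a x : ℝ} (hx : 0 < x)
    (hxa : x ^ 2 < 2 * a) : ∫ k in Ioi (0 : ℝ), besselKernel m (k * x) * gauss m a k =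
      (a : ℂ) ^ (-(m + 1)) * gauss m a⁻¹ x := by
  have ha : 0 < a := by nlinarith [sq_nonneg x]
  obtain ⟨C, hC, hb⟩ := exists_besselTerm_bound hm
  have hsum : ∀ k : ℝ, HasSum (fun n : ℕ => C * (k * x) ^ (m.re + 1 / 2) *
      (((k * x) ^ 2 / 4) ^ n / n.factorial) * ‖gauss m a k‖)
      (C * (k * x) ^ (m.re + 1 / 2) * Real.exp ((k * x) ^ 2 / 4) * ‖gauss m a k‖) := fun k =>
    (summable_besselBound _ (k * x)).mul_right _
  -- The norms of the terms sum to a multiple of `e^{k²x²/4}` times a power and the Gaussian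
  -- `e^{-ak²/2}`; this is integrable in `k` because `x² < 2a`.
  have key := hasSum_integral_of_dominated_convergence (μ := halfLine)
    (F := fun n k => besselTerm m n (k * x) * gauss m a k)
    (f := fun k => besselKernel m (k * x) * gauss m a k)
    (fun n k => C * (k * x) ^ (m.re + 1 / 2) * (((k * x) ^ 2 / 4) ^ n / n.factorial) * ‖gauss m a k‖)
    (fun n => (((measurable_besselTerm m n).comp (by fun_prop)).mul
      (measurable_gauss m a)).aestronglyMeasurable) ?_ ?_ ?_ ?_
  · simp only [integral_besselTerm_mul_gauss hm ha hx] at key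
    have hexp := (NormedSpace.expSeries_div_hasSum_exp ((-(a⁻¹ / 2) * x ^ 2 : ℝ) : ℂ)).mul_left
      ((a : ℂ) ^ (-(m + 1)) * (x : ℂ) ^ (m + 1 / 2))
    rw [key.unique hexp, gauss, mul_assoc, Complex.ofReal_exp, Complex.exp_eq_exp_ℂ]
  · intro n
    filter_upwards [ae_restrict_mem measurableSet_Ioi] with k hk
    have hk' : (0:ℝ) < k := hk
    rw [norm_mul]
    exact mul_le_mul_of_nonneg_right (hb n _ (by positivity)) (norm_nonneg _)
  · exact ae_of_all _ fun k => (hsum k).summable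
  · simp only [fun k => (hsum k).tsum_eq]
    have h1 := (integrableOn_rpow_mul_exp_neg_mul_sq (b := a / 2 - x ^ 2 / 4) (s := 2 * m.re + 1)
      (by linarith) (by linarith)).const_mul (C * x ^ (m.re + 1 / 2))
    refine h1.congr ?_
    filter_upwards [ae_restrict_mem measurableSet_Ioi] with k hk
    have hk' : (0:ℝ) < k := hk
    rw [norm_gauss m a hk', Real.mul_rpow hk'.le hx.le]
    have e1 : k ^ (2 * m.re + 1) = k ^ (m.re + 1 / 2) * k ^ (m.re + 1 / 2) := by
      rw [← Real.rpow_add hk']; ring_nf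
    have e2 : Real.exp (-(a / 2 - x ^ 2 / 4) * k ^ 2) =
        Real.exp ((k * x) ^ 2 / 4) * Real.exp (-(a / 2) * k ^ 2) := by
      rw [← Real.exp_add]; ring_nf
    rw [e1, e2]
    ring
  · filter_upwards [ae_restrict_mem measurableSet_Ioi] with k hk
    have hk' : (0:ℝ) < k := hk
    exact (hasSum_besselTerm hm (by positivity)).mul_right _

/-! ### The Hankel transformation -/

/-- Cauchy–Schwarz: the power is square integrable at the origin because `2 Re m + 1 > -1`. -/
theorem integrableOn_rpow_mul_norm {m : ℂ} (hm : -1 < m.re) (f : HalfLineL2) {R : ℝ} (hR : 0 < R) :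
    IntegrableOn (fun x => x ^ (m.re + 1 / 2) * ‖f x‖) (Ioo 0 R) := by
  have h1 : MemLp (fun x : ℝ => x ^ (m.re + 1 / 2)) 2 (volume.restrict (Ioo 0 R)) := by
    refine (memLp_two_iff_integrable_sq (Measurable.aestronglyMeasurable (by fun_prop))).mpr ?_
    refine ((intervalIntegral.integrableOn_Ioo_rpow_iff (s := 2 * m.re + 1) hR).mpr
      (by linarith)).congr ?_
    filter_upwards [ae_restrict_mem measurableSet_Ioo] with x hx
    rw [← Real.rpow_mul_natCast hx.1.le]
    congr 1
    push_cast
    ring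
  have h2 : MemLp f 2 (volume.restrict (Ioo 0 R)) :=
    (Lp.memLp f).mono_measure (Measure.restrict_mono (fun _ hx => hx.1) le_rfl)
  exact h1.integrable_mul h2.norm

theorem aestronglyMeasurable_Ioo (f : HalfLineL2) (R : ℝ) :
    AEStronglyMeasurable f (volume.restrict (Ioo 0 R)) :=
  (Lp.aestronglyMeasurable f).mono_measure (Measure.restrict_mono (fun _ hx => hx.1) le_rfl)

theorem integrableOn_besselKernel_mul {m : ℂ} (hm : -1 < m.re) (f : HalfLineL2) {R : ℝ} (hR : 0 < R)
    {k : ℝ} (hk : 0 < k) : IntegrableOn (fun x => besselKernel m (k * x) * f x) (Ioo 0 R) := by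
  obtain ⟨C, hC, hb⟩ := exists_besselKernel_bound hm
  refine ((integrableOn_rpow_mul_norm hm f hR).const_mul
    (C * k ^ (m.re + 1 / 2) * Real.exp ((k * R) ^ 2 / 4))).mono'
    (((measurable_besselKernel m).comp (by fun_prop)).aestronglyMeasurable.mul
      (aestronglyMeasurable_Ioo f R)) ?_
  filter_upwards [ae_restrict_mem measurableSet_Ioo] with x hx
  have hx0 := hx.1
  rw [norm_mul]
  calc ‖besselKernel m (k * x)‖ * ‖f x‖
      ≤ C * (k * x) ^ (m.re + 1 / 2) * Real.exp ((k * x) ^ 2 / 4) * ‖f x‖ :=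
        mul_le_mul_of_nonneg_right (hb _ (by positivity)) (norm_nonneg _)
    _ ≤ C * (k * x) ^ (m.re + 1 / 2) * Real.exp ((k * R) ^ 2 / 4) * ‖f x‖ := by
        gcongr
        exact hx.2.le
    _ = _ := by rw [Real.mul_rpow hk.le hx0.le]; ring

theorem integrable_prod_besselKernel {m : ℂ} (hm : -1 < m.re) (f : HalfLineL2) {R a : ℝ} (hR : 0 < R)
    (ha : R ^ 2 < 2 * a) :
    Integrable (fun p : ℝ × ℝ => besselKernel m (p.1 * p.2) * f p.2 * gauss m a p.1)
      (halfLine.prod (volume.restrict (Ioo 0 R))) := by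
  obtain ⟨C, hC, hb⟩ := exists_besselKernel_bound hm
  have h1 : Integrable (fun k : ℝ => C * (k ^ (2 * m.re + 1) *
      Real.exp (-(a / 2 - R ^ 2 / 4) * k ^ 2))) halfLine :=
    (integrableOn_rpow_mul_exp_neg_mul_sq (by linarith) (by linarith)).const_mul C
  refine (h1.mul_prod (integrableOn_rpow_mul_norm hm f hR)).mono' ?_ ?_
  · refine AEStronglyMeasurable.mul (AEStronglyMeasurable.mul ?_ ?_) ?_
    · exact ((measurable_besselKernel m).comp (by fun_prop)).aestronglyMeasurable
    · exact (aestronglyMeasurable_Ioo f R).comp_snd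
    · exact ((measurable_gauss m a).comp measurable_fst).aestronglyMeasurable
  · rw [Measure.prod_restrict]
    filter_upwards [ae_restrict_mem (measurableSet_Ioi.prod measurableSet_Ioo)] with p hp
    obtain ⟨k, x⟩ := p
    have hk : 0 < k := hp.1
    have hx : 0 < x := hp.2.1
    have hxR : x < R := hp.2.2
    rw [norm_mul, norm_mul]
    calc ‖besselKernel m (k * x)‖ * ‖f x‖ * ‖gauss m a k‖
        ≤ C * (k * x) ^ (m.re + 1 / 2) * Real.exp ((k * x) ^ 2 / 4) * ‖f x‖ * ‖gauss m a k‖ := by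
          gcongr
          exact hb _ (by positivity)
      _ ≤ C * (k * x) ^ (m.re + 1 / 2) * Real.exp ((k * R) ^ 2 / 4) * ‖f x‖ * ‖gauss m a k‖ := by
          gcongr
      _ = _ := by
          have e1 : k ^ (2 * m.re + 1) = k ^ (m.re + 1 / 2) * k ^ (m.re + 1 / 2) := by
            rw [← Real.rpow_add hk]; ring_nf
          have e2 : Real.exp (-(a / 2 - R ^ 2 / 4) * k ^ 2) =
              Real.exp ((k * R) ^ 2 / 4) * Real.exp (-(a / 2) * k ^ 2) := by
            rw [← Real.exp_add]; ring_nf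
          rw [norm_gauss m a hk, Real.mul_rpow hk.le hx.le, e1, e2]
          ring

/-- The restriction of `f` to `]0, R[`. -/
noncomputable def truncL2 (R : ℝ) (f : HalfLineL2) : HalfLineL2 :=
  ((Lp.memLp f).indicator (measurableSet_Ioo (a := (0:ℝ)) (b := R))).toLp _

theorem truncL2_coe (R : ℝ) (f : HalfLineL2) :
    ⇑(truncL2 R f) =ᵐ[halfLine] (Ioo 0 R).indicator f := MemLp.coeFn_toLp _

theorem tendsto_truncL2 (f : HalfLineL2) : Tendsto (fun R => truncL2 R f) atTop (𝓝 f) := by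
  rw [Lp.tendsto_Lp_iff_tendsto_eLpNorm']
  have h := tendsto_eLpNorm_mul_of_bounded (l := (atTop : Filter ℝ)) (Lp.memLp f)
    (C := 1) (θ := fun R => (Ioo 0 R).indicator 1 - 1) (fun R => ?_) (fun R x => ?_) (fun x hx => ?_)
  · refine h.congr fun R => eLpNorm_congr_ae ?_
    filter_upwards [truncL2_coe R f] with x h1
    rw [Pi.sub_apply, Pi.sub_apply, h1]
    by_cases hx : x ∈ Ioo 0 R <;> simp [hx]
  · exact ((measurable_one.indicator measurableSet_Ioo).sub measurable_one).aestronglyMeasurable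
  · by_cases hx : x ∈ Ioo 0 R <;> simp [hx]
  · refine tendsto_const_nhds.congr' ?_
    filter_upwards [eventually_gt_atTop x] with R hR
    rw [Pi.sub_apply, indicator_of_mem (show x ∈ Ioo 0 R from ⟨hx, hR⟩)]
    simp

/-- Both functions have the same integrals against `g_a` for `a ≥ R²`. Fubini and the Hankel
transform of a Gaussian give `∫_0^R f · a^{-(m+1)} g_{1/a}` for the truncated integral, and the
symmetry of the bilinear pairing gives the same for the operator. The restriction on `a` secures
absolute convergence of the double integral. -/
theorem hankelTrunc_ae_eq {m : ℂ} (hm : -1 < m.re) (f : HalfLineL2) {R : ℝ} (hR : 0 < R) :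
    hankelTrunc m R f =ᵐ[halfLine] hankelCLM hm (truncL2 R f) := by
  have hR2 : 0 < R ^ 2 := by positivity
  have hint1 : ∀ a ≥ R ^ 2, IntegrableOn (fun k => hankelTrunc m R f k * gauss m a k) (Ioi 0) := by
    intro a ha
    refine (integrable_prod_besselKernel hm f hR (a := a) (by linarith)).integral_prod_left.congr
      (ae_of_all _ fun k => ?_)
    simp only
    rw [integral_mul_const]
    rfl
  have hint2 : ∀ a ≥ R ^ 2,
      IntegrableOn (fun k => hankelCLM hm (truncL2 R f) k * gauss m a k) (Ioi 0) := fun a ha =>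
    (Lp.memLp _).integrable_mul (memLp_gauss hm (by linarith))
  have h0 : (fun k => hankelTrunc m R f k - hankelCLM hm (truncL2 R f) k) =ᵐ[halfLine] 0 := by
    refine ae_zero_of_integral_gauss (m := m) (a₀ := R ^ 2) ?_ fun a ha => ?_
    · simp only [sub_mul]
      exact (hint1 _ le_rfl).sub (hint2 _ le_rfl)
    · have ha0 : 0 < a := by linarith
      simp only [sub_mul]
      rw [integral_sub (hint1 a ha) (hint2 a ha), sub_eq_zero]
      have e1 : ∫ k in Ioi (0 : ℝ), hankelCLM hm (truncL2 R f) k * gauss m a k =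
          pairing (truncL2 R f) (hankelCLM hm (gaussL2 hm ha0)) := by
        rw [← pairing_hankelCLM, pairing_apply]
        refine integral_congr_ae ?_
        filter_upwards [gaussL2_coe hm ha0] with k hk
        rw [hk]
      have e2 : ∫ k in Ioi (0 : ℝ), hankelTrunc m R f k * gauss m a k =
          ∫ x in Ioo 0 R, f x * ((a : ℂ) ^ (-(m + 1)) * gauss m a⁻¹ x) := by
        have e3 : ∀ k, hankelTrunc m R f k * gauss m a k =
            ∫ x in Ioo 0 R, besselKernel m (k * x) * f x * gauss m a k := fun k => by
          rw [integral_mul_const]; rfl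
        simp only [e3]
        rw [integral_integral_swap (f := fun k x => besselKernel m (k * x) * f x * gauss m a k)
          (integrable_prod_besselKernel hm f hR (a := a) (by linarith))]
        refine setIntegral_congr_fun measurableSet_Ioo fun x hx => ?_
        have hx2 : x ^ 2 < 2 * a := by nlinarith [hx.1, hx.2]
        rw [← integral_besselKernel_mul_gauss hm hx.1 hx2, ← integral_const_mul]
        congr 1
        funext k
        ring
      rw [e1, e2, pairing_apply, hankelCLM_gaussL2]
      have e4 : ∫ x in Ioo 0 R, f x * ((a : ℂ) ^ (-(m + 1)) * gauss m a⁻¹ x) =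
          ∫ x in Ioi (0 : ℝ), (Ioo 0 R).indicator
            (fun x => f x * ((a : ℂ) ^ (-(m + 1)) * gauss m a⁻¹ x)) x := by
        rw [setIntegral_indicator measurableSet_Ioo,
          inter_eq_right.mpr (show Ioo 0 R ⊆ Ioi 0 from fun x hx => hx.1)]
      rw [e4]
      refine integral_congr_ae ?_
      filter_upwards [truncL2_coe R f, gaussL2_coe hm (inv_pos.mpr ha0),
        Lp.coeFn_smul ((a : ℂ) ^ (-(m + 1))) (gaussL2 hm (inv_pos.mpr ha0))] with x h1 h2 h3
      rw [h1, h3, Pi.smul_apply, h2, smul_eq_mul]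
      by_cases hx : x ∈ Ioo 0 R <;> simp [hx]
  filter_upwards [h0] with k hk
  exact sub_eq_zero.mp hk

theorem mem_hankelGraph {m : ℂ} (hm : -1 < m.re) (f : HalfLineL2) :
    (f, hankelCLM hm f) ∈ hankelGraph m := by
  refine ⟨fun R hR k hk => integrableOn_besselKernel_mul hm f hR hk, fun R hR => ?_, ?_⟩
  · exact (Lp.memLp (hankelCLM hm (truncL2 R f))).ae_eq (hankelTrunc_ae_eq hm f hR).symm
  · have h := ((hankelCLM hm).continuous.tendsto f).comp (tendsto_truncL2 f)
    have h' := (Lp.tendsto_Lp_iff_tendsto_eLpNorm' _ _).mp h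
    refine h'.congr' ?_
    filter_upwards [eventually_gt_atTop 0] with R hR
    refine eLpNorm_congr_ae ?_
    filter_upwards [hankelTrunc_ae_eq hm f hR] with k hk
    simp only [Function.comp, Pi.sub_apply, hk]

/-- A single-valued graph containing the graph of an everywhere defined operator equals it. -/
theorem hankel_eq_toPMap {m : ℂ} (hm : -1 < m.re) (L : HalfLineL2 →ₗ[ℂ] HalfLineL2)
    (hL : ∀ f, L f = hankelCLM hm f) : hankel m = L.toPMap ⊤ := by
  have hg : ∀ f, (f, L f) ∈ (hankel m).graph := fun f => by
    rw [hankel_graph, hL]; exact mem_hankelGraph hm f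
  refine LinearPMap.eq_of_eq_graph (Submodule.ext fun p => ?_)
  obtain ⟨f, g⟩ := p
  constructor
  · intro h
    have h1 : g = L f := LinearPMap.mem_graph_snd_inj (hankel m) h (hg f) rfl
    rw [h1]
    exact (LinearPMap.mem_graph_iff _).mpr ⟨⟨f, Submodule.mem_top⟩, rfl, rfl⟩
  · intro h
    obtain ⟨z, hz, hz'⟩ := (LinearPMap.mem_graph_iff _).mp h
    have h1 : (z : HalfLineL2) = f := hz
    have h2 : L z = g := hz'
    rw [← h2, h1]
    exact hg f

/-! ### The maximal and the minimal Schrödinger operator -/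

theorem IsTest.integral_deriv {φ : ℝ → ℂ} (h : IsTest φ) :
    ∫ x in Ioi (0 : ℝ), _root_.deriv φ x = 0 := by
  rw [setIntegral_eq_integral_of_forall_compl_eq_zero fun x hx =>
    image_eq_zero_of_notMem_tsupport fun hn => hx (h.deriv.supp hn)]
  exact integral_eq_zero_of_hasDerivAt_of_integrable
    (fun x => ((h.contDiff.differentiable (by simp)) x).hasDerivAt)
    (h.deriv.contDiff.continuous.integrable_of_hasCompactSupport h.deriv.compact)
    (h.contDiff.continuous.integrable_of_hasCompactSupport h.compact)

theorem mem_LMax_graph {α : ℂ} {w w₁ w₂ : ℝ → ℂ} (hs : ∀ x > 0, ContDiffAt ℝ ∞ w x)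
    (hs₁ : ∀ x > 0, ContDiffAt ℝ ∞ w₁ x) (h1 : ∀ x > 0, HasDerivAt w (w₁ x) x)
    (h2 : ∀ x > 0, HasDerivAt w₁ (w₂ x) x) {f g : HalfLineL2} (hf : ⇑f =ᵐ[halfLine] w)
    (hg : ⇑g =ᵐ[halfLine] fun x => -w₂ x + (-1 / 4 + α) / (x : ℂ) ^ 2 * w x) :
    (f, g) ∈ (LMax α).graph := by
  rw [LMax, weakOp_graph]
  intro φ hφ
  show ∫ x in Ioi (0 : ℝ), g x * φ x = ∫ x in Ioi (0 : ℝ), f x * schrodingerExpr α φ x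
  -- Green's formula: the difference of the two integrands is the derivative of `w φ' - w' φ`, a
  -- test function even when `w` is singular at the origin.
  have hΦ : IsTest ((fun x => w x * deriv φ x) + fun x => -w₁ x * φ x) :=
    (hφ.deriv.mul_of_smooth hs).add (hφ.mul_of_smooth fun x hx => (hs₁ x hx).neg)
  rw [← sub_eq_zero, ← integral_sub (hφ.integrable_mul g)
    ((schrodingerExpr_isTest α φ hφ).integrable_mul f), ← hΦ.integral_deriv]
  refine integral_congr_ae ?_
  filter_upwards [hf, hg, ae_restrict_mem measurableSet_Ioi] with x e1 e2 hx
  have d1 := (hφ.contDiff.differentiable (by simp) x).hasDerivAt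
  have d2 := (hφ.deriv.contDiff.differentiable (by simp) x).hasDerivAt
  have d3 := (((h1 x hx).mul d2).add ((h2 x hx).neg.mul d1)).deriv
  have d4 : deriv ((fun x => w x * deriv φ x) + fun x => -w₁ x * φ x) x = _ := d3
  rw [d4, e1, e2, schrodingerExpr, Pi.neg_apply]
  ring

theorem mem_LMax_graph_iff {α : ℂ} {f g : HalfLineL2} : (f, g) ∈ (LMax α).graph ↔
    ∀ φ (hφ : IsTest φ), pairing (hφ.memLp.toLp φ) g =
      pairing ((schrodingerExpr_isTest α φ hφ).memLp.toLp _) f := by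
  rw [LMax, weakOp_graph]
  have key : ∀ (u : HalfLineL2) {ψ : ℝ → ℂ} (hψ : IsTest ψ),
      pairing (hψ.memLp.toLp ψ) u = ∫ x in Ioi (0 : ℝ), u x * ψ x := by
    intro u ψ hψ
    rw [pairing_comm, pairing_apply]
    refine integral_congr_ae ?_
    filter_upwards [hψ.memLp.coeFn_toLp] with x hx
    rw [hx]
  change (∀ φ, IsTest φ → _) ↔ _
  refine forall₂_congr fun φ hφ => ?_
  rw [key g hφ, key f (schrodingerExpr_isTest α φ hφ)]

theorem LMax_isClosed (α : ℂ) : (LMax α).IsClosed := by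
  have h : ((LMax α).graph : Set (HalfLineL2 × HalfLineL2)) =
      ⋂ (φ : ℝ → ℂ) (hφ : IsTest φ), {p | pairing (hφ.memLp.toLp φ) p.2 =
        pairing ((schrodingerExpr_isTest α φ hφ).memLp.toLp _) p.1} := by
    ext ⟨f, g⟩
    simpa using mem_LMax_graph_iff
  rw [LinearPMap.IsClosed, h]
  exact isClosed_iInter fun φ => isClosed_iInter fun hφ =>
    isClosed_eq ((ContinuousLinearMap.continuous _).comp continuous_snd)
      ((ContinuousLinearMap.continuous _).comp continuous_fst)

theorem mem_domRestrict_graph {E : Type*} [AddCommGroup E] [Module ℂ E] (T : E →ₗ.[ℂ] E)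
    (S : Submodule ℂ E) (p : E × E) :
    p ∈ (T.domRestrict S).graph ↔ p.1 ∈ S ∧ p ∈ T.graph := by
  constructor
  · intro h
    refine ⟨?_, LinearPMap.le_graph_of_le LinearPMap.domRestrict_le h⟩
    have h1 := LinearPMap.mem_domain_of_mem_graph (f := T.domRestrict S) (x := p.1) (y := p.2) h
    exact h1.1
  · rintro ⟨h1, h2⟩
    obtain ⟨z, hz, hz'⟩ := (LinearPMap.mem_graph_iff _).mp h2
    refine (LinearPMap.mem_graph_iff _).mpr ⟨⟨p.1, h1, hz ▸ z.2⟩, rfl, ?_⟩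
    rw [← hz']
    exact LinearPMap.domRestrict_apply hz.symm

theorem LMin_graph (α : ℂ) :
    (LMin α).graph = ((LMax α).domRestrict testSubmodule).graph.topologicalClosure :=
  (((LMax_isClosed α).isClosable.leIsClosable
    LinearPMap.domRestrict_le).graph_closure_eq_closure_graph).symm

theorem LMin_graph_le (α : ℂ) : (LMin α).graph ≤ (LMax α).graph := by
  rw [LMin_graph]
  exact Submodule.topologicalClosure_minimal _
    (LinearPMap.le_graph_of_le LinearPMap.domRestrict_le) (LMax_isClosed α)

theorem LMin_isClosed (α : ℂ) : IsClosed ((LMin α).graph : Set (HalfLineL2 × HalfLineL2)) := by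
  rw [LMin_graph]
  exact Submodule.isClosed_topologicalClosure _

theorem mem_LMin_graph_of_isTest {α : ℂ} {p : HalfLineL2 × HalfLineL2} (h1 : p.1 ∈ testSubmodule)
    (h2 : p ∈ (LMax α).graph) : p ∈ (LMin α).graph := by
  rw [LMin_graph]
  exact Submodule.le_topologicalClosure _ ((mem_domRestrict_graph _ _ _).mpr ⟨h1, h2⟩)

theorem exists_tendsto_zero_of_bounded {θ : ℕ → ℝ → ℂ} {C : ℝ} (hθm : ∀ n, Measurable (θ n))
    (hθ : ∀ n x, ‖θ n x‖ ≤ C) (hlim : ∀ x > 0, Tendsto (fun n => θ n x) atTop (𝓝 0))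
    (f : HalfLineL2) : ∃ F : ℕ → HalfLineL2, (∀ n, ⇑(F n) =ᵐ[halfLine] fun x => θ n x * f x) ∧
      Tendsto F atTop (𝓝 0) := by
  have hF : ∀ n, ⇑(boundedMul halfLine (θ n) (hθm n) C (hθ n) f) =ᵐ[halfLine]
      fun x => θ n x * f x := fun n => boundedMul_coe (hθm n) (hθ n) f
  refine ⟨fun n => boundedMul halfLine (θ n) (hθm n) C (hθ n) f, hF, ?_⟩
  rw [Lp.tendsto_Lp_iff_tendsto_eLpNorm']
  refine (tendsto_eLpNorm_mul_of_bounded (Lp.memLp f)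
    (fun n => (hθm n).aestronglyMeasurable) hθ hlim).congr fun n => eLpNorm_congr_ae ?_
  filter_upwards [hF n, Lp.coeFn_zero ℂ 2 halfLine] with x h1 h2
  rw [Pi.sub_apply, h1, h2, Pi.zero_apply, sub_zero]

/-- An `L²` function which is smooth on the open half-line lies in the domain of the minimal
operator as soon as it and its first derivative are small enough at the origin. -/
theorem mem_LMin_graph {α : ℂ} {w w₁ w₂ : ℝ → ℂ} (hs : ∀ x > 0, ContDiffAt ℝ ∞ w x)
    (hs₁ : ∀ x > 0, ContDiffAt ℝ ∞ w₁ x) (h1 : ∀ x > 0, HasDerivAt w (w₁ x) x)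
    (h2 : ∀ x > 0, HasDerivAt w₁ (w₂ x) x) {f g b c : HalfLineL2} (hf : ⇑f =ᵐ[halfLine] w)
    (hg : ⇑g =ᵐ[halfLine] fun x => -w₂ x + (-1 / 4 + α) / (x : ℂ) ^ 2 * w x)
    (hb : ⇑b =ᵐ[halfLine] fun x => w₁ x / x) (hc : ⇑c =ᵐ[halfLine] fun x => w x / (x : ℂ) ^ 2) :
    (f, g) ∈ (LMin α).graph := by
  let θ : ContDiffBump (0 : ℝ) := ⟨1, 2, one_pos, by norm_num⟩
  have hθs : ContDiff ℝ ∞ θ := θ.contDiff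
  have hθs₁ : ContDiff ℝ ∞ (deriv θ) := (contDiff_infty_iff_deriv.mp hθs).2
  have hθs₂ : ContDiff ℝ ∞ (deriv (deriv θ)) := (contDiff_infty_iff_deriv.mp hθs₁).2
  obtain ⟨D, hD⟩ := (θ.hasCompactSupport.deriv (𝕜 := ℝ)).exists_bound_of_continuous
    hθs₁.continuous
  obtain ⟨D', hD'⟩ := ((θ.hasCompactSupport.deriv (𝕜 := ℝ)).deriv
    (𝕜 := ℝ)).exists_bound_of_continuous hθs₂.continuous
  -- The cutoffs are `θ(t_n log x)`, supported in a compact subset of the open half-line. Their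
  -- first derivative is `t_n θ'/x` and their second is `t_n (t_n θ'' - θ')/x²`. The commutator
  -- terms are therefore bounded factors tending to zero times `w'/x` and `w/x²`, which is why these
  -- two are required in `L²`. `B` and `K` below are these terms.
  let t : ℕ → ℝ := fun n => ((n : ℝ) + 1)⁻¹
  have ht0 : ∀ n, 0 < t n := fun n => by positivity
  have ht1 : ∀ n, t n ≤ 1 := fun n => inv_le_one_of_one_le₀ (by simp)
  have htlim : Tendsto t atTop (𝓝 0) := by
    simpa [t] using tendsto_one_div_add_atTop_nhds_zero_nat (𝕜 := ℝ)
  have hlog : ∀ x, Tendsto (fun n => t n * Real.log x) atTop (𝓝 0) := fun x => by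
    simpa using htlim.mul_const (Real.log x)
  have hm : ∀ n, Measurable fun x => t n * Real.log x := fun n =>
    Real.measurable_log.const_mul _
  have hof : Tendsto Complex.ofReal (𝓝 0) (𝓝 0) := by
    simpa using Complex.continuous_ofReal.tendsto 0
  have hθ0 : θ 0 = 1 := θ.one_of_mem_closedBall (by simp [θ])
  have hcut := exists_tendsto_zero_of_bounded
    (θ := fun n x => ((θ (t n * Real.log x) - 1 : ℝ) : ℂ)) (C := 1)
    (fun n => Complex.measurable_ofReal.comp ((θ.continuous.measurable.comp (hm n)).sub_const 1))
    (fun n x => by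
      rw [Complex.norm_real, Real.norm_eq_abs, abs_le]
      have := θ.nonneg (x := t n * Real.log x)
      have := θ.le_one (x := t n * Real.log x)
      constructor <;> linarith)
    (fun x _ => by
      have h3 := ((θ.continuous.tendsto 0).comp (hlog x)).sub_const 1
      rw [hθ0, sub_self] at h3
      exact hof.comp h3)
  obtain ⟨A, hA, hA0⟩ := hcut f
  obtain ⟨A', hA', hA0'⟩ := hcut g
  obtain ⟨B, hB, hB0⟩ := exists_tendsto_zero_of_bounded
    (θ := fun n x => ((t n * deriv θ (t n * Real.log x) : ℝ) : ℂ)) (C := D)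
    (fun n => Complex.measurable_ofReal.comp
      ((hθs₁.continuous.measurable.comp (hm n)).const_mul _))
    (fun n x => by
      rw [Complex.norm_real, norm_mul, Real.norm_of_nonneg (ht0 n).le]
      have := mul_le_mul (ht1 n) (hD (t n * Real.log x)) (norm_nonneg _) zero_le_one
      linarith)
    (fun x _ => by
      have h3 := htlim.mul ((hθs₁.continuous.tendsto 0).comp (hlog x))
      rw [zero_mul] at h3
      exact hof.comp h3) b
  obtain ⟨K, hK, hK0⟩ := exists_tendsto_zero_of_bounded
    (θ := fun n x => ((t n * (t n * deriv (deriv θ) (t n * Real.log x)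
      - deriv θ (t n * Real.log x)) : ℝ) : ℂ)) (C := D' + D)
    (fun n => Complex.measurable_ofReal.comp
      ((((hθs₂.continuous.measurable.comp (hm n)).const_mul _).sub
        (hθs₁.continuous.measurable.comp (hm n))).const_mul _))
    (fun n x => by
      rw [Complex.norm_real, norm_mul, Real.norm_of_nonneg (ht0 n).le]
      have h3 : ‖t n * deriv (deriv θ) (t n * Real.log x)‖ ≤ D' := by
        rw [norm_mul, Real.norm_of_nonneg (ht0 n).le]
        have := mul_le_mul (ht1 n) (hD' (t n * Real.log x)) (norm_nonneg _) zero_le_one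
        linarith
      have h4 := (norm_sub_le (t n * deriv (deriv θ) (t n * Real.log x))
        (deriv θ (t n * Real.log x))).trans (add_le_add h3 (hD _))
      have := mul_le_mul (ht1 n) h4 (norm_nonneg _) zero_le_one
      linarith)
    (fun x _ => by
      have h3 := htlim.mul ((htlim.mul ((hθs₂.continuous.tendsto 0).comp (hlog x))).sub
        ((hθs₁.continuous.tendsto 0).comp (hlog x)))
      rw [zero_mul] at h3
      exact hof.comp h3) c
  have hlim : Tendsto (fun n => (f + A n, g + A' n - (2 : ℂ) • B n - K n)) atTop (𝓝 (f, g)) := by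
    refine Tendsto.prodMk_nhds ?_ ?_
    · simpa using hA0.const_add f
    · simpa using (((hA0'.const_add g).sub (hB0.const_smul (2 : ℂ))).sub hK0)
  refine (LMin_isClosed α).mem_of_tendsto hlim (Eventually.of_forall fun n => ?_)
  have hlogd : ∀ x > 0, HasDerivAt (fun x => t n * Real.log x) (t n * x⁻¹) x := fun x hx =>
    (Real.hasDerivAt_log (ne_of_gt hx)).const_mul _
  have hlogs : ∀ x > 0, ContDiffAt ℝ ∞ (fun x => t n * Real.log x) x := fun x hx =>
    contDiffAt_const.mul (Real.contDiffAt_log.mpr (ne_of_gt hx))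
  have hχs : ∀ x > 0, ContDiffAt ℝ ∞ (fun x => ((θ (t n * Real.log x) : ℝ) : ℂ)) x :=
    fun x hx => Complex.ofRealCLM.contDiff.contDiffAt.comp x
      (hθs.contDiffAt.comp x (hlogs x hx))
  have hχs₁ : ∀ x > 0, ContDiffAt ℝ ∞
      (fun x => ((deriv θ (t n * Real.log x) * (t n * x⁻¹) : ℝ) : ℂ)) x :=
    fun x hx => Complex.ofRealCLM.contDiff.contDiffAt.comp x
      ((hθs₁.contDiffAt.comp x (hlogs x hx)).mul (contDiffAt_const.mul
        (contDiffAt_inv ℝ (ne_of_gt hx))))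
  have hχ : ∀ x > 0, HasDerivAt (fun x => ((θ (t n * Real.log x) : ℝ) : ℂ))
      ((deriv θ (t n * Real.log x) * (t n * x⁻¹) : ℝ) : ℂ) x := fun x hx =>
    (HasDerivAt.comp (h₂ := ⇑θ) x (hθs.differentiable (by simp) _).hasDerivAt
      (hlogd x hx)).ofReal_comp
  have hχ₁ : ∀ x > 0, HasDerivAt (fun x => ((deriv θ (t n * Real.log x) * (t n * x⁻¹) : ℝ) : ℂ))
      ((deriv (deriv θ) (t n * Real.log x) * (t n * x⁻¹) * (t n * x⁻¹) +
        deriv θ (t n * Real.log x) * (t n * -(x ^ 2)⁻¹) : ℝ) : ℂ) x := fun x hx =>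
    ((HasDerivAt.comp (h₂ := deriv θ) x (hθs₁.differentiable (by simp) _).hasDerivAt
      (hlogd x hx)).mul ((hasDerivAt_inv (ne_of_gt hx)).const_mul _)).ofReal_comp
  have hfA : ⇑(f + A n) =ᵐ[halfLine] fun x => ((θ (t n * Real.log x) : ℝ) : ℂ) * w x := by
    filter_upwards [Lp.coeFn_add f (A n), hA n, hf] with x e1 e2 e3
    rw [e1, Pi.add_apply, e2, e3]
    push_cast
    ring
  refine mem_LMin_graph_of_isTest ?_ (mem_LMax_graph
    (w₁ := fun x => ((deriv θ (t n * Real.log x) * (t n * x⁻¹) : ℝ) : ℂ) * w x +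
      ((θ (t n * Real.log x) : ℝ) : ℂ) * w₁ x)
    (fun x hx => (hχs x hx).mul (hs x hx))
    (fun x hx => ((hχs₁ x hx).mul (hs x hx)).add ((hχs x hx).mul (hs₁ x hx)))
    (fun x hx => (hχ x hx).mul (h1 x hx))
    (fun x hx => ((hχ₁ x hx).mul (h1 x hx)).add ((hχ x hx).mul (h2 x hx))) hfA ?_)
  · have hc1 : ContDiff ℝ ∞ fun y => ((θ (t n * y) : ℝ) : ℂ) :=
      Complex.ofRealCLM.contDiff.comp (hθs.comp (by fun_prop))
    have hc2 : HasCompactSupport fun y => ((θ (t n * y) : ℝ) : ℂ) := by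
      have h3 : HasCompactSupport fun u => θ (t n * u) :=
        θ.hasCompactSupport.comp_homeomorph (Homeomorph.mulLeft₀ (t n) (ht0 n).ne')
      exact h3.comp_left (g := fun r : ℝ => (r : ℂ)) (by simp)
    refine ⟨_, (IsTest.of_comp_log hc1 hc2).mul_of_smooth hs, ?_⟩
    filter_upwards [hfA, ae_restrict_mem measurableSet_Ioi] with x e1 hx
    rw [e1, indicator_of_mem hx, mul_comm]
  · filter_upwards [Lp.coeFn_sub (g + A' n - (2 : ℂ) • B n) (K n),
      Lp.coeFn_sub (g + A' n) ((2 : ℂ) • B n), Lp.coeFn_add g (A' n),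
      Lp.coeFn_smul (2 : ℂ) (B n), hA' n, hB n, hK n, hg, hb, hc,
      ae_restrict_mem measurableSet_Ioi] with x e1 e2 e3 e4 e5 e6 e7 e8 e9 e10 hx
    have hx' : (x : ℂ) ≠ 0 := by exact_mod_cast (ne_of_gt hx)
    rw [e1, Pi.sub_apply, e2, Pi.sub_apply, e3, Pi.add_apply, e4, Pi.smul_apply, e5, e6, e7, e8,
      e9, e10, smul_eq_mul]
    push_cast
    field_simp
    ring

/-! ### Functions `x^(m+1/2) ψ(x)` -/

theorem memLp_cpow_mul {m : ℂ} (hm : -1 < m.re) {a : ℝ} (ha : 0 < a) {β : ℝ → ℂ}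
    (hβ : Measurable β) {C : ℝ} (hC : ∀ x > 0, ‖β x‖ ≤ C * Real.exp (-(a / 2) * x ^ 2)) :
    MemLp (fun x : ℝ => (x : ℂ) ^ (m + 1 / 2) * β x) 2 halfLine := by
  refine (memLp_gauss hm ha).of_le_mul (c := C) ?_ ?_
  · exact ((Complex.measurable_ofReal.pow_const _).mul hβ).aestronglyMeasurable
  · filter_upwards [ae_restrict_mem measurableSet_Ioi] with x hx
    rw [gauss, norm_mul, norm_mul, Complex.norm_real, Real.norm_of_nonneg (Real.exp_pos _).le]
    have := mul_le_mul_of_nonneg_left (hC x hx) (norm_nonneg ((x : ℂ) ^ (m + 1 / 2)))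
    linarith

theorem contDiffAt_cpow (μ : ℂ) {x : ℝ} (hx : 0 < x) :
    ContDiffAt ℝ ∞ (fun x : ℝ => (x : ℂ) ^ μ) x := by
  have h : (fun x : ℝ => (x : ℂ) ^ μ) =ᶠ[𝓝 x] fun x => Complex.exp (Real.log x * μ) := by
    filter_upwards [lt_mem_nhds hx] with y hy
    rw [Complex.cpow_def_of_ne_zero (by exact_mod_cast (ne_of_gt hy)), Complex.ofReal_log hy.le]
  refine ContDiffAt.congr_of_eventuallyEq ?_ h
  exact Complex.contDiff_exp.contDiffAt.comp x
    ((Complex.ofRealCLM.contDiff.contDiffAt.comp x (Real.contDiffAt_log.mpr hx.ne')).mul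
      contDiffAt_const)

theorem hasDerivAt_cpow (μ : ℂ) {x : ℝ} (hx : 0 < x) :
    HasDerivAt (fun x : ℝ => (x : ℂ) ^ μ) ((x : ℂ) ^ μ * (μ / x)) x := by
  have hx' : (x : ℂ) ≠ 0 := by exact_mod_cast hx.ne'
  have h : HasDerivAt (fun x : ℝ => (x : ℂ) ^ μ) _ x :=
    ((hasDerivAt_id (x : ℂ)).cpow_const (c := μ) (Or.inl (by simpa using hx))).comp_ofReal
  convert h using 1
  simp only [id, Complex.cpow_sub _ _ hx', Complex.cpow_one]
  field_simp

theorem hasDerivAt_cpow_mul (μ : ℂ) {ψ : ℝ → ℝ} (hψ : ContDiff ℝ ∞ ψ) {x : ℝ} (hx : 0 < x) :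
    HasDerivAt (fun x : ℝ => (x : ℂ) ^ μ * ψ x)
      ((x : ℂ) ^ μ * (μ * (ψ x / x : ℝ) + deriv ψ x)) x := by
  have h := (hasDerivAt_cpow μ hx).mul (hψ.differentiable (by simp) x).hasDerivAt.ofReal_comp
  refine HasDerivAt.congr_deriv h ?_
  push_cast
  ring

theorem hasDerivAt_deriv_cpow_mul (μ : ℂ) {ψ : ℝ → ℝ} (hψ : ContDiff ℝ ∞ ψ) {x : ℝ} (hx : 0 < x) :
    HasDerivAt (fun x : ℝ => (x : ℂ) ^ μ * (μ * (ψ x / x : ℝ) + deriv ψ x))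
      ((x : ℂ) ^ μ * (μ * (μ - 1) * (ψ x / x ^ 2 : ℝ) + 2 * μ * (deriv ψ x / x : ℝ) +
        deriv (deriv ψ) x)) x := by
  have hψ₁ : ContDiff ℝ ∞ (deriv ψ) := (contDiff_infty_iff_deriv.mp hψ).2
  have hx' : (x : ℂ) ≠ 0 := by exact_mod_cast hx.ne'
  have d1 := ((hψ.differentiable (by simp) x).hasDerivAt.div (hasDerivAt_id x) hx.ne').ofReal_comp
  have d2 := (hψ₁.differentiable (by simp) x).hasDerivAt.ofReal_comp
  have h := (hasDerivAt_cpow μ hx).mul ((d1.const_mul μ).add d2)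
  refine HasDerivAt.congr_deriv h ?_
  simp only [Pi.add_apply, Pi.div_apply, id]
  push_cast
  field_simp
  ring

theorem contDiffAt_cpow_mul (μ : ℂ) {ψ : ℝ → ℝ} (hψ : ContDiff ℝ ∞ ψ) {x : ℝ} (hx : 0 < x) :
    ContDiffAt ℝ ∞ (fun x : ℝ => (x : ℂ) ^ μ * ψ x) x :=
  (contDiffAt_cpow μ hx).mul (Complex.ofRealCLM.contDiff.comp hψ).contDiffAt

theorem contDiffAt_deriv_cpow_mul (μ : ℂ) {ψ : ℝ → ℝ} (hψ : ContDiff ℝ ∞ ψ) {x : ℝ} (hx : 0 < x) :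
    ContDiffAt ℝ ∞ (fun x : ℝ => (x : ℂ) ^ μ * (μ * (ψ x / x : ℝ) + deriv ψ x)) x :=
  (contDiffAt_cpow μ hx).mul ((contDiffAt_const.mul
    (Complex.ofRealCLM.contDiff.contDiffAt.comp x
      (hψ.contDiffAt.div contDiffAt_id hx.ne'))).add
    (Complex.ofRealCLM.contDiff.comp (contDiff_infty_iff_deriv.mp hψ).2).contDiffAt)

/-- `L_{m²}` applied to `x^(m+1/2) ψ(x)`. -/
theorem schrodinger_cpow_mul (m : ℂ) (ψ : ℝ → ℝ) {x : ℝ} (hx : 0 < x) :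
    -((x : ℂ) ^ (m + 1 / 2) * ((m + 1 / 2) * (m + 1 / 2 - 1) * (ψ x / x ^ 2 : ℝ) +
        2 * (m + 1 / 2) * (deriv ψ x / x : ℝ) + deriv (deriv ψ) x)) +
      (-1 / 4 + m ^ 2) / (x : ℂ) ^ 2 * ((x : ℂ) ^ (m + 1 / 2) * ψ x) =
    (x : ℂ) ^ (m + 1 / 2) * -((2 * m + 1) * (deriv ψ x / x : ℝ) + deriv (deriv ψ) x) := by
  have hx' : (x : ℂ) ≠ 0 := by exact_mod_cast hx.ne'
  push_cast
  field_simp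
  ring

theorem mem_LMax_graph_cpow_mul {m : ℂ} {ψ : ℝ → ℝ} (hψ : ContDiff ℝ ∞ ψ) {f g : HalfLineL2}
    (hf : ⇑f =ᵐ[halfLine] fun x => (x : ℂ) ^ (m + 1 / 2) * ψ x)
    (hg : ⇑g =ᵐ[halfLine] fun x => (x : ℂ) ^ (m + 1 / 2) *
      -((2 * m + 1) * (deriv ψ x / x : ℝ) + deriv (deriv ψ) x)) :
    (f, g) ∈ (LMax (m ^ 2)).graph := by
  refine mem_LMax_graph (fun x hx => contDiffAt_cpow_mul _ hψ hx)
    (fun x hx => contDiffAt_deriv_cpow_mul _ hψ hx) (fun x hx => hasDerivAt_cpow_mul _ hψ hx)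
    (fun x hx => hasDerivAt_deriv_cpow_mul _ hψ hx) hf ?_
  filter_upwards [hg, ae_restrict_mem measurableSet_Ioi] with x h1 hx
  rw [h1, schrodinger_cpow_mul m ψ hx]

/-- The bounds express second order vanishing of `ψ` at the origin and Gaussian decay. They put
`w/x²`, `w'/x` and `L w` in `L²` for `w = x^{m+1/2} ψ`, as each is `x^{m+1/2}` times a function
dominated by a Gaussian. -/
theorem exists_mem_LMin_graph_cpow_mul {m : ℂ} (hm : -1 < m.re) {a C : ℝ} (ha : 0 < a)
    {ψ : ℝ → ℝ} (hψ : ContDiff ℝ ∞ ψ)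
    (h0 : ∀ x > 0, |ψ x / x ^ 2| ≤ C * Real.exp (-(a / 2) * x ^ 2))
    (h1 : ∀ x > 0, |deriv ψ x / x| ≤ C * Real.exp (-(a / 2) * x ^ 2))
    (h2 : ∀ x > 0, |deriv (deriv ψ) x| ≤ C * Real.exp (-(a / 2) * x ^ 2)) {f : HalfLineL2}
    (hf : ⇑f =ᵐ[halfLine] fun x => (x : ℂ) ^ (m + 1 / 2) * ψ x) :
    ∃ g, (f, g) ∈ (LMin (m ^ 2)).graph := by
  have hψ₁ : ContDiff ℝ ∞ (deriv ψ) := (contDiff_infty_iff_deriv.mp hψ).2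
  have hψ₂ : ContDiff ℝ ∞ (deriv (deriv ψ)) := (contDiff_infty_iff_deriv.mp hψ₁).2
  have mc : Measurable fun x : ℝ => ((ψ x / x ^ 2 : ℝ) : ℂ) := Complex.measurable_ofReal.comp
    (hψ.continuous.measurable.div (measurable_id.pow_const 2))
  have md : Measurable fun x : ℝ => ((deriv ψ x / x : ℝ) : ℂ) := Complex.measurable_ofReal.comp
    (hψ₁.continuous.measurable.div measurable_id)
  have me : Measurable fun x : ℝ => ((deriv (deriv ψ) x : ℝ) : ℂ) :=
    Complex.measurable_ofReal.comp hψ₂.continuous.measurable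
  have hc := memLp_cpow_mul hm ha mc (C := C) fun x hx => by
    rw [Complex.norm_real]; exact h0 x hx
  have hd := memLp_cpow_mul hm ha md (C := C) fun x hx => by
    rw [Complex.norm_real]; exact h1 x hx
  have he := memLp_cpow_mul hm ha me (C := C) fun x hx => by
    rw [Complex.norm_real]; exact h2 x hx
  refine ⟨((hd.const_mul (2 * m + 1)).add he).neg.toLp _, ?_⟩
  refine mem_LMin_graph (fun x hx => contDiffAt_cpow_mul _ hψ hx)
    (fun x hx => contDiffAt_deriv_cpow_mul _ hψ hx) (fun x hx => hasDerivAt_cpow_mul _ hψ hx)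
    (fun x hx => hasDerivAt_deriv_cpow_mul _ hψ hx) (b := ((hc.const_mul (m + 1 / 2)).add hd).toLp _)
    (c := hc.toLp _) hf ?_ ?_ ?_
  · filter_upwards [((hd.const_mul (2 * m + 1)).add he).neg.coeFn_toLp,
      ae_restrict_mem measurableSet_Ioi] with x e1 hx
    rw [e1, schrodinger_cpow_mul m ψ hx]
    simp only [Pi.neg_apply, Pi.add_apply]
    ring
  · filter_upwards [((hc.const_mul (m + 1 / 2)).add hd).coeFn_toLp,
      ae_restrict_mem measurableSet_Ioi] with x e1 hx
    have hx' : (x : ℂ) ≠ 0 := by exact_mod_cast (ne_of_gt hx)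
    rw [e1]
    simp only [Pi.add_apply]
    push_cast
    field_simp
  · filter_upwards [hc.coeFn_toLp] with x e1
    rw [e1]
    push_cast
    ring

/-! ### Gaussians and the cutoff -/

theorem contDiff_gaussian (a : ℝ) : ContDiff ℝ ∞ fun x : ℝ => Real.exp (-(a / 2) * x ^ 2) :=
  Real.contDiff_exp.comp (by fun_prop)

theorem deriv_gaussian (a : ℝ) :
    deriv (fun x : ℝ => Real.exp (-(a / 2) * x ^ 2)) =
      fun x => -(a * x) * Real.exp (-(a / 2) * x ^ 2) := by
  funext x
  have h := (((hasDerivAt_pow 2 x).const_mul (-(a / 2))).exp).deriv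
  rw [h]
  push_cast
  ring

theorem deriv_deriv_gaussian (a : ℝ) :
    deriv (deriv (fun x : ℝ => Real.exp (-(a / 2) * x ^ 2))) =
      fun x => (-a + a ^ 2 * x ^ 2) * Real.exp (-(a / 2) * x ^ 2) := by
  rw [deriv_gaussian]
  funext x
  have h1 : HasDerivAt (fun x : ℝ => -(a * x)) (-a) x := by
    have h2 := ((hasDerivAt_id x).const_mul a).neg
    rw [mul_one] at h2
    exact h2
  have h := (h1.mul (((hasDerivAt_pow 2 x).const_mul (-(a / 2))).exp)).deriv
  refine h.trans ?_
  push_cast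
  ring

theorem gaussL2_mem_LMax_graph {m : ℂ} (hm : -1 < m.re) {a : ℝ} (ha : 0 < a) :
    (gaussL2 hm ha, gaussLap hm ha) ∈ (LMax (m ^ 2)).graph := by
  refine mem_LMax_graph_cpow_mul (contDiff_gaussian a) (gaussL2_coe hm ha) ?_
  filter_upwards [gaussLap_coe hm ha, ae_restrict_mem measurableSet_Ioi] with x h1 hx
  have hx' : (x : ℂ) ≠ 0 := by exact_mod_cast (ne_of_gt hx)
  rw [h1, deriv_deriv_gaussian, deriv_gaussian, gauss]
  push_cast
  field_simp
  ring

theorem exists_le_mul_exp {η : ℝ → ℝ} (h1 : Continuous η) (h2 : HasCompactSupport η) (a : ℝ) :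
    ∃ M, 0 ≤ M ∧ ∀ x, |η x| ≤ M * Real.exp (-(a / 2) * x ^ 2) := by
  have h3 : HasCompactSupport fun x => η x * Real.exp (a / 2 * x ^ 2) := h2.mul_right
  obtain ⟨M, hM⟩ := h3.exists_bound_of_continuous (by fun_prop)
  refine ⟨M, (norm_nonneg _).trans (hM 0), fun x => ?_⟩
  have h4 := hM x
  rw [norm_mul, Real.norm_of_nonneg (Real.exp_pos _).le] at h4
  rw [neg_mul, Real.exp_neg, ← div_eq_mul_inv, le_div_iff₀ (Real.exp_pos _)]
  exact h4

/-- Both functions behave like `x^{m+1/2}` at the origin, and `e^{-ax²/2} - ξ` vanishes there to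
second order. -/
theorem exists_mem_LMin_graph_gaussL2_sub {m : ℂ} (hm : -1 < m.re) {ξ : ℝ → ℝ}
    (hξ : ContDiff ℝ ∞ ξ) (hξc : HasCompactSupport ξ) (hξ1 : ∀ᶠ x in 𝓝 (0 : ℝ), ξ x = 1)
    {u : HalfLineL2} (hu : ⇑u =ᵐ[halfLine] fun x => (x : ℂ) ^ (m + 1 / 2) * ξ x)
    {a : ℝ} (ha : 0 < a) : ∃ v, (gaussL2 hm ha - u, v) ∈ (LMin (m ^ 2)).graph := by
  have hξ₁ : ContDiff ℝ ∞ (deriv ξ) := (contDiff_infty_iff_deriv.mp hξ).2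
  have hξ₂ : ContDiff ℝ ∞ (deriv (deriv ξ)) := (contDiff_infty_iff_deriv.mp hξ₁).2
  obtain ⟨M₀, hM₀, hb₀⟩ := exists_le_mul_exp hξ.continuous hξc (a / 2)
  obtain ⟨M₁, hM₁, hb₁⟩ := exists_le_mul_exp hξ₁.continuous (hξc.deriv (𝕜 := ℝ)) (a / 2)
  obtain ⟨M₂, hM₂, hb₂⟩ := exists_le_mul_exp hξ₂.continuous
    ((hξc.deriv (𝕜 := ℝ)).deriv (𝕜 := ℝ)) (a / 2)
  obtain ⟨δ, hδ, hδ1⟩ := Metric.eventually_nhds_iff.mp hξ1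
  have hone : ∀ x, 0 < x → x < δ → ξ x = 1 ∧ deriv ξ x = 0 := by
    intro x h1 h2
    have h3 : ∀ y, 0 < y → y < δ → ξ y = 1 := fun y h4 h5 => hδ1 (by
      rw [Real.dist_eq, sub_zero, abs_of_pos h4]; exact h5)
    refine ⟨h3 x h1 h2, ?_⟩
    have h4 : ξ =ᶠ[𝓝 x] fun _ => 1 := by
      filter_upwards [Ioo_mem_nhds h1 h2] with y hy
      exact h3 y hy.1 hy.2
    rw [h4.deriv_eq, deriv_const]
  -- `G` is the square root of the Gaussian; giving up half of the decay absorbs the factor `a x²`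
  -- from the second derivative, by `a x² G ≤ 4`.
  set G : ℝ → ℝ := fun x => Real.exp (-(a / 2 / 2) * x ^ 2) with hG
  have hG0 : ∀ x, 0 < G x := fun x => Real.exp_pos _
  have hG1 : ∀ x, G x ≤ 1 := fun x => Real.exp_le_one_iff.mpr (by
    have : 0 ≤ a / 2 / 2 * x ^ 2 := by positivity
    linarith)
  have hE : ∀ x : ℝ, Real.exp (-(a / 2) * x ^ 2) = G x * G x := fun x => by
    rw [hG, ← Real.exp_add]; congr 1; ring
  have hEG : ∀ x : ℝ, Real.exp (-(a / 2) * x ^ 2) ≤ G x := fun x => by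
    rw [hE]; exact mul_le_of_le_one_left (hG0 x).le (hG1 x)
  have hxG : ∀ x : ℝ, a * x ^ 2 * G x ≤ 4 := fun x => by
    have h1 := Real.add_one_le_exp (a / 2 / 2 * x ^ 2)
    have h2 : G x * Real.exp (a / 2 / 2 * x ^ 2) = 1 := by
      rw [hG, ← Real.exp_add]; simp
    have h3 := mul_le_mul_of_nonneg_left h1 (hG0 x).le
    nlinarith [hG0 x]
  set ψ : ℝ → ℝ := (fun x => Real.exp (-(a / 2) * x ^ 2)) - ξ with hψ
  have hψs : ContDiff ℝ ∞ ψ := (contDiff_gaussian a).sub hξ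
  have hψ₁ : deriv ψ = fun x => -(a * x) * Real.exp (-(a / 2) * x ^ 2) - deriv ξ x := by
    funext x
    rw [hψ, deriv_sub ((contDiff_gaussian a).differentiable (by simp) x)
      (hξ.differentiable (by simp) x), deriv_gaussian]
  have hψ₂ : deriv (deriv ψ) = fun x =>
      (-a + a ^ 2 * x ^ 2) * Real.exp (-(a / 2) * x ^ 2) - deriv (deriv ξ) x := by
    funext x
    have h1 : deriv ψ = deriv (fun x => Real.exp (-(a / 2) * x ^ 2)) - deriv ξ := by
      rw [hψ₁, deriv_gaussian]; rfl
    rw [h1, deriv_sub ((contDiff_infty_iff_deriv.mp (contDiff_gaussian a)).2.differentiable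
      (by simp) x) (hξ₁.differentiable (by simp) x), deriv_deriv_gaussian]
  -- The constant is the sum of those for the three bounds: the first two summands control `ψ/x²`
  -- for `x < δ` and `x ≥ δ`, the next two `ψ'/x`, the last two `ψ''`.
  refine exists_mem_LMin_graph_cpow_mul hm (half_pos ha)
    (C := a / 2 / G δ + (1 + M₀) / δ ^ 2 + a + M₁ / δ + 5 * a + M₂) hψs ?_ ?_ ?_ ?_
  · intro x hx
    change _ ≤ _ * G x
    have hrest : 0 ≤ a + M₁ / δ + 5 * a + M₂ := by positivity
    have hA : 0 ≤ a / 2 / G δ := div_nonneg (by positivity) (hG0 δ).le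
    have hB : 0 ≤ (1 + M₀) / δ ^ 2 := by positivity
    have key : |ψ x / x ^ 2| ≤ (a / 2 / G δ + (1 + M₀) / δ ^ 2) * G x := by
      rw [abs_div, abs_of_pos (show 0 < x ^ 2 by positivity), div_le_iff₀ (by positivity)]
      by_cases h : x < δ
      · have h1 : |ψ x| ≤ a / 2 * x ^ 2 := by
          rw [hψ, Pi.sub_apply, (hone x hx h).1, abs_sub_comm, abs_of_nonneg]
          · have := Real.add_one_le_exp (-(a / 2) * x ^ 2)
            linarith
          · have := (hEG x).trans (hG1 x)
            linarith
        have h2 : G δ ≤ G x := by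
          refine Real.exp_le_exp.mpr ?_
          have : x ^ 2 ≤ δ ^ 2 := by nlinarith
          nlinarith
        have h3 : a / 2 ≤ a / 2 / G δ * G x := by
          rw [div_mul_eq_mul_div, le_div_iff₀ (hG0 δ)]
          exact mul_le_mul_of_nonneg_left h2 (by positivity)
        have h4 : a / 2 ≤ (a / 2 / G δ + (1 + M₀) / δ ^ 2) * G x := by
          have := mul_nonneg hB (hG0 x).le
          linarith
        exact h1.trans (mul_le_mul_of_nonneg_right h4 (by positivity))
      · have h1 : |ψ x| ≤ (1 + M₀) * G x := by
          rw [hψ, Pi.sub_apply]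
          refine (abs_sub _ _).trans ?_
          rw [abs_of_pos (Real.exp_pos _)]
          have := hEG x
          have : |ξ x| ≤ M₀ * G x := hb₀ x
          linarith
        have h2 : (1 + M₀) ≤ (1 + M₀) / δ ^ 2 * x ^ 2 := by
          rw [div_mul_eq_mul_div, le_div_iff₀ (by positivity)]
          have : δ ^ 2 ≤ x ^ 2 := by nlinarith
          exact mul_le_mul_of_nonneg_left this (by positivity)
        have h3 := mul_le_mul_of_nonneg_right h2 (hG0 x).le
        have h4 := mul_nonneg (mul_nonneg hA (hG0 x).le) (sq_nonneg x)
        linarith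
    have := mul_nonneg hrest (hG0 x).le
    linarith
  · intro x hx
    change _ ≤ _ * G x
    have hrest : 0 ≤ a / 2 / G δ + (1 + M₀) / δ ^ 2 + 5 * a + M₂ := by
      have := hG0 δ
      positivity
    have key : |deriv ψ x / x| ≤ (a + M₁ / δ) * G x := by
      have h1 : deriv ψ x / x = -(a * Real.exp (-(a / 2) * x ^ 2)) - deriv ξ x / x := by
        rw [hψ₁]; field_simp
      have h2 : |deriv ξ x / x| ≤ M₁ / δ * G x := by
        by_cases h : x < δ
        · rw [(hone x hx h).2, zero_div, abs_zero]
          exact mul_nonneg (by positivity) (hG0 x).le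
        · rw [abs_div, abs_of_pos hx, div_mul_eq_mul_div]
          exact div_le_div₀ (mul_nonneg hM₁ (hG0 x).le) (hb₁ x) hδ (not_lt.mp h)
      rw [h1]
      refine (abs_sub _ _).trans ?_
      rw [abs_neg, abs_of_pos (mul_pos ha (Real.exp_pos _))]
      have := mul_le_mul_of_nonneg_left (hEG x) ha.le
      linarith
    have := mul_nonneg hrest (hG0 x).le
    linarith
  · intro x hx
    change _ ≤ _ * G x
    have hrest : 0 ≤ a / 2 / G δ + (1 + M₀) / δ ^ 2 + a + M₁ / δ := by
      have := hG0 δ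
      positivity
    have key : |deriv (deriv ψ) x| ≤ (5 * a + M₂) * G x := by
      rw [hψ₂]
      refine (abs_sub _ _).trans ?_
      have h1 : |(-a + a ^ 2 * x ^ 2) * Real.exp (-(a / 2) * x ^ 2)| ≤ 5 * a * G x := by
        rw [abs_mul, abs_of_pos (Real.exp_pos _), hE]
        have h2 : |-a + a ^ 2 * x ^ 2| ≤ a + a * (a * x ^ 2) := by
          refine (abs_add_le _ _).trans ?_
          rw [abs_neg, abs_of_pos ha, abs_of_nonneg (by positivity)]
          linarith [mul_self_nonneg a]
        have h3 : (a + a * (a * x ^ 2)) * G x ≤ 5 * a := by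
          have h4 := mul_le_mul_of_nonneg_left (hxG x) ha.le
          have h5 := mul_le_mul_of_nonneg_left (hG1 x) ha.le
          linarith
        have h6 := mul_le_mul_of_nonneg_right h2 (hG0 x).le
        have h7 := mul_le_mul_of_nonneg_right (h6.trans h3) (hG0 x).le
        linarith
      have : |deriv (deriv ξ) x| ≤ M₂ * G x := hb₂ x
      linarith
    have := mul_nonneg hrest (hG0 x).le
    linarith
  · filter_upwards [Lp.coeFn_sub (gaussL2 hm ha) u, gaussL2_coe hm ha, hu] with x e1 e2 e3
    rw [e1, Pi.sub_apply, e2, e3, gauss, hψ, Pi.sub_apply]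
    push_cast
    ring

theorem exists_cutoff {m : ℂ} (hm : -1 < m.re) {ξ : ℝ → ℝ} (hξ : Continuous ξ)
    (hξc : HasCompactSupport ξ) :
    ∃ u : HalfLineL2, ⇑u =ᵐ[halfLine] fun x => (x : ℂ) ^ (m + 1 / 2) * ξ x := by
  obtain ⟨M, hM, hb⟩ := exists_le_mul_exp hξ hξc 1
  have h := memLp_cpow_mul hm one_pos (β := fun x => (ξ x : ℂ)) (C := M)
    (Complex.measurable_ofReal.comp hξ.measurable) fun x _ => by
      rw [Complex.norm_real]; exact hb x
  exact ⟨h.toLp _, h.coeFn_toLp⟩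

/-! ### Diagonalization of the homogeneous Schrödinger operator -/

/-- The operator `Ξ_m⁻¹(A) X⁻² Ξ_m(A)`. -/
noncomputable def hankelConj {m : ℂ} (hm : -1 < m.re) : HalfLineL2 →ₗ.[ℂ] HalfLineL2 :=
  conjOp (XiA hm).toLinearEquiv (mulOp halfLine fun x => ((x : ℂ) ^ 2)⁻¹)

theorem inversion_coe (f : HalfLineL2) :
    ⇑(inversion f) =ᵐ[halfLine] fun x : ℝ => (x : ℂ)⁻¹ * f x⁻¹ :=
  (inversion_memLp f).coeFn_toLp

/-- The inversion conjugates multiplication by `x⁻²` to multiplication by `x²`, so the operator is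
`F X² F` with `F` the involution `hankelCLM`. -/
theorem mem_hankelConj_graph {m : ℂ} (hm : -1 < m.re) {f g : HalfLineL2} :
    (f, g) ∈ (hankelConj hm).graph ↔
      ⇑(hankelCLM hm g) =ᵐ[halfLine] fun x => (x : ℂ) ^ 2 * hankelCLM hm f x := by
  rw [hankelConj, mem_conjOp_graph, mulOp_graph]
  change ⇑(XiA hm g) =ᵐ[halfLine] (fun x => ((x : ℂ) ^ 2)⁻¹ * XiA hm f x) ↔ _
  constructor
  · intro h
    filter_upwards [inversion_coe (XiA hm f), inversion_coe (XiA hm g), inversion_qmp.ae h]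
      with x h1 h2 h3
    rw [hankelCLM_apply, hankelCLM_apply, h1, h2, h3]
    push_cast
    rw [inv_pow, inv_inv]
    ring
  · intro h
    have e : ∀ f, inversion (hankelCLM hm f) = XiA hm f := fun f => inversion_inversion _
    rw [← e f, ← e g]
    filter_upwards [inversion_coe (hankelCLM hm f), inversion_coe (hankelCLM hm g),
      inversion_qmp.ae h] with x h1 h2 h3
    rw [h1, h2, h3]
    push_cast
    ring

theorem gaussL2_mem_hankelConj_graph {m : ℂ} (hm : -1 < m.re) {a : ℝ} (ha : 0 < a) :
    (gaussL2 hm ha, gaussLap hm ha) ∈ (hankelConj hm).graph := by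
  rw [mem_hankelConj_graph, hankelCLM_gaussL2, hankelCLM_gaussLap]
  filter_upwards [Lp.coeFn_smul ((a : ℂ) ^ (-(m + 1))) (gaussL2 (add_two_re hm) (inv_pos.mpr ha)),
    Lp.coeFn_smul ((a : ℂ) ^ (-(m + 1))) (gaussL2 hm (inv_pos.mpr ha)),
    gaussL2_coe hm (inv_pos.mpr ha), gaussL2_coe (add_two_re hm) (inv_pos.mpr ha),
    ae_restrict_mem measurableSet_Ioi] with x h1 h2 h3 h4 hx
  rw [h1, h2, Pi.smul_apply, Pi.smul_apply, h3, h4, gauss_add_two m _ hx, smul_eq_mul, smul_eq_mul]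
  ring

/-- The operator contains the transpose of its own restriction to Gaussians. Moving the Hankel
transformation across the pairing, the hypothesis says that `F g - x² F f` integrates to zero
against every Gaussian. -/
theorem mem_hankelConj_graph_of_pairing {m : ℂ} (hm : -1 < m.re) {f g : HalfLineL2}
    (h : ∀ a (ha : 0 < a), pairing g (gaussL2 hm ha) = pairing f (gaussLap hm ha)) :
    (f, g) ∈ (hankelConj hm).graph := by
  rw [mem_hankelConj_graph]
  have hi : ∀ b (hb : 0 < b), IntegrableOn (fun x => hankelCLM hm g x * gauss m b x) (Ioi 0) ∧
      IntegrableOn (fun x : ℝ => (x : ℂ) ^ 2 * hankelCLM hm f x * gauss m b x) (Ioi 0) := by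
    intro b hb
    refine ⟨((Lp.memLp (hankelCLM hm g)).integrable_mul (memLp_gauss hm hb)),
      ((Lp.memLp (hankelCLM hm f)).integrable_mul (memLp_gauss (add_two_re hm) hb)).congr ?_⟩
    filter_upwards [ae_restrict_mem measurableSet_Ioi] with x hx
    rw [Pi.mul_apply, gauss_add_two m b hx]
    ring
  have key : ∀ b > 0, ∫ x in Ioi (0 : ℝ),
      (hankelCLM hm g x - (x : ℂ) ^ 2 * hankelCLM hm f x) * gauss m b x = 0 := by
    intro b hb
    have h1 := h b⁻¹ (inv_pos.mpr hb)
    rw [← hankelCLM_hankelCLM hm (gaussL2 hm (inv_pos.mpr hb)),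
      ← hankelCLM_hankelCLM hm (gaussLap hm (inv_pos.mpr hb)), ← pairing_hankelCLM hm g,
      ← pairing_hankelCLM hm f, hankelCLM_gaussL2, hankelCLM_gaussLap, map_smul, map_smul] at h1
    have h2 : ((b⁻¹ : ℝ) : ℂ) ^ (-(m + 1)) ≠ 0 := by
      rw [Complex.cpow_def_of_ne_zero (by exact_mod_cast (inv_pos.mpr hb).ne')]
      exact Complex.exp_ne_zero _
    have h3 := smul_right_injective ℂ h2 h1
    rw [pairing_apply, pairing_apply] at h3
    have e : ∀ x, (hankelCLM hm g x - (x : ℂ) ^ 2 * hankelCLM hm f x) * gauss m b x =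
        hankelCLM hm g x * gauss m b x - (x : ℂ) ^ 2 * hankelCLM hm f x * gauss m b x :=
      fun x => by ring
    simp only [e]
    rw [integral_sub (hi b hb).1 (hi b hb).2, sub_eq_zero]
    refine Eq.trans (integral_congr_ae ?_) (h3.trans (integral_congr_ae ?_))
    · filter_upwards [gaussL2_coe hm (inv_pos.mpr (inv_pos.mpr hb))] with x hx
      rw [hx, inv_inv]
    · filter_upwards [gaussL2_coe (add_two_re hm) (inv_pos.mpr (inv_pos.mpr hb)),
        ae_restrict_mem measurableSet_Ioi] with x hx hx'
      rw [hx, inv_inv, gauss_add_two m b hx']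
      ring
  have h0 := ae_zero_of_integral_gauss (m := m) (a₀ := 1)
    (D := fun x => hankelCLM hm g x - (x : ℂ) ^ 2 * hankelCLM hm f x)
    (((hi 1 one_pos).1.sub (hi 1 one_pos).2).congr (ae_of_all _ fun x => by
      simp only [Pi.sub_apply]; ring))
    fun a ha => key a (by linarith [show a ≥ 1 from ha])
  filter_upwards [h0] with x hx
  exact sub_eq_zero.mp hx

/-- The pairing condition with Gaussians is closed in the graph norm. It holds on test functions
because the Gaussians belong to the maximal operator, whose definition is exactly this duality. -/
theorem LMin_graph_le_hankelConj {m : ℂ} (hm : -1 < m.re) :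
    (LMin (m ^ 2)).graph ≤ (hankelConj hm).graph := by
  have hclosed : IsClosed {p : HalfLineL2 × HalfLineL2 | ∀ a (ha : 0 < a),
      pairing (gaussL2 hm ha) p.2 = pairing (gaussLap hm ha) p.1} := by
    simp only [ofPred_forall]
    exact isClosed_iInter fun a => isClosed_iInter fun ha =>
      isClosed_eq ((ContinuousLinearMap.continuous _).comp continuous_snd)
        ((ContinuousLinearMap.continuous _).comp continuous_fst)
  have hsub : (((LMax (m ^ 2)).domRestrict testSubmodule).graph : Set (HalfLineL2 × HalfLineL2)) ⊆
      {p | ∀ a (ha : 0 < a), pairing (gaussL2 hm ha) p.2 = pairing (gaussLap hm ha) p.1} := by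
    rintro ⟨f, g⟩ hp a ha
    obtain ⟨⟨φ, hφ, hf⟩, hfg⟩ := (mem_domRestrict_graph _ _ _).mp hp
    have h1 : f = hφ.memLp.toLp φ := Lp.ext (hf.trans hφ.memLp.coeFn_toLp.symm)
    have hL := (schrodingerExpr_isTest (m ^ 2) φ hφ).memLp
    have h2 : (f, hL.toLp _) ∈ (LMax (m ^ 2)).graph := mem_LMax_graph
      (fun x _ => hφ.contDiff.contDiffAt) (fun x _ => hφ.deriv.contDiff.contDiffAt)
      (fun x _ => (hφ.contDiff.differentiable (by simp) x).hasDerivAt)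
      (fun x _ => (hφ.deriv.contDiff.differentiable (by simp) x).hasDerivAt) hf hL.coeFn_toLp
    have h3 : g = hL.toLp _ := LinearPMap.mem_graph_snd_inj _ hfg h2 rfl
    have h4 := mem_LMax_graph_iff.mp (gaussL2_mem_LMax_graph hm ha) φ hφ
    show pairing (gaussL2 hm ha) g = pairing (gaussLap hm ha) f
    rw [h3, h1, pairing_comm, ← h4, pairing_comm]
  rintro ⟨f, g⟩ hp
  rw [LMin_graph] at hp
  have h := closure_minimal hsub hclosed hp
  exact mem_hankelConj_graph_of_pairing hm fun a ha => by
    rw [pairing_comm, pairing_comm f]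
    exact h a ha

/-- A closed subspace of the graph of `Ξ_m⁻¹(A) X⁻² Ξ_m(A)` which contains all Gaussians is the
whole graph. -/
theorem hankelConj_graph_le {m : ℂ} (hm : -1 < m.re)
    {S : Submodule ℂ (HalfLineL2 × HalfLineL2)} (hS : IsClosed (S : Set (HalfLineL2 × HalfLineL2)))
    (h : ∀ a (ha : 0 < a), (gaussL2 hm ha, gaussLap hm ha) ∈ S) : (hankelConj hm).graph ≤ S := by
  have hpos : ∀ x : ℝ, (0 : ℝ) < 1 + x ^ 2 := fun x => by positivity
  have hC₁ : ∀ x : ℝ, ‖((1 / (1 + x ^ 2) : ℝ) : ℂ)‖ ≤ 1 := fun x => by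
    rw [Complex.norm_real, Real.norm_of_nonneg (by positivity), div_le_one (hpos x)]
    nlinarith
  have hC₂ : ∀ x : ℝ, ‖((x ^ 2 / (1 + x ^ 2) : ℝ) : ℂ)‖ ≤ 1 := fun x => by
    rw [Complex.norm_real, Real.norm_of_nonneg (by positivity), div_le_one (hpos x)]
    linarith
  have hm₁ : Measurable fun x : ℝ => ((1 / (1 + x ^ 2) : ℝ) : ℂ) := by fun_prop
  have hm₂ : Measurable fun x : ℝ => ((x ^ 2 / (1 + x ^ 2) : ℝ) : ℂ) := by fun_prop
  -- `T` parametrizes the graph by all of `L²`: for `(f, g)` in it, `F f + F g = (1 + x²) F f`, from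
  -- which `F f` and `F g` are recovered by bounded multiplications. The preimage of `S` under `T`
  -- is closed and contains `(1 + x²) g_b` for every `b`.
  let T : HalfLineL2 →L[ℂ] HalfLineL2 × HalfLineL2 :=
    (hankelCLM hm ∘L boundedMul halfLine _ hm₁ 1 hC₁).prod
      (hankelCLM hm ∘L boundedMul halfLine _ hm₂ 1 hC₂)
  have hT : ∀ {f g : HalfLineL2}, (f, g) ∈ (hankelConj hm).graph →
      T (hankelCLM hm f + hankelCLM hm g) = (f, g) := by
    intro f g hfg
    rw [mem_hankelConj_graph] at hfg
    have hne : ∀ x : ℝ, (1 + (x : ℂ) ^ 2) ≠ 0 := fun x => by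
      exact_mod_cast (hpos x).ne'
    have e1 : boundedMul halfLine _ hm₁ 1 hC₁ (hankelCLM hm f + hankelCLM hm g) =
        hankelCLM hm f := by
      refine Lp.ext ?_
      filter_upwards [boundedMul_coe hm₁ hC₁ (hankelCLM hm f + hankelCLM hm g),
        Lp.coeFn_add (hankelCLM hm f) (hankelCLM hm g), hfg] with x h1 h2 h3
      have := hne x
      rw [h1, h2, Pi.add_apply, h3]
      push_cast
      field_simp
    have e2 : boundedMul halfLine _ hm₂ 1 hC₂ (hankelCLM hm f + hankelCLM hm g) =
        hankelCLM hm g := by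
      refine Lp.ext ?_
      filter_upwards [boundedMul_coe hm₂ hC₂ (hankelCLM hm f + hankelCLM hm g),
        Lp.coeFn_add (hankelCLM hm f) (hankelCLM hm g), hfg] with x h1 h2 h3
      have := hne x
      rw [h1, h2, Pi.add_apply, h3]
      push_cast
      field_simp
    refine Prod.ext ?_ ?_
    · show hankelCLM hm (boundedMul halfLine _ hm₁ 1 hC₁ _) = f
      rw [e1, hankelCLM_hankelCLM]
    · show hankelCLM hm (boundedMul halfLine _ hm₂ 1 hC₂ _) = g
      rw [e2, hankelCLM_hankelCLM]
  have htop : S.comap T.toLinearMap = ⊤ := by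
    refine eq_top_of_gauss_mem (m := m) (wt := fun x => 1 + (x : ℂ) ^ 2)
      (fun x _ => by exact_mod_cast (hpos x).ne') (hS.preimage T.continuous) fun b hb => ?_
    have ha : 0 < b⁻¹ := inv_pos.mpr hb
    have hc : ((b⁻¹ : ℝ) : ℂ) ^ (m + 1) * ((b⁻¹ : ℝ) : ℂ) ^ (-(m + 1)) = 1 := by
      rw [Complex.cpow_neg, mul_inv_cancel₀]
      rw [Complex.cpow_def_of_ne_zero (by exact_mod_cast ha.ne')]
      exact Complex.exp_ne_zero _
    refine ⟨((b⁻¹ : ℝ) : ℂ) ^ (m + 1) •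
      (hankelCLM hm (gaussL2 hm ha) + hankelCLM hm (gaussLap hm ha)), ?_, ?_⟩
    · refine Submodule.smul_mem _ _ ?_
      show T _ ∈ S
      rw [hT (gaussL2_mem_hankelConj_graph hm ha)]
      exact h _ ha
    · rw [hankelCLM_gaussL2, hankelCLM_gaussLap, ← smul_add, smul_smul, hc, one_smul]
      filter_upwards [Lp.coeFn_add (gaussL2 hm (inv_pos.mpr ha))
          (gaussL2 (add_two_re hm) (inv_pos.mpr ha)), gaussL2_coe hm (inv_pos.mpr ha),
        gaussL2_coe (add_two_re hm) (inv_pos.mpr ha), ae_restrict_mem measurableSet_Ioi]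
        with x h1 h2 h3 hx
      rw [h1, Pi.add_apply, h2, h3, inv_inv, gauss_add_two m b hx]
      ring
  rintro ⟨f, g⟩ hfg
  have : hankelCLM hm f + hankelCLM hm g ∈ S.comap T.toLinearMap := htop ▸ Submodule.mem_top
  have h2 : T (hankelCLM hm f + hankelCLM hm g) ∈ S := this
  rwa [hT hfg] at h2

/-- One inclusion: the cutoff function is a Gaussian minus an element of `Dom L^min`, and both lie
in the domain of the conjugated operator. The other: adding a line to the closed graph of `L^min`
keeps it closed, and the result contains the core of Gaussians. -/
theorem homogeneousSchrodinger_eq {m : ℂ} (hm : -1 < m.re) {ξ : ℝ → ℝ} (hξ : ContDiff ℝ ∞ ξ)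
    (hξc : HasCompactSupport ξ) (hξ1 : ∀ᶠ x in 𝓝 (0 : ℝ), ξ x = 1) :
    homogeneousSchrodinger m ξ = hankelConj hm := by
  obtain ⟨u, hu⟩ := exists_cutoff hm hξ.continuous hξc
  choose v hv using fun (a : ℝ) (ha : 0 < a) =>
    exists_mem_LMin_graph_gaussL2_sub hm hξ hξc hξ1 hu ha
  have hspan : {f : HalfLineL2 | ⇑f =ᵐ[halfLine] fun x => (x : ℂ) ^ (1 / 2 + m) * ξ x} = {u} := by
    ext f
    rw [mem_ofPred_eq, mem_singleton_iff, add_comm (1 / 2 : ℂ) m]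
    exact ⟨fun h => Lp.ext (h.trans hu.symm), fun h => h ▸ hu⟩
  set Lu := gaussLap hm one_pos - v 1 one_pos with hLu
  have hLmax : (u, Lu) ∈ (LMax (m ^ 2)).graph := by
    have h := (LMax (m ^ 2)).graph.sub_mem (gaussL2_mem_LMax_graph hm one_pos)
      (LMin_graph_le _ (hv 1 one_pos))
    simpa using h
  have hK : (u, Lu) ∈ (hankelConj hm).graph := by
    have h := (hankelConj hm).graph.sub_mem (gaussL2_mem_hankelConj_graph hm one_pos)
      (LMin_graph_le_hankelConj hm (hv 1 one_pos))
    simpa using h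
  have hH : ∀ p, p ∈ (homogeneousSchrodinger m ξ).graph ↔
      p.1 ∈ (LMin (m ^ 2)).domain ⊔ Submodule.span ℂ {u} ∧ p ∈ (LMax (m ^ 2)).graph := fun p => by
    rw [homogeneousSchrodinger, hspan]
    exact mem_domRestrict_graph _ _ p
  have hS : (LMin (m ^ 2)).graph ⊔ Submodule.span ℂ {(u, Lu)} ≤
      (homogeneousSchrodinger m ξ).graph := by
    refine sup_le (fun p hp => (hH p).mpr ⟨?_, LMin_graph_le _ hp⟩)
      ((Submodule.span_singleton_le_iff_mem _ _).mpr ((hH _).mpr ⟨?_, hLmax⟩))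
    · exact Submodule.mem_sup_left
        (LinearPMap.mem_domain_of_mem_graph (f := LMin (m ^ 2)) (x := p.1) (y := p.2) hp)
    · exact Submodule.mem_sup_right (Submodule.mem_span_singleton_self u)
  refine LinearPMap.eq_of_eq_graph (le_antisymm ?_ (le_trans (hankelConj_graph_le hm
    (Submodule.isClosed_sup_finiteDimensional _ _ (LMin_isClosed _)) fun a ha => ?_) hS))
  · rintro ⟨f, g⟩ hp
    obtain ⟨h1, h2⟩ := (hH _).mp hp
    obtain ⟨f₀, h3, w, h4, rfl⟩ := Submodule.mem_sup.mp h1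
    obtain ⟨c, rfl⟩ := Submodule.mem_span_singleton.mp h4
    have h5 := LinearPMap.mem_graph (LMin (m ^ 2)) ⟨f₀, h3⟩
    have h6 := (LMax (m ^ 2)).graph.add_mem (LMin_graph_le _ h5)
      ((LMax (m ^ 2)).graph.smul_mem c hLmax)
    have h7 := LinearPMap.mem_graph_snd_inj _ h2 h6 rfl
    rw [h7]
    exact (hankelConj hm).graph.add_mem (LMin_graph_le_hankelConj hm h5)
      ((hankelConj hm).graph.smul_mem c hK)
  · have h1 := (LMax (m ^ 2)).graph.sub_mem (gaussL2_mem_LMax_graph hm ha)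
      (LMin_graph_le _ (hv a ha))
    -- `Lu` was defined with `a = 1`; any other `a` gives the same vector because the maximal
    -- operator is single-valued. Hence one line suffices for all Gaussians.
    have h2 : gaussLap hm ha - v a ha = Lu :=
      LinearPMap.mem_graph_snd_inj _ h1 hLmax (by simp)
    refine Submodule.mem_sup.mpr ⟨_, hv a ha, _, Submodule.mem_span_singleton_self _, ?_⟩
    rw [← h2]
    simp

theorem mainTheorem8 (m : ℂ) (hm : -1 < m.re)
    (ξ : ℝ → ℝ) (hξ : ContDiff ℝ ∞ ξ) (hξc : HasCompactSupport ξ)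
    (hξ1 : ∀ᶠ x in 𝓝 (0 : ℝ), ξ x = 1) :
    ∃ ΞA : HalfLineL2 ≃L[ℂ] HalfLineL2,
      (∀ B : HalfLineL2 →L[ℂ] HalfLineL2,
        IsFunctionOf dilationGenerator (Xi m) B ↔ B = ΞA) ∧
      (∀ B : HalfLineL2 →L[ℂ] HalfLineL2,
        IsFunctionOf dilationGenerator (fun t => (Xi m t)⁻¹) B ↔ B = ΞA.symm) ∧
      hankel m = (inversion.toLinearMap ∘ₗ ΞA.toLinearEquiv.toLinearMap).toPMap ⊤ ∧
      hankel m = (ΞA.symm.toLinearEquiv.toLinearMap ∘ₗ inversion.toLinearMap).toPMap ⊤ ∧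
      homogeneousSchrodinger m ξ =
        conjOp ΞA.toLinearEquiv (mulOp halfLine fun x => ((x : ℂ) ^ 2)⁻¹) := by
  exact ⟨XiA hm, isFunctionOf_Xi_iff hm, isFunctionOf_Xi_inv_iff hm, hankel_eq_toPMap hm _ fun _ => rfl,
    hankel_eq_toPMap hm _ fun f => (hankelCLM_eq_symm hm f).symm,
    homogeneousSchrodinger_eq hm hξ hξc hξ1⟩
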